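/- For every $n\ge 1$ let $X_1,\dots,X_n$ be independent standard normal random variables (they may live on a different probability space for each $n$). For $\sigma\in\{-1,+1\}^n$ let $E(\sigma)=n^{-1/2}\bigl|\sum_{i=1}^n\sigma_iX_i\bigr|$; since $E(\sigma)=E(-\sigma)$, this is a function of the unordered partition $\{\sigma,-\sigma\}$. For $a\le b$ let $Z_n(a,b)$ be the number of the $2^{n-1}$ distinct partitions $\{\sigma,-\sigma\}$ with $E(\sigma)\in[a,b]$. Let $\alpha_n\ge 0$ be a sequence with $\alpha_n=o(\sqrt n)$, put $$\xi_n=\frac{1}{2^{n-1}g(\alpha_n)},\qquad g(y)=\sqrt{2/\pi}\,e^{-y^2/2},$$ where $g$ is the density of each $E(\sigma)$ on $[0,\infty)$, and for $t>0$ put $N_n(t)=Z_n(\alpha_n,\alpha_n+t\xi_n)$. Write $(Z)_k=Z(Z-1)\cdots(Z-k+1)$. (i) For every fixed $t>0$, $\mathbb E[N_n(t)]=t+o(1)$ as $n\to\infty$. (ii) Let $[c_1,d_1],\dots,[c_m,d_m]$ be finitely many intervals with $0\le c_\ell<d_\ell$ and pairwise disjoint interiors, let $k_1,\dots,k_m$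 be positive integers with $k=\sum_\ell k_\ell\ge 2$, and set $\gamma_\ell=d_\ell-c_\ell$, $a_n^\ell=\alpha_n+c_\ell\xi_n$, $b_n^\ell=\alpha_n+d_\ell\xi_n$. Then there are real sequences $u_n=O(\alpha_n^6n^{-2})$ and $v_n=o(1)$ such that for all sufficiently large $n$ $$\mathbb E\Bigl[\prod_{\ell=1}^m\bigl(Z_n(a_n^\ell,b_n^\ell)\bigr)_{k_\ell}\Bigr]=\Bigl(\prod_{\ell=1}^m\gamma_\ell^{k_\ell}\Bigr)\,e^{\frac{k(k-1)}{4n}\alpha_n^4}\,e^{u_n+v_n}.$$ (iii) In particular, factorization fails once $\alpha_n$ is at least of order $n^{1/4}$: if $n^{1/4}=O(\alpha_n)$, then for all intervals and integers as in (ii) there is $\delta>0$ such that for all sufficiently large $n$ the expectation on the left-hand side in (ii) is at least $(1+\delta)\prod_\ell\gamma_\ell^{k_\ell}$ and also at least $(1+\delta)\prod_\ell\bigl(\mathbb E[Z_n(a_n^\ell,b_n^\ell)]\bigr)^{k_\ell}$. -/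

import Mathlib

open MeasureTheory ProbabilityTheory Filter Asymptotics
open scoped NNReal ENNReal Topology

namespace NumberPartitioning

/-- Spin configurations `σ ∈ {-1, +1}ⁿ`. -/
abbrev Spin (n : ℕ) : Type := Fin n → ℤˣ

/-- The energy `E(σ) = n^{-1/2} |∑ᵢ σᵢ xᵢ|` of a configuration for the weights `x₁, …, xₙ`. -/
noncomputable def energy {n : ℕ} (x : Fin n → ℝ) (σ : Spin n) : ℝ :=
  |∑ i, (((σ i : ℤˣ) : ℤ) : ℝ) * x i| / √(n : ℝ)

/-- Two configurations describe the same (unordered) partition iff they agree up to a global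
spin flip. -/
def flipSetoid (n : ℕ) : Setoid (Spin n) where
  r σ τ := τ = σ ∨ τ = -σ
  iseqv :=
    { refl := fun _ => Or.inl rfl
      symm := by
        rintro σ τ (rfl | rfl)
        · exact Or.inl rfl
        · exact Or.inr (neg_neg σ).symm
      trans := by
        rintro σ τ υ (rfl | rfl) (rfl | rfl)
        · exact Or.inl rfl
        · exact Or.inr rfl
        · exact Or.inr rfl
        · exact Or.inl (neg_neg σ) }

/-- The distinct partitions of `{1, …, n}` into two sets; there are `2^{n-1}` of them
for `n ≥ 1`. -/
abbrev Partition (n : ℕ) : Type := Quotient (flipSetoid n)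

lemma energy_neg {n : ℕ} (x : Fin n → ℝ) (σ : Spin n) : energy x (-σ) = energy x σ := by
  simp [energy, Finset.sum_neg_distrib, abs_neg]

/-- The energy of a partition. -/
noncomputable def Partition.energy {n : ℕ} (x : Fin n → ℝ) (p : Partition n) : ℝ :=
  Quotient.lift (NumberPartitioning.energy x)
    (by
      rintro σ τ (rfl | rfl)
      · rfl
      · exact (energy_neg x σ).symm) p

/-- `Z_n(a, b)`: the number of points of the energy spectrum (the energies of the `2^{n-1}`
distinct partitions, with multiplicity) in the interval `[a, b]`. -/
noncomputable def numPoints {n : ℕ} (x : Fin n → ℝ) (a b : ℝ) : ℕ :=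
  Set.ncard {p : Partition n | Partition.energy x p ∈ Set.Icc a b}

/-- The density `g(y) = √(2/π) e^{-y²/2}` on `[0, ∞)` of the energy `E(σ)` for standard normal
weights; that this is the density is proved in `map_energy_eq_withDensity`. -/
noncomputable def energyDensity (y : ℝ) : ℝ :=
  √(2 / Real.pi) * Real.exp (-y ^ 2 / 2)

/-- The scaling factor `ξ_n = 1 / (2^{n-1} g(α))` at the energy scale `α` (for `n ≥ 1`). -/
noncomputable def scaling (n : ℕ) (α : ℝ) : ℝ :=
  1 / ((2 : ℝ) ^ (n - 1) * energyDensity α)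

section Density

variable {Ω : Type*} [MeasurableSpace Ω] {P : Measure Ω}

lemma map_abs_gaussian {H : Ω → ℝ} (hH : HasLaw H (gaussianReal 0 1) P) :
    P.map (fun ω => |H ω|) =
      (volume.restrict (Set.Ici (0 : ℝ))).withDensity
        (fun y => ENNReal.ofReal (energyDensity y)) := by
  have h1 : P.map (fun ω => |H ω|) = (gaussianReal 0 1).map (fun x : ℝ => |x|) := by
    rw [← hH.map_eq, AEMeasurable.map_map_of_aemeasurable (by fun_prop) hH.aemeasurable]
    rfl
  have hpdf : ∀ x : ℝ, gaussianPDF 0 1 |x| = gaussianPDF 0 1 x := by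
    intro x
    simp [gaussianPDF, gaussianPDFReal]
  have hdens : ∀ y : ℝ, ENNReal.ofReal (energyDensity y) = 2 * gaussianPDF 0 1 y := by
    intro y
    rw [gaussianPDF, show (2 : ℝ≥0∞) = ENNReal.ofReal 2 by simp,
      ← ENNReal.ofReal_mul (by norm_num)]
    congr 1
    simp only [energyDensity, gaussianPDFReal, NNReal.coe_one, mul_one, sub_zero]
    rw [← mul_assoc]
    congr 1
    have hpi := Real.pi_pos
    rw [← Real.sqrt_inv, show (2 / Real.pi : ℝ) = 2 ^ 2 * (2 * Real.pi)⁻¹ by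
      field_simp, Real.sqrt_mul (by positivity), Real.sqrt_sq (by norm_num)]
  have hf : Measurable (fun y : ℝ => ENNReal.ofReal (energyDensity y)) := by
    simp_rw [hdens]
    exact (measurable_gaussianPDF 0 1).const_mul 2
  rw [h1]
  ext s hs
  rw [Measure.map_apply (by fun_prop) hs, withDensity_apply _ hs,
    gaussianReal_apply _ one_ne_zero, Measure.restrict_restrict hs]
  have hA : MeasurableSet ((fun x : ℝ => |x|) ⁻¹' s) := by
    exact (by fun_prop : Measurable fun x : ℝ => |x|) hs
  have hcov : (∫⁻ x in ((fun x : ℝ => |x|) ⁻¹' s) ∩ Set.Iio 0, gaussianPDF 0 1 x)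
      = ∫⁻ x in s ∩ Set.Ioi 0, gaussianPDF 0 1 x := by
    have hmp : MeasurePreserving (fun x : ℝ => -x) volume volume := Measure.measurePreserving_neg _
    have hme : MeasurableEmbedding (fun x : ℝ => -x) := (MeasurableEquiv.neg ℝ).measurableEmbedding
    rw [← hmp.setLIntegral_comp_preimage_emb hme]
    have hset : (fun x : ℝ => -x) ⁻¹' (((fun x : ℝ => |x|) ⁻¹' s) ∩ Set.Iio 0)
        = s ∩ Set.Ioi 0 := by
      ext x
      simp only [Set.mem_preimage, Set.mem_inter_iff, abs_neg, Set.mem_Iio, Set.mem_Ioi,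
        neg_lt_zero]
      refine ⟨fun h => ⟨?_, h.2⟩, fun h => ⟨?_, h.2⟩⟩
      · simpa [abs_of_pos h.2] using h.1
      · simpa [abs_of_pos h.2] using h.1
    rw [hset]
    refine lintegral_congr fun x => ?_
    rw [← hpdf (-x), abs_neg, hpdf]
  have hpos : ((fun x : ℝ => |x|) ⁻¹' s) \ Set.Iio 0 = s ∩ Set.Ici 0 := by
    ext x
    simp only [Set.mem_preimage, Set.mem_sdiff, Set.mem_inter_iff, Set.mem_Iio, Set.mem_Ici, not_lt]
    refine ⟨fun h => ⟨?_, h.2⟩, fun h => ⟨?_, h.2⟩⟩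
    · simpa [abs_of_nonneg h.2] using h.1
    · simpa [abs_of_nonneg h.2] using h.1
  have hae : (s ∩ Set.Ioi (0 : ℝ) : Set ℝ) =ᵐ[volume] (s ∩ Set.Ici (0 : ℝ) : Set ℝ) :=
    (ae_eq_refl s).inter Ioi_ae_eq_Ici
  rw [← lintegral_inter_add_sdiff _ _ (measurableSet_Iio (a := (0 : ℝ))), hcov, hpos,
    setLIntegral_congr hae]
  simp_rw [hdens]
  rw [lintegral_const_mul _ (measurable_gaussianPDF 0 1), two_mul]

/-- For independent standard normal weights and `n ≥ 1`, every energy `E(σ)` has density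
`energyDensity` with respect to Lebesgue measure on `[0, ∞)`. -/
theorem map_energy_eq_withDensity {n : ℕ} (hn : 0 < n)
    {X : Fin n → Ω → ℝ} (hind : iIndepFun X P)
    (hlaw : ∀ i, HasLaw (X i) (gaussianReal 0 1) P) (σ : Spin n) :
    P.map (fun ω => energy (fun i => X i ω) σ) =
      (volume.restrict (Set.Ici (0 : ℝ))).withDensity
        (fun y => ENNReal.ofReal (energyDensity y)) := by
  have hprob : IsProbabilityMeasure P := hind.isProbabilityMeasure
  let Y : Fin n → Ω → ℝ := fun i ω => (((σ i : ℤˣ) : ℤ) : ℝ) * X i ω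
  have hYlaw : ∀ i, HasLaw (Y i) (gaussianReal 0 1) P := by
    intro i
    have h := gaussianReal_const_mul (hlaw i) (((σ i : ℤˣ) : ℤ) : ℝ)
    have hv : (NNReal.mk ((((σ i : ℤˣ) : ℤ) : ℝ) ^ 2) (sq_nonneg _) * 1 : ℝ≥0) = 1 := by
      rcases Int.units_eq_one_or (σ i) with h' | h' <;> ext <;> simp [h']
    rwa [hv, mul_zero] at h
  have hYind : iIndepFun Y P :=
    hind.comp (fun i x => (((σ i : ℤˣ) : ℤ) : ℝ) * x) (fun i => by fun_prop)
  have key : ∀ s : Finset (Fin n),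
      HasLaw (∑ i ∈ s, Y i) (gaussianReal 0 (s.card : ℝ≥0)) P := by
    intro s
    induction s using Finset.induction_on with
    | empty =>
      refine ⟨by simp; fun_prop, ?_⟩
      simp only [Finset.sum_empty, Finset.card_empty, Nat.cast_zero, gaussianReal_zero_var]
      rw [show (0 : Ω → ℝ) = fun _ => (0 : ℝ) from rfl, Measure.map_const]
      simp
    | insert i s hi ih =>
      rw [Finset.sum_insert hi, add_comm]
      refine ⟨ih.aemeasurable.add (hYlaw i).aemeasurable, ?_⟩
      rw [gaussianReal_add_gaussianReal_of_indepFun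
        (hYind.indepFun_finsetSum_of_notMem₀ (fun j => (hYlaw j).aemeasurable) hi)
        ih.map_eq (hYlaw i).map_eq, Finset.card_insert_of_notMem hi]
      simp
  have hH : HasLaw (fun ω => (∑ i, Y i) ω / √(n : ℝ)) (gaussianReal 0 1) P := by
    have h := gaussianReal_div_const (key Finset.univ) (√(n : ℝ))
    have hn' : (0 : ℝ) < n := by exact_mod_cast hn
    have hv : (((Finset.univ : Finset (Fin n)).card : ℝ≥0) /
        NNReal.mk (√(n : ℝ) ^ 2) (sq_nonneg _) : ℝ≥0) = 1 := by
      ext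
      simp [hn'.ne']
    rwa [hv, zero_div] at h
  rw [← map_abs_gaussian hH]
  congr 1
  funext ω
  simp [energy, Y, abs_div, abs_of_nonneg (Real.sqrt_nonneg _)]

end Density

end NumberPartitioning

/-! Off a null set, a partition with energy in `[a, b]`, `0 ≤ a`, has exactly one representative
whose signed energy lies in `[a, b]`. A mixed factorial moment is therefore a sum over k-tuples of
configurations of the probability that a centred Gaussian vector, with the overlap matrix Q as
covariance, falls into a small box near (α, ..., α) (`integral_prod_descFactorial`).

Main term. For Q near 1, Q⁻¹ is close to 2 - Q, so the density on the box is about (2π)^(-k/2)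
exp(-kα²/2 + β ∑ᵢ Sᵢ), where β = α²/n and Sᵢ is the `pairSum` of the spins at site i. The scaling ξ
makes (2π)^(-k/2) exp(-kα²/2) times the volume of the box equal to 2^(-nk) ∏ γ. What remains is the
average of exp(β ∑ᵢ Sᵢ) over uniform tuples, which factors over sites into `pairMGF β ^ n`. Since S
has mean 0 and variance k(k-1)/2, log `pairMGF β` = k(k-1)β²/4 + O(β³), and the n-th power produces
k(k-1)α⁴/(4n) + O(α⁶/n²).

For the upper bound no closeness to 1 is needed in the exponent, because Q⁻¹ ≥ 2 - Q for every
positive definite Q. For the lower bound the error is at most kα²‖Q - 1‖² up to the window error.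
Jensen's inequality under the law tilted by exp(β ∑ᵢ Sᵢ), where ‖Q - 1‖² has mean O(1/n + β²), turns
it into O(β + α⁶/n²) in the exponent (`le_sum_nearOrthogonal`).

The other tuples are negligible, since α² = o(n) makes exp(kα²/2) subexponential. Independent tuples
with a large overlap are exponentially rare by Chernoff, and their density is only polynomially
larger because det(nQ) is a positive integer. A dependent tuple of distinct partitions is
determined, up to boundedly many choices, by an independent subtuple of some size r that omits a
sign pattern; there are at most C(2^r - 1)^n of these against a probability of order 2^(-nr)
(`sum_dependent_le`). Tuples with two parallel entries have probability zero.

If n^(1/4) = O(α), then α⁴/n is bounded below and α⁶/n² = (α²/n)(α⁴/n) is negligible beside it, so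
the exponential factor stays away from 1. -/

namespace NumberPartitioning

/-! ### Densities of linear images of a standard Gaussian vector -/

section GaussianDensity

open Matrix

variable {ι κ m : Type*} [Fintype ι] [Fintype κ] [Fintype m]

/-- The law of a family of independent standard normal variables. -/
noncomputable abbrev stdGaussianPi (m : Type*) [Fintype m] : Measure (m → ℝ) :=
  Measure.pi fun _ => gaussianReal 0 1

lemma charFunDual_stdGaussianPi (L : StrongDual ℝ (m → ℝ)) [DecidableEq m] :
    charFunDual (stdGaussianPi m) L
      = Complex.exp (-((∑ i, L (Pi.single i 1) ^ 2 : ℝ) : ℂ) / 2) := by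
  rw [charFunDual_pi]
  have h : ∀ i, charFunDual (gaussianReal 0 1) (L.comp (.single ℝ (fun _ => ℝ) i))
      = Complex.exp (-((L (Pi.single i 1) ^ 2 : ℝ) : ℂ) / 2) := by
    intro i
    have hL : ∀ x : ℝ, L.comp (.single ℝ (fun _ => ℝ) i) x = L (Pi.single i 1) * x := by
      intro x
      have : (Pi.single i x : m → ℝ) = x • Pi.single i (1 : ℝ) := by
        rw [← Pi.single_smul]; simp
      simp [this, mul_comm]
    rw [charFunDual_eq_charFun_map_one,
      show (⇑(L.comp (.single ℝ (fun _ => ℝ) i)) : ℝ → ℝ) = fun x => L (Pi.single i 1) * x from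
        funext hL, gaussianReal_map_const_mul, charFun_gaussianReal]
    congr 1
    simp
    ring
  simp_rw [h, ← Complex.exp_sum]
  congr 1
  push_cast
  rw [← Finset.sum_div, Finset.sum_neg_distrib]

lemma sum_dual_mulVec_single_sq (A : Matrix ι m ℝ) [DecidableEq m] [DecidableEq ι]
    (L : StrongDual ℝ (ι → ℝ)) :
    ∑ i, L (A *ᵥ Pi.single i 1) ^ 2
      = (fun s => L (Pi.single s 1)) ⬝ᵥ (A * Aᵀ) *ᵥ (fun s => L (Pi.single s 1)) := by
  have hL : ∀ v : ι → ℝ, L v = (fun s => L (Pi.single s 1)) ⬝ᵥ v := by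
    intro v
    conv_lhs => rw [← Finset.univ_sum_single v]
    rw [map_sum, dotProduct]
    refine Finset.sum_congr rfl fun s _ => ?_
    have : (Pi.single s (v s) : ι → ℝ) = v s • Pi.single s (1 : ℝ) := by
      rw [← Pi.single_smul]; simp
    rw [this, map_smul, smul_eq_mul, mul_comm]
  set l : ι → ℝ := fun s => L (Pi.single s 1) with hl
  rw [← Matrix.mulVec_mulVec, Matrix.dotProduct_mulVec, Matrix.mulVec_transpose, dotProduct]
  refine Finset.sum_congr rfl fun i _ => ?_
  rw [hL, Matrix.dotProduct_mulVec, dotProduct_single, mul_one, sq]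

/-- The law of a linear image of a standard Gaussian vector depends on the covariance only. -/
lemma map_mulVec_stdGaussianPi_congr (A : Matrix ι m ℝ) (M : Matrix ι κ ℝ)
    (h : A * Aᵀ = M * Mᵀ) :
    (stdGaussianPi m).map (fun x => A *ᵥ x) = (stdGaussianPi κ).map (fun x => M *ᵥ x) := by
  classical
  have hA : (fun x => A *ᵥ x) = ⇑(LinearMap.toContinuousLinearMap A.mulVecLin) := by
    ext x; simp
  have hM : (fun x => M *ᵥ x) = ⇑(LinearMap.toContinuousLinearMap M.mulVecLin) := by
    ext x; simp
  have : IsProbabilityMeasure ((stdGaussianPi m).map (fun x => A *ᵥ x)) := by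
    rw [hA]; exact Measure.isProbabilityMeasure_map (by fun_prop)
  have : IsProbabilityMeasure ((stdGaussianPi κ).map (fun x => M *ᵥ x)) := by
    rw [hM]; exact Measure.isProbabilityMeasure_map (by fun_prop)
  refine Measure.ext_of_charFunDual ?_
  ext L
  rw [hA, hM, charFunDual_map, charFunDual_map, charFunDual_stdGaussianPi,
    charFunDual_stdGaussianPi]
  congr 4
  simp only [ContinuousLinearMap.comp_apply, LinearMap.coe_toContinuousLinearMap',
    Matrix.mulVecLin_apply]
  rw [sum_dual_mulVec_single_sq, sum_dual_mulVec_single_sq, h]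

lemma stdGaussianPi_eq_withDensity :
    stdGaussianPi ι = volume.withDensity fun x : ι → ℝ =>
      ENNReal.ofReal ((√(2 * Real.pi))⁻¹ ^ Fintype.card ι * Real.exp (-(x ⬝ᵥ x) / 2)) := by
  refine (Measure.pi_eq fun s hs => ?_)
  rw [withDensity_apply _ (MeasurableSet.univ_pi hs), volume_pi, Measure.restrict_pi_pi]
  have hi : ∀ i, Integrable (gaussianPDFReal 0 1) ((volume : Measure ℝ).restrict (s i)) :=
    fun i => (integrable_gaussianPDFReal 0 1).restrict
  have hp : ∀ x : ι → ℝ,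
      (√(2 * Real.pi))⁻¹ ^ Fintype.card ι * Real.exp (-(x ⬝ᵥ x) / 2)
        = ∏ i, gaussianPDFReal 0 1 (x i) := by
    intro x
    simp only [gaussianPDFReal, Finset.prod_mul_distrib, Finset.prod_const, Finset.card_univ,
      ← Real.exp_sum, dotProduct]
    congr 2
    · simp
    · simp [← Finset.sum_div, sq]
  simp_rw [hp]
  rw [← ofReal_integral_eq_lintegral_ofReal (Integrable.fintype_prod hi)
    (Eventually.of_forall fun x => Finset.prod_nonneg fun i _ => gaussianPDFReal_nonneg _ _ _),
    integral_fintype_prod_eq_prod (fun _ => gaussianPDFReal 0 1), ENNReal.ofReal_prod_of_nonneg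
    (fun i _ => integral_nonneg fun x => gaussianPDFReal_nonneg _ _ _)]
  refine Finset.prod_congr rfl fun i _ => ?_
  rw [gaussianReal_apply _ one_ne_zero, ofReal_integral_eq_lintegral_ofReal (hi i)
    (Eventually.of_forall fun x => gaussianPDFReal_nonneg _ _ _)]
  rfl

variable [DecidableEq ι]

/-- The density of the centred normal law with covariance matrix `Q`. -/
noncomputable def gaussianDensity (Q : Matrix ι ι ℝ) (x : ι → ℝ) : ℝ :=
  (√(2 * Real.pi))⁻¹ ^ Fintype.card ι * (√Q.det)⁻¹ * Real.exp (-(x ⬝ᵥ Q⁻¹ *ᵥ x) / 2)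

/-- `A` may be rectangular, so no change of variables applies to it directly. As the law depends on
`A * Aᵀ` only, `A` is replaced by an invertible square `Bᵀ` with `Bᵀ * B` the same covariance. -/
lemma map_mulVec_stdGaussianPi_eq_withDensity (A : Matrix ι m ℝ) (hA : (A * Aᵀ).PosDef) :
    (stdGaussianPi m).map (fun x => A *ᵥ x)
      = volume.withDensity fun x => ENNReal.ofReal (gaussianDensity (A * Aᵀ) x) := by
  obtain ⟨B, hB⟩ := by
    open scoped MatrixOrder in
    exact CStarAlgebra.nonneg_iff_eq_star_mul_self.mp hA.posSemidef.nonneg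
  set Q := A * Aᵀ with hQ
  have hB' : Q = Bᵀ * B := by
    rw [hB, Matrix.star_eq_conjTranspose, conjTranspose_eq_transpose_of_trivial]
  rw [map_mulVec_stdGaussianPi_congr A Bᵀ (by rw [← hQ, hB', transpose_transpose])]
  have hdetQ : Q.det = B.det ^ 2 := by rw [hB', det_mul, det_transpose, sq]
  have hdet0 : B.det ≠ 0 := by
    intro h
    have := hA.det_pos
    rw [hdetQ, h] at this
    simp at this
  have hdet : LinearMap.det (Matrix.toLin' Bᵀ) ≠ 0 := by
    rwa [LinearMap.det_toLin', det_transpose]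
  have hu : IsUnit B.det := hdet0.isUnit
  have huT : IsUnit Bᵀ.det := by rwa [det_transpose]
  have hmul : Measurable fun x : ι → ℝ => Bᵀ *ᵥ x :=
    (LinearMap.continuous_of_finiteDimensional (Matrix.toLin' Bᵀ)).measurable
  have hquad : ∀ x : ι → ℝ, (Bᵀ *ᵥ x) ⬝ᵥ Q⁻¹ *ᵥ (Bᵀ *ᵥ x) = x ⬝ᵥ x := by
    intro x
    rw [hB', Matrix.mul_inv_rev, mulVec_mulVec, Matrix.mul_assoc, Matrix.nonsing_inv_mul _ huT,
      Matrix.mul_one, mulVec_transpose, ← dotProduct_mulVec, mulVec_mulVec,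
      Matrix.mul_nonsing_inv _ hu, one_mulVec]
  rw [stdGaussianPi_eq_withDensity]
  ext S hS
  -- The change of variables by `Bᵀ`, integrated against the target density over `S`. The Jacobian
  -- factor and the factor `(√Q.det)⁻¹` of the density are both `|B.det|⁻¹` and cancel at the end.
  have hmap := congrArg (fun μ : Measure (ι → ℝ) => μ.withDensity
    (fun x => ENNReal.ofReal (gaussianDensity Q x)) S)
    (Measure.map_linearMap_addHaar_eq_smul_addHaar (volume : Measure (ι → ℝ)) hdet)
  have hmeas : Measurable fun x : ι → ℝ => ENNReal.ofReal (gaussianDensity Q x) := by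
    refine ENNReal.measurable_ofReal.comp ?_
    unfold gaussianDensity
    have : Continuous fun x : ι → ℝ => x ⬝ᵥ Q⁻¹ *ᵥ x :=
      continuous_id.dotProduct (continuous_const.matrix_mulVec continuous_id)
    fun_prop
  simp only [withDensity_apply _ hS] at hmap
  rw [Measure.restrict_smul, lintegral_smul_measure, Measure.restrict_map (by exact hmul) hS,
    lintegral_map hmeas (by exact hmul)] at hmap
  rw [Measure.map_apply hmul hS, withDensity_apply _ (hmul hS), withDensity_apply _ hS]
  have hpos : 0 < |B.det| := abs_pos.mpr hdet0
  simp only [LinearMap.det_toLin', det_transpose, Matrix.toLin'_apply, gaussianDensity, hquad,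
    hdetQ, Real.sqrt_sq_eq_abs, smul_eq_mul] at hmap ⊢
  have hc : ∀ t : ℝ, ENNReal.ofReal ((√(2 * Real.pi))⁻¹ ^ Fintype.card ι * |B.det|⁻¹ * t)
      = ENNReal.ofReal |B.det⁻¹|
        * ENNReal.ofReal ((√(2 * Real.pi))⁻¹ ^ Fintype.card ι * t) := by
    intro t
    rw [← ENNReal.ofReal_mul (abs_nonneg _), abs_inv]
    ring_nf
  have h0 : ENNReal.ofReal |B.det⁻¹| ≠ 0 := by
    rw [abs_inv]
    exact (ENNReal.ofReal_pos.mpr (inv_pos.mpr hpos)).ne'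
  simp_rw [hc] at hmap ⊢
  rw [lintegral_const_mul' _ _ ENNReal.ofReal_ne_top,
    lintegral_const_mul' _ _ ENNReal.ofReal_ne_top] at hmap
  rw [lintegral_const_mul' _ _ ENNReal.ofReal_ne_top]
  exact (ENNReal.mul_right_inj h0 ENNReal.ofReal_ne_top).mp hmap

end GaussianDensity
-- The inverse quadratic form near the identity
section QuadraticForm

open Matrix

variable {ι : Type*} [Fintype ι]

lemma dotProduct_mulVec_eq_sum (Q : Matrix ι ι ℝ) (x : ι → ℝ) :
    x ⬝ᵥ Q *ᵥ x = ∑ s, ∑ t, Q s t * (x s * x t) := by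
  simp only [dotProduct, mulVec, Finset.mul_sum]
  exact Finset.sum_congr rfl fun s _ => Finset.sum_congr rfl fun t _ => by ring

variable [DecidableEq ι]

/-- First-order Neumann expansion with exact remainder: Q⁻¹ = 2 - Q + (1 - Q⁻¹) Q (1 - Q⁻¹). The
remainder is a nonnegative form, which gives the lower bound for free. -/
lemma dotProduct_inv_mulVec_eq {Q : Matrix ι ι ℝ} (hQ : Q.PosDef) (x : ι → ℝ) :
    x ⬝ᵥ Q⁻¹ *ᵥ x
      = 2 * (x ⬝ᵥ x) - x ⬝ᵥ Q *ᵥ x + (x - Q⁻¹ *ᵥ x) ⬝ᵥ Q *ᵥ (x - Q⁻¹ *ᵥ x) := by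
  have hy : Q *ᵥ (Q⁻¹ *ᵥ x) = x := by
    rw [mulVec_mulVec, Matrix.mul_nonsing_inv _ (hQ.det_pos.ne'.isUnit), one_mulVec]
  have hsymm : (Q⁻¹ *ᵥ x) ⬝ᵥ Q *ᵥ x = x ⬝ᵥ x := by
    have hT : Qᵀ = Q := by
      have := hQ.isHermitian.eq
      rwa [conjTranspose_eq_transpose_of_trivial] at this
    rw [dotProduct_mulVec, ← mulVec_transpose, hT, hy]
  rw [mulVec_sub, hy, dotProduct_sub, sub_dotProduct, sub_dotProduct, hsymm,
    dotProduct_comm (Q⁻¹ *ᵥ x) x]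
  ring

lemma le_dotProduct_inv_mulVec {Q : Matrix ι ι ℝ} (hQ : Q.PosDef) (x : ι → ℝ) :
    2 * (x ⬝ᵥ x) - x ⬝ᵥ Q *ᵥ x ≤ x ⬝ᵥ Q⁻¹ *ᵥ x := by
  rw [dotProduct_inv_mulVec_eq hQ x]
  have := hQ.posSemidef.dotProduct_mulVec_nonneg (x - Q⁻¹ *ᵥ x)
  simp only [star_trivial] at this
  linarith

lemma dotProduct_inv_mulVec_le {Q : Matrix ι ι ℝ} (hQ : Q.PosDef)
    (h : ∀ z, (z ⬝ᵥ z) / 2 ≤ z ⬝ᵥ Q *ᵥ z) (x : ι → ℝ) :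
    x ⬝ᵥ Q⁻¹ *ᵥ x
      ≤ 2 * (x ⬝ᵥ x) - x ⬝ᵥ Q *ᵥ x + 2 * ((Q *ᵥ x - x) ⬝ᵥ (Q *ᵥ x - x)) := by
  rw [dotProduct_inv_mulVec_eq hQ x]
  have hy : Q *ᵥ (Q⁻¹ *ᵥ x) = x := by
    rw [mulVec_mulVec, Matrix.mul_nonsing_inv _ (hQ.det_pos.ne'.isUnit), one_mulVec]
  have h1 := h (x - Q⁻¹ *ᵥ x)
  have h2 : Q *ᵥ (x - Q⁻¹ *ᵥ x) = Q *ᵥ x - x := by rw [mulVec_sub, hy]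
  rw [h2] at h1 ⊢
  set z := x - Q⁻¹ *ᵥ x
  set u := Q *ᵥ x - x
  -- Expand |z/2 - u|² ≥ 0. Together with |z|²/2 ≤ z·u this yields z·u ≤ 2|u|², the bound on the
  -- remainder.
  have h3 : z ⬝ᵥ u ≤ (z ⬝ᵥ z) / 4 + u ⬝ᵥ u := by
    have : 0 ≤ ((1 / 2 : ℝ) • z - u) ⬝ᵥ ((1 / 2 : ℝ) • z - u) :=
      Finset.sum_nonneg fun i _ => mul_self_nonneg _
    simp only [sub_dotProduct, dotProduct_sub, smul_dotProduct, dotProduct_smul, smul_eq_mul,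
      dotProduct_comm u z] at this
    linarith
  linarith

lemma half_dotProduct_le_of_near_one {Q : Matrix ι ι ℝ} {ε : ℝ}
    (hQ : ∀ s t, |Q s t - (1 : Matrix ι ι ℝ) s t| ≤ ε) (hε : Fintype.card ι * ε ≤ 1 / 2)
    (z : ι → ℝ) : (z ⬝ᵥ z) / 2 ≤ z ⬝ᵥ Q *ᵥ z := by
  have h1 : z ⬝ᵥ Q *ᵥ z = z ⬝ᵥ z + z ⬝ᵥ (Q - 1) *ᵥ z := by
    rw [sub_mulVec, dotProduct_sub, one_mulVec]; ring
  have h2 : -(Fintype.card ι * ε * (z ⬝ᵥ z)) ≤ z ⬝ᵥ (Q - 1) *ᵥ z := by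
    rw [dotProduct_mulVec_eq_sum]
    have h3 : ∀ s t, -(ε * ((z s ^ 2 + z t ^ 2) / 2)) ≤ (Q - 1) s t * (z s * z t) := by
      intro s t
      have h4 : |(Q - 1) s t * (z s * z t)| ≤ ε * ((z s ^ 2 + z t ^ 2) / 2) := by
        rw [abs_mul]
        refine mul_le_mul (hQ s t) ?_ (abs_nonneg _) ((abs_nonneg _).trans (hQ s t))
        rw [abs_le]
        constructor <;> nlinarith [sq_nonneg (z s + z t), sq_nonneg (z s - z t)]
      exact (abs_le.mp h4).1
    calc -(Fintype.card ι * ε * (z ⬝ᵥ z))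
        = ∑ s, ∑ t, -(ε * ((z s ^ 2 + z t ^ 2) / 2)) := by
          simp only [Finset.sum_neg_distrib, ← Finset.mul_sum, ← Finset.sum_div,
            Finset.sum_add_distrib, Finset.sum_const, Finset.card_univ, nsmul_eq_mul, dotProduct,
            sq]
          ring_nf
          rw [← Finset.mul_sum]
          ring
      _ ≤ _ := Finset.sum_le_sum fun s _ => Finset.sum_le_sum fun t _ => h3 s t
  have h5 : 0 ≤ z ⬝ᵥ z := Finset.sum_nonneg fun i _ => mul_self_nonneg _
  nlinarith

lemma posDef_of_near_one {Q : Matrix ι ι ℝ} (hT : Q.IsHermitian) {ε : ℝ}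
    (hQ : ∀ s t, |Q s t - (1 : Matrix ι ι ℝ) s t| ≤ ε) (hε : Fintype.card ι * ε ≤ 1 / 2) :
    Q.PosDef := by
  refine Matrix.PosDef.of_dotProduct_mulVec_pos hT fun z hz => ?_
  have h := half_dotProduct_le_of_near_one hQ hε z
  have : 0 < z ⬝ᵥ z := by
    have := Matrix.dotProduct_star_self_pos_iff (v := z) |>.mpr hz
    simpa using this
  simp only [star_trivial]
  linarith

/-- Continuity of the determinant at the identity. -/
lemma exists_abs_det_sub_one_le (ι : Type*) [Fintype ι] [DecidableEq ι] {δ : ℝ} (hδ : 0 < δ) :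
    ∃ ε > 0, ∀ Q : Matrix ι ι ℝ, (∀ s t, |Q s t - (1 : Matrix ι ι ℝ) s t| ≤ ε) →
      |(√Q.det)⁻¹ - 1| ≤ δ := by
  have hc : ContinuousAt (fun Q : ι → ι → ℝ => (√(Matrix.det (Matrix.of Q)))⁻¹)
      (1 : Matrix ι ι ℝ) := by
    have h1 : Continuous fun Q : ι → ι → ℝ => √(Matrix.det (Matrix.of Q)) :=
      Real.continuous_sqrt.comp (Continuous.matrix_det continuous_id)
    exact h1.continuousAt.inv₀ (by
      change √(Matrix.det (1 : Matrix ι ι ℝ)) ≠ 0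
      simp)
  obtain ⟨ε, hε, h⟩ := Metric.continuousAt_iff.mp hc δ hδ
  refine ⟨ε / 2, by positivity, fun Q hQ => ?_⟩
  have hd : @dist (ι → ι → ℝ) _ Q (1 : Matrix ι ι ℝ) < ε := by
    refine lt_of_le_of_lt ?_ (half_lt_self hε)
    refine (dist_pi_le_iff (by positivity)).mpr fun s => (dist_pi_le_iff (by positivity)).mpr
      fun t => ?_
    rw [Real.dist_eq]
    exact hQ s t
  have := h hd
  rw [Real.dist_eq] at this
  change |(√Q.det)⁻¹ - (√(1 : Matrix ι ι ℝ).det)⁻¹| < δ at this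
  rw [Matrix.det_one, Real.sqrt_one, inv_one] at this
  exact this.le

end QuadraticForm

/-! ### Overlap matrices of tuples of configurations -/

section Overlap

open Matrix

variable {ι : Type*} {n : ℕ}

/-- The real matrix whose rows are the given configurations. -/
def signMatrix (σ : ι → Spin n) : Matrix ι (Fin n) ℝ :=
  Matrix.of fun s i => ((σ s i : ℤ) : ℝ)

/-- The overlap matrix `n⁻¹ ∑ᵢ σₛ(i) σₜ(i)` of a tuple of configurations. -/
noncomputable def overlap (σ : ι → Spin n) : Matrix ι ι ℝ :=
  (n : ℝ)⁻¹ • (signMatrix σ * (signMatrix σ)ᵀ)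

lemma overlap_apply (σ : ι → Spin n) (s t : ι) :
    overlap σ s t = (∑ i, ((σ s i : ℤ) : ℝ) * ((σ t i : ℤ) : ℝ)) / n := by
  simp [overlap, signMatrix, Matrix.mul_apply, div_eq_inv_mul]

lemma unit_sq (u : ℤˣ) : ((u : ℤ) : ℝ) * ((u : ℤ) : ℝ) = 1 := by
  rcases Int.units_eq_one_or u with h | h <;> simp [h]

lemma abs_unit (u : ℤˣ) : |((u : ℤ) : ℝ)| = 1 := by
  rcases Int.units_eq_one_or u with h | h <;> simp [h]

lemma overlap_self (hn : 0 < n) (σ : ι → Spin n) (s : ι) : overlap σ s s = 1 := by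
  rw [overlap_apply]
  simp [unit_sq, hn.ne']

lemma abs_overlap_le (hn : 0 < n) (σ : ι → Spin n) (s t : ι) : |overlap σ s t| ≤ 1 := by
  rw [overlap_apply, abs_div, Nat.abs_cast, div_le_one (by exact_mod_cast hn)]
  refine (Finset.abs_sum_le_sum_abs _ _).trans ?_
  simp [abs_mul, abs_unit]

lemma overlap_isHermitian (σ : ι → Spin n) : (overlap σ).IsHermitian := by
  ext s t
  simp [overlap_apply, mul_comm]

variable [Fintype ι]

/-- The sum `∑_{s<t} yₛ yₜ` of the pair products of a sign pattern. -/
noncomputable def pairSum (y : ι → ℤˣ) : ℝ :=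
  ((∑ s, ((y s : ℤ) : ℝ)) ^ 2 - Fintype.card ι) / 2

lemma abs_pairSum_le (y : ι → ℤˣ) : |pairSum y| ≤ (Fintype.card ι : ℝ) ^ 2 := by
  have h1 : |∑ s, ((y s : ℤ) : ℝ)| ≤ Fintype.card ι := by
    refine (Finset.abs_sum_le_sum_abs _ _).trans ?_
    simp [abs_unit]
  have h2 : (∑ s, ((y s : ℤ) : ℝ)) ^ 2 ≤ (Fintype.card ι : ℝ) ^ 2 := by
    rw [← sq_abs]; exact pow_le_pow_left₀ (abs_nonneg _) h1 2
  have h3 : (Fintype.card ι : ℝ) ≤ (Fintype.card ι : ℝ) ^ 2 := by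
    rcases Nat.eq_zero_or_pos (Fintype.card ι) with h | h
    · simp [h]
    · exact le_self_pow₀ (by exact_mod_cast h) (by norm_num)
  rw [pairSum, abs_le]
  constructor <;> nlinarith [sq_nonneg (∑ s, ((y s : ℤ) : ℝ))]

/-- Summing over the pair (s, t) first leaves the square of the spin sum at each site. This makes
the quadratic form additive over sites, so that its exponential factors. -/
lemma sum_overlap (σ : ι → Spin n) (hn : 0 < n) :
    ∑ s, ∑ t, overlap σ s t
      = Fintype.card ι + 2 / n * ∑ i, pairSum fun s => σ s i := by
  have hn' : (n : ℝ) ≠ 0 := by exact_mod_cast hn.ne'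
  have h1 : ∑ s, ∑ t, overlap σ s t = (∑ i, (∑ s, ((σ s i : ℤ) : ℝ)) ^ 2) / n := by
    simp only [overlap_apply, ← Finset.sum_div]
    congr 1
    rw [Finset.sum_congr rfl fun s _ => Finset.sum_comm, Finset.sum_comm]
    refine Finset.sum_congr rfl fun i _ => ?_
    rw [sq, Finset.sum_mul_sum]
  rw [h1]
  simp only [pairSum, ← Finset.sum_div, Finset.sum_sub_distrib, Finset.sum_const, Finset.card_univ,
    Fintype.card_fin, nsmul_eq_mul]
  field_simp
  ring

lemma posDef_signMatrix (σ : ι → Spin n) (h : LinearIndependent ℝ (signMatrix σ).row) :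
    (signMatrix σ * (signMatrix σ)ᵀ).PosDef := by
  have := Matrix.PosDef.mul_conjTranspose_self (signMatrix σ)
    (Matrix.vecMul_injective_iff.mpr h)
  rwa [conjTranspose_eq_transpose_of_trivial] at this

lemma posDef_overlap (hn : 0 < n) (σ : ι → Spin n)
    (h : LinearIndependent ℝ (signMatrix σ).row) : (overlap σ).PosDef :=
  (posDef_signMatrix σ h).smul (by positivity)

variable [DecidableEq ι]

/-- The Gram matrix n·Q has integer entries, so its positive determinant is at least 1. -/
lemma inv_sqrt_det_overlap_le (hn : 0 < n) (σ : ι → Spin n)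
    (h : LinearIndependent ℝ (signMatrix σ).row) :
    (√(overlap σ).det)⁻¹ ≤ √n ^ Fintype.card ι := by
  have hn' : (0 : ℝ) < n := by exact_mod_cast hn
  have hG := (posDef_signMatrix σ h).det_pos
  set G : Matrix ι ι ℤ := (Matrix.of fun s i => (σ s i : ℤ)) * (Matrix.of fun s i => (σ s i : ℤ))ᵀ
  have hGR : signMatrix σ * (signMatrix σ)ᵀ = G.map (Int.castRingHom ℝ) := by
    ext s t
    simp [G, signMatrix, Matrix.mul_apply]
  have hdet : (signMatrix σ * (signMatrix σ)ᵀ).det = ((G.det : ℤ) : ℝ) := by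
    rw [hGR, ← RingHom.mapMatrix_apply, ← RingHom.map_det]; rfl
  have h1 : (1 : ℝ) ≤ (signMatrix σ * (signMatrix σ)ᵀ).det := by
    rw [hdet] at hG ⊢
    have : 0 < G.det := by exact_mod_cast hG
    exact_mod_cast this
  have h2 : ((n : ℝ) ^ Fintype.card ι)⁻¹ ≤ (overlap σ).det := by
    rw [overlap, det_smul, inv_pow]
    exact le_mul_of_one_le_right (by positivity) h1
  have h3 : √n ^ Fintype.card ι = √((n : ℝ) ^ Fintype.card ι) :=
    (Real.sqrt_eq_iff_mul_self_eq (by positivity) (by positivity)).mpr (by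
      rw [← mul_pow, Real.mul_self_sqrt hn'.le]) |>.symm
  rw [h3]
  rw [inv_le_comm₀ (Real.sqrt_pos.mpr (lt_of_lt_of_le (by positivity) h2)) (by positivity),
    ← Real.sqrt_inv]
  exact Real.sqrt_le_sqrt h2

end Overlap
-- Probability that the signed energies lie in a box
section BoxProb

open Matrix

variable {ι : Type*} {n : ℕ}

/-- The signed energy `n^{-1/2} ∑ᵢ σᵢ xᵢ`. -/
noncomputable def signedEnergy (x : Fin n → ℝ) (σ : Spin n) : ℝ :=
  (∑ i, ((σ i : ℤ) : ℝ) * x i) / √(n : ℝ)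

/-- The probability that the signed energies of a tuple of configurations lie in a box. -/
noncomputable def boxProb (σ : ι → Spin n) (a b : ι → ℝ) : ℝ :=
  (stdGaussianPi (Fin n)).real {x | ∀ s, signedEnergy x (σ s) ∈ Set.Icc (a s) (b s)}

lemma measurable_signedEnergy (σ : Spin n) : Measurable fun x => signedEnergy x σ := by
  unfold signedEnergy
  fun_prop

lemma boxProb_nonneg (σ : ι → Spin n) (a b : ι → ℝ) : 0 ≤ boxProb σ a b := measureReal_nonneg

lemma boxProb_le_restrict (σ : ι → Spin n) (a b : ι → ℝ) (J : Finset ι) :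
    boxProb σ a b ≤ boxProb (fun j : J => σ j) (fun j => a j) (fun j => b j) := by
  refine measureReal_mono ?_
  intro x hx j
  exact hx j

variable [Fintype ι]

/-- On the box every product x_s x_t lies in [α², α² + η], and all overlaps are at most 1 in
modulus. Replacing x by the constant vector α therefore costs only multiples of η. -/
lemma two_mul_dotProduct_sub_bounds (hn : 0 < n) (σ : ι → Spin n) {α η : ℝ} (hα : 0 ≤ α)
    {x : ι → ℝ} (hx : ∀ s, α ≤ x s) (hxη : ∀ s t, x s * x t ≤ α ^ 2 + η) :
    2 * (x ⬝ᵥ x) - x ⬝ᵥ overlap σ *ᵥ x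
        ∈ Set.Icc (Fintype.card ι * α ^ 2 - 2 * (α ^ 2 / n * ∑ i, pairSum fun s => σ s i)
            - Fintype.card ι ^ 2 * η)
          (Fintype.card ι * α ^ 2 - 2 * (α ^ 2 / n * ∑ i, pairSum fun s => σ s i)
            + 2 * Fintype.card ι * η + Fintype.card ι ^ 2 * η) := by
  have hlow : ∀ s t, α ^ 2 ≤ x s * x t := fun s t => by
    rw [sq]; exact mul_le_mul (hx s) (hx t) hα (hα.trans (hx s))
  have h1 : Fintype.card ι * α ^ 2 ≤ x ⬝ᵥ x := by
    calc _ = ∑ _ : ι, α ^ 2 := by simp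
      _ ≤ _ := Finset.sum_le_sum fun s _ => hlow s s
  have h2 : x ⬝ᵥ x ≤ Fintype.card ι * (α ^ 2 + η) := by
    calc x ⬝ᵥ x ≤ ∑ _ : ι, (α ^ 2 + η) := Finset.sum_le_sum fun s _ => hxη s s
      _ = _ := by simp; ring
  have h3 : |x ⬝ᵥ overlap σ *ᵥ x - α ^ 2 * ∑ s, ∑ t, overlap σ s t|
      ≤ Fintype.card ι ^ 2 * η := by
    rw [dotProduct_mulVec_eq_sum, Finset.mul_sum, ← Finset.sum_sub_distrib]
    calc _ ≤ ∑ s : ι, ∑ t : ι, η := by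
          refine (Finset.abs_sum_le_sum_abs _ _).trans (Finset.sum_le_sum fun s _ => ?_)
          rw [Finset.mul_sum, ← Finset.sum_sub_distrib]
          refine (Finset.abs_sum_le_sum_abs _ _).trans (Finset.sum_le_sum fun t _ => ?_)
          rw [show overlap σ s t * (x s * x t) - α ^ 2 * overlap σ s t
            = overlap σ s t * (x s * x t - α ^ 2) by ring, abs_mul,
            abs_of_nonneg (sub_nonneg.mpr (hlow s t))]
          have h4 := abs_overlap_le hn σ s t
          have h5 := hxη s t
          have h6 := hlow s t
          calc _ ≤ 1 * (x s * x t - α ^ 2) :=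
                mul_le_mul_of_nonneg_right h4 (by linarith)
            _ ≤ η := by linarith
      _ = _ := by simp; ring
  rw [sum_overlap σ hn] at h3
  have h7 : α ^ 2 * (Fintype.card ι + 2 / n * ∑ i, pairSum fun s => σ s i)
      = Fintype.card ι * α ^ 2 + 2 * (α ^ 2 / n * ∑ i, pairSum fun s => σ s i) := by ring
  rw [h7] at h3
  have h8 := abs_le.mp h3
  constructor <;> linarith [h8.1, h8.2]

variable [DecidableEq ι]

lemma boxProb_eq_lintegral (σ : ι → Spin n) (hσ : (overlap σ).PosDef) (a b : ι → ℝ) :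
    boxProb σ a b
      = (∫⁻ x in Set.Icc a b, ENNReal.ofReal (gaussianDensity (overlap σ) x)).toReal := by
  have hA : ((√(n : ℝ))⁻¹ • signMatrix σ) * ((√(n : ℝ))⁻¹ • signMatrix σ)ᵀ = overlap σ := by
    rw [transpose_smul, Matrix.smul_mul, Matrix.mul_smul, smul_smul, overlap, ← mul_inv,
      Real.mul_self_sqrt (Nat.cast_nonneg n)]
  have h := map_mulVec_stdGaussianPi_eq_withDensity ((√(n : ℝ))⁻¹ • signMatrix σ) (by rwa [hA])
  rw [hA] at h
  have hmul : Measurable fun x : Fin n → ℝ => ((√(n : ℝ))⁻¹ • signMatrix σ) *ᵥ x :=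
    (LinearMap.continuous_of_finiteDimensional
      (Matrix.toLin' ((√(n : ℝ))⁻¹ • signMatrix σ))).measurable
  rw [← withDensity_apply _ measurableSet_Icc, ← h, Measure.map_apply hmul measurableSet_Icc,
    boxProb, Measure.real]
  congr 2
  ext x
  simp only [Set.mem_ofPred_eq, Set.mem_preimage, Set.mem_Icc, Pi.le_def, ← forall_and]
  refine forall_congr' fun s => ?_
  have : signedEnergy x (σ s) = (((√(n : ℝ))⁻¹ • signMatrix σ) *ᵥ x) s := by
    simp [signedEnergy, signMatrix, mulVec, dotProduct, div_eq_inv_mul,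
      Finset.mul_sum, mul_assoc]
  rw [this]

lemma boxProb_le (σ : ι → Spin n) (hσ : (overlap σ).PosDef) {a b : ι → ℝ} (hab : a ≤ b) {D : ℝ}
    (hD0 : 0 ≤ D) (hD : ∀ x ∈ Set.Icc a b, gaussianDensity (overlap σ) x ≤ D) :
    boxProb σ a b ≤ D * ∏ s, (b s - a s) := by
  rw [boxProb_eq_lintegral σ hσ]
  refine ENNReal.toReal_le_of_le_ofReal
    (mul_nonneg hD0 (Finset.prod_nonneg fun s _ => sub_nonneg.mpr (hab s))) ?_
  calc _ ≤ ∫⁻ _ in Set.Icc a b, ENNReal.ofReal D :=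
        setLIntegral_mono measurable_const fun x hx => ENNReal.ofReal_le_ofReal (hD x hx)
    _ = _ := by
        rw [setLIntegral_const, Real.volume_Icc_pi, ENNReal.ofReal_mul hD0,
          ENNReal.ofReal_prod_of_nonneg fun s _ => sub_nonneg.mpr (hab s)]

lemma le_boxProb (σ : ι → Spin n) (hσ : (overlap σ).PosDef) {a b : ι → ℝ} (hab : a ≤ b) {D : ℝ}
    (hD0 : 0 ≤ D) (hD : ∀ x ∈ Set.Icc a b, D ≤ gaussianDensity (overlap σ) x) :
    D * ∏ s, (b s - a s) ≤ boxProb σ a b := by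
  have h1 : ENNReal.ofReal (D * ∏ s, (b s - a s))
      ≤ ∫⁻ x in Set.Icc a b, ENNReal.ofReal (gaussianDensity (overlap σ) x) := by
    calc _ = ∫⁻ _ in Set.Icc a b, ENNReal.ofReal D := by
          rw [setLIntegral_const, Real.volume_Icc_pi, ENNReal.ofReal_mul hD0,
            ENNReal.ofReal_prod_of_nonneg fun s _ => sub_nonneg.mpr (hab s)]
      _ ≤ _ := setLIntegral_mono' measurableSet_Icc
          fun x hx => ENNReal.ofReal_le_ofReal (hD x hx)
  rw [boxProb_eq_lintegral σ hσ]
  refine (ENNReal.ofReal_le_iff_le_toReal ?_).mp h1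
  -- Since `toReal` sends `⊤` to 0, finiteness has to be known; the density is bounded by its
  -- prefactor and the box has finite volume.
  refine ne_top_of_le_ne_top (b := ∫⁻ _ in Set.Icc a b, ENNReal.ofReal
    ((√(2 * Real.pi))⁻¹ ^ Fintype.card ι * (√(overlap σ).det)⁻¹)) ?_ ?_
  · rw [setLIntegral_const]
    exact ENNReal.mul_ne_top ENNReal.ofReal_ne_top (measure_Icc_lt_top.ne)
  · refine setLIntegral_mono measurable_const fun x _ => ENNReal.ofReal_le_ofReal ?_
    refine mul_le_of_le_one_right (by positivity) (Real.exp_le_one_iff.mpr ?_)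
    have := hσ.inv.posSemidef.dotProduct_mulVec_nonneg x
    simp only [star_trivial] at this
    linarith

/-- Crude bound for atypical tuples: the exponential is bounded by 1 and the determinant by
integrality. The polynomial loss in n is harmless against exponentially small counts. -/
lemma boxProb_le_of_linearIndependent (hn : 0 < n) (σ : ι → Spin n)
    (hσ : LinearIndependent ℝ (signMatrix σ).row) {a b : ι → ℝ} (hab : a ≤ b) :
    boxProb σ a b
      ≤ ((√(2 * Real.pi))⁻¹ ^ Fintype.card ι * √n ^ Fintype.card ι) * ∏ s, (b s - a s) := by
  have hQ := posDef_overlap hn σ hσ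
  refine boxProb_le σ hQ hab (by positivity) fun x _ => ?_
  have h2 := hQ.inv.posSemidef.dotProduct_mulVec_nonneg x
  simp only [star_trivial] at h2
  calc gaussianDensity (overlap σ) x
      ≤ (√(2 * Real.pi))⁻¹ ^ Fintype.card ι * (√(overlap σ).det)⁻¹ :=
        mul_le_of_le_one_right (by positivity) (Real.exp_le_one_iff.mpr (by linarith))
    _ ≤ _ := mul_le_mul_of_nonneg_left (inv_sqrt_det_overlap_le hn σ hσ) (by positivity)

lemma boxProb_le_exp (hn : 0 < n) (σ : ι → Spin n)
    (hQ : (overlap σ).PosDef) {a b : ι → ℝ} (hab : a ≤ b) {α η : ℝ}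
    (hα : 0 ≤ α) (ha : ∀ s, α ≤ a s) (hb : ∀ s t, b s * b t ≤ α ^ 2 + η) :
    boxProb σ a b ≤ ((√(2 * Real.pi))⁻¹ ^ Fintype.card ι * (√(overlap σ).det)⁻¹
      * Real.exp (-(Fintype.card ι * α ^ 2) / 2 + α ^ 2 / n * ∑ i, (pairSum fun s => σ s i)
        + Fintype.card ι ^ 2 * η)) * ∏ s, (b s - a s) := by
  -- The sign of `η` follows from α² ≤ b_s² as soon as an index exists; for empty `ι` the prefactor
  -- vanishes.
  have hη : 0 ≤ Fintype.card ι ^ 2 * η := by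
    rcases isEmpty_or_nonempty ι with h | ⟨⟨s⟩⟩
    · simp
    · have : α ^ 2 ≤ b s * b s := by
        have := (ha s).trans (hab s); rw [sq]; exact mul_le_mul this this hα (hα.trans this)
      have : 0 ≤ η := by linarith [hb s s]
      positivity
  refine boxProb_le σ hQ hab (by positivity) fun x hx => ?_
  refine mul_le_mul_of_nonneg_left (Real.exp_le_exp.mpr ?_) (by positivity)
  have hxa : ∀ s, α ≤ x s := fun s => (ha s).trans (hx.1 s)
  have h1 := (two_mul_dotProduct_sub_bounds hn σ hα hxa (η := η) fun s t =>
    (mul_le_mul (hx.2 s) (hx.2 t) (hα.trans (hxa t))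
      (hα.trans ((hxa s).trans (hx.2 s)))).trans (hb s t)).1
  have h2 := le_dotProduct_inv_mulVec hQ x
  linarith

/-- Half of the remainder 2|Qx - x|² of the inverse form enters the exponent; Cauchy–Schwarz bounds
it by kα² times the squared overlaps, up to multiples of η. -/
lemma le_boxProb_exp (hn : 0 < n) (σ : ι → Spin n) {ε : ℝ}
    (hσ : ∀ s t, |overlap σ s t - (1 : Matrix ι ι ℝ) s t| ≤ ε) (hε : Fintype.card ι * ε ≤ 1 / 2)
    {a b : ι → ℝ} (hab : a ≤ b) {α η : ℝ}
    (hα : 0 ≤ α) (ha : ∀ s, α ≤ a s) (hη0 : 0 ≤ η) (hb : ∀ s t, b s * b t ≤ α ^ 2 + η) :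
    ((√(2 * Real.pi))⁻¹ ^ Fintype.card ι * (√(overlap σ).det)⁻¹
      * Real.exp (-(Fintype.card ι * α ^ 2) / 2 + α ^ 2 / n * ∑ i, (pairSum fun s => σ s i)
        - Fintype.card ι * α ^ 2 * (∑ s, ∑ t, (overlap σ s t - (1 : Matrix ι ι ℝ) s t) ^ 2)
        - 3 * Fintype.card ι ^ 3 * η)) * ∏ s, (b s - a s) ≤ boxProb σ a b := by
  have hQ := posDef_of_near_one (overlap_isHermitian σ) hσ hε
  refine le_boxProb σ hQ hab (by positivity) fun x hx => ?_
  refine mul_le_mul_of_nonneg_left (Real.exp_le_exp.mpr ?_) (by positivity)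
  have hxa : ∀ s, α ≤ x s := fun s => (ha s).trans (hx.1 s)
  have hxη : ∀ s t, x s * x t ≤ α ^ 2 + η := fun s t =>
    (mul_le_mul (hx.2 s) (hx.2 t) (hα.trans (hxa t))
      (hα.trans ((hxa s).trans (hx.2 s)))).trans (hb s t)
  have h1 := (two_mul_dotProduct_sub_bounds hn σ hα hxa hxη).2
  have h2 := dotProduct_inv_mulVec_le hQ (half_dotProduct_le_of_near_one hσ hε) x
  have hsq : ∀ s t, (overlap σ s t - (1 : Matrix ι ι ℝ) s t) ^ 2 ≤ 1 := by
    intro s t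
    rcases eq_or_ne s t with rfl | hst
    · simp [overlap_self hn]
    · rw [one_apply_ne hst, sub_zero, sq_le_one_iff_abs_le_one]
      exact abs_overlap_le hn σ s t
  have h3 : (overlap σ *ᵥ x - x) ⬝ᵥ (overlap σ *ᵥ x - x)
      ≤ Fintype.card ι * α ^ 2 * (∑ s, ∑ t, (overlap σ s t - (1 : Matrix ι ι ℝ) s t) ^ 2)
        + Fintype.card ι ^ 3 * η := by
    have h4 : ∀ s, (overlap σ *ᵥ x - x) s ^ 2
        ≤ Fintype.card ι * α ^ 2 * (∑ t, (overlap σ s t - (1 : Matrix ι ι ℝ) s t) ^ 2)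
          + Fintype.card ι ^ 2 * η := by
      intro s
      have h5 : (overlap σ *ᵥ x - x) s
          = ∑ t, (overlap σ s t - (1 : Matrix ι ι ℝ) s t) * x t := by
        have : overlap σ *ᵥ x - x = (overlap σ - 1) *ᵥ x := by rw [sub_mulVec, one_mulVec]
        rw [this]; rfl
      rw [h5]
      -- Cauchy–Schwarz. The bound x_t² ≤ α² + η is used with the entries of Q - 1 having square at
      -- most 1, so `η` appears without an overlap factor.
      refine (sq_sum_le_card_mul_sum_sq).trans ?_
      rw [Finset.card_univ, sq (Fintype.card ι : ℝ), mul_assoc, mul_assoc, ← mul_add]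
      refine mul_le_mul_of_nonneg_left ?_ (by positivity)
      calc _ ≤ ∑ t, (α ^ 2 * (overlap σ s t - (1 : Matrix ι ι ℝ) s t) ^ 2 + η) := by
            refine Finset.sum_le_sum fun t _ => ?_
            rw [mul_pow]
            have h6 := hxη t t
            have h7 := hsq s t
            have h8 := sq_nonneg (overlap σ s t - (1 : Matrix ι ι ℝ) s t)
            nlinarith
        _ = _ := by simp [Finset.sum_add_distrib, Finset.mul_sum]
    calc _ = ∑ s, (overlap σ *ᵥ x - x) s ^ 2 := by simp [dotProduct, sq]
      _ ≤ _ := Finset.sum_le_sum fun s _ => h4 s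
      _ = _ := by simp [Finset.sum_add_distrib, Finset.mul_sum]; ring
  -- The total coefficient of `η` is k + k²/2 + k³, which is at most 3k³.
  have hk : ((Fintype.card ι : ℕ) : ℝ) ≤ (Fintype.card ι : ℝ) ^ 3 ∧
      (Fintype.card ι : ℝ) ^ 2 ≤ (Fintype.card ι : ℝ) ^ 3 := by
    rcases Nat.eq_zero_or_pos (Fintype.card ι) with h | h
    · simp [h]
    · have : (1 : ℝ) ≤ Fintype.card ι := by exact_mod_cast h
      exact ⟨le_self_pow₀ this (by norm_num), pow_le_pow_right₀ this (by norm_num)⟩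
  nlinarith [mul_le_mul_of_nonneg_right hk.1 hη0, mul_le_mul_of_nonneg_right hk.2 hη0]

end BoxProb
-- Random signs at one site and the generating function of the pair sum
section SignPatterns

lemma sum_intUnits (f : ℤˣ → ℝ) : ∑ u, f u = f 1 + f (-1) := by
  have : (Finset.univ : Finset ℤˣ) = {1, -1} := by decide
  rw [this, Finset.sum_pair (by decide)]

lemma sum_option_pattern {ι : Type*} [Fintype ι] [DecidableEq ι] [DecidableEq (Option ι)]
    (f : (Option ι → ℤˣ) → ℝ) :
    ∑ y, f y = ∑ u : ℤˣ, ∑ z : ι → ℤˣ,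
      f ((Equiv.piOptionEquivProd (β := fun _ : Option ι => ℤˣ)).symm (u, z)) := by
  rw [← (Equiv.piOptionEquivProd (β := fun _ : Option ι => ℤˣ)).symm.sum_comp,
    Fintype.sum_prod_type]

/-- Second and fourth moments of a sum of independent random signs. -/
lemma sum_pattern_pow (ι : Type*) [Fintype ι] [DecidableEq ι] :
    ∑ y : ι → ℤˣ, (∑ s, ((y s : ℤ) : ℝ)) ^ 2 = 2 ^ Fintype.card ι * Fintype.card ι ∧
    ∑ y : ι → ℤˣ, (∑ s, ((y s : ℤ) : ℝ)) ^ 4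
      = 2 ^ Fintype.card ι * (3 * (Fintype.card ι : ℝ) ^ 2 - 2 * Fintype.card ι) := by
  classical
  have key : ∀ (ι : Type _) [Fintype ι], ∀ [DecidableEq ι],
      ∑ y : ι → ℤˣ, (∑ s, ((y s : ℤ) : ℝ)) ^ 2 = 2 ^ Fintype.card ι * Fintype.card ι ∧
      ∑ y : ι → ℤˣ, (∑ s, ((y s : ℤ) : ℝ)) ^ 4
        = 2 ^ Fintype.card ι * (3 * (Fintype.card ι : ℝ) ^ 2 - 2 * Fintype.card ι) := by
    intro ι _
    refine Fintype.induction_empty_option (P := fun ι _ => ∀ [DecidableEq ι],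
      ∑ y : ι → ℤˣ, (∑ s, ((y s : ℤ) : ℝ)) ^ 2 = 2 ^ Fintype.card ι * Fintype.card ι ∧
      ∑ y : ι → ℤˣ, (∑ s, ((y s : ℤ) : ℝ)) ^ 4
        = 2 ^ Fintype.card ι * (3 * (Fintype.card ι : ℝ) ^ 2 - 2 * Fintype.card ι)) ?_ ?_ ?_ ι
    · intro α β _ e h _
      classical
      let _ := Fintype.ofEquiv β e.symm
      have h' := h
      rw [← Fintype.card_congr e]
      have hs : ∀ p : ℕ, ∑ y : β → ℤˣ, (∑ s, ((y s : ℤ) : ℝ)) ^ p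
          = ∑ y : α → ℤˣ, (∑ s, ((y s : ℤ) : ℝ)) ^ p := by
        intro p
        refine Fintype.sum_equiv (Equiv.arrowCongr e.symm (Equiv.refl _)) _ _ fun y => ?_
        congr 1
        exact Fintype.sum_equiv e.symm _ _ fun s => by simp [Equiv.arrowCongr]
      rw [hs, hs]
      exact h'
    · intro _
      simp
    -- One new sign turns the sum S into S ± 1, and adding the two powers leaves even terms only:
    -- 2S² + 2 and 2S⁴ + 12S² + 2.
    · intro α _ h _
      classical
      obtain ⟨h2, h4⟩ := h
      have hc : ∑ _ : α → ℤˣ, (1 : ℝ) = 2 ^ Fintype.card α := by simp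
      simp only [Fintype.card_option]
      constructor
      · rw [sum_option_pattern, sum_intUnits, ← Finset.sum_add_distrib]
        simp only [Fintype.sum_option, Equiv.piOptionEquivProd_symm_apply, Units.val_one,
          Units.val_neg, Int.cast_neg, Int.cast_one]
        rw [Finset.sum_congr rfl (g := fun y => 2 * (∑ s, ((y s : ℤ) : ℝ)) ^ 2 + 2 * (1 : ℝ))
          (fun y _ => by ring), Finset.sum_add_distrib, ← Finset.mul_sum, ← Finset.mul_sum, hc, h2]
        push_cast
        ring
      · rw [sum_option_pattern, sum_intUnits, ← Finset.sum_add_distrib]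
        simp only [Fintype.sum_option, Equiv.piOptionEquivProd_symm_apply, Units.val_one,
          Units.val_neg, Int.cast_neg, Int.cast_one]
        rw [Finset.sum_congr rfl (g := fun y => 2 * (∑ s, ((y s : ℤ) : ℝ)) ^ 4
          + 12 * (∑ s, ((y s : ℤ) : ℝ)) ^ 2 + 2 * (1 : ℝ))
          (fun y _ => by ring), Finset.sum_add_distrib, Finset.sum_add_distrib, ← Finset.mul_sum,
          ← Finset.mul_sum, ← Finset.mul_sum, hc, h2, h4]
        push_cast
        ring
  exact key ι

variable {ι : Type*} [Fintype ι] [DecidableEq ι]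

/-- The average over the `2^k` sign patterns. -/
noncomputable def patternAvg (f : (ι → ℤˣ) → ℝ) : ℝ :=
  (2 ^ Fintype.card ι)⁻¹ * ∑ y, f y

lemma patternAvg_add (f g : (ι → ℤˣ) → ℝ) :
    patternAvg (fun y => f y + g y) = patternAvg f + patternAvg g := by
  simp [patternAvg, Finset.sum_add_distrib, mul_add]

lemma patternAvg_const_mul (c : ℝ) (f : (ι → ℤˣ) → ℝ) :
    patternAvg (fun y => c * f y) = c * patternAvg f := by
  simp [patternAvg, ← Finset.mul_sum]; ring

lemma patternAvg_const (c : ℝ) : patternAvg (fun _ : ι → ℤˣ => c) = c := by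
  simp [patternAvg]

lemma patternAvg_mono {f g : (ι → ℤˣ) → ℝ} (h : ∀ y, f y ≤ g y) :
    patternAvg f ≤ patternAvg g :=
  mul_le_mul_of_nonneg_left (Finset.sum_le_sum fun y _ => h y) (by positivity)

lemma abs_patternAvg_le {f : (ι → ℤˣ) → ℝ} {c : ℝ} (h : ∀ y, |f y| ≤ c) :
    |patternAvg f| ≤ c := by
  rw [abs_le]
  constructor
  · rw [← patternAvg_const (ι := ι) (-c)]
    exact patternAvg_mono fun y => (abs_le.mp (h y)).1
  · rw [← patternAvg_const (ι := ι) c]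
    exact patternAvg_mono fun y => (abs_le.mp (h y)).2

lemma patternAvg_pairSum : patternAvg (pairSum : (ι → ℤˣ) → ℝ) = 0 := by
  have h := (sum_pattern_pow ι).1
  simp only [patternAvg, pairSum, ← Finset.sum_div, Finset.sum_sub_distrib, h]
  simp

lemma patternAvg_pairSum_sq :
    patternAvg (fun y : ι → ℤˣ => pairSum y ^ 2)
      = Fintype.card ι * (Fintype.card ι - 1) / 2 := by
  obtain ⟨h2, h4⟩ := sum_pattern_pow ι
  have hc : ∑ _ : ι → ℤˣ, (1 : ℝ) = 2 ^ Fintype.card ι := by simp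
  rw [patternAvg, inv_mul_eq_iff_eq_mul₀ (by positivity)]
  simp only [pairSum]
  rw [Finset.sum_congr rfl (g := fun y => (1 / 4) * (∑ s, ((y s : ℤ) : ℝ)) ^ 4
    - (Fintype.card ι / 2) * (∑ s, ((y s : ℤ) : ℝ)) ^ 2 + (Fintype.card ι : ℝ) ^ 2 / 4 * 1)
    (fun y _ => by ring), Finset.sum_add_distrib, Finset.sum_sub_distrib, ← Finset.mul_sum,
    ← Finset.mul_sum, ← Finset.mul_sum, hc, h2, h4]
  ring

/-- The moment generating function of `pairSum` under uniform random signs. -/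
noncomputable def pairMGF (ι : Type*) [Fintype ι] [DecidableEq ι] (β : ℝ) : ℝ :=
  patternAvg fun y : ι → ℤˣ => Real.exp (β * pairSum y)

/-- Jensen: exp x ≥ 1 + x and the pair sum is centred. The tilted weights can thus be normalised
without loss. -/
lemma one_le_pairMGF (β : ℝ) : 1 ≤ pairMGF ι β := by
  have h : patternAvg (fun y : ι → ℤˣ => 1 + β * pairSum y) = 1 := by
    rw [patternAvg_add, patternAvg_const, patternAvg_const_mul, patternAvg_pairSum]; simp
  rw [← h]
  refine patternAvg_mono fun y => ?_
  have := Real.add_one_le_exp (β * pairSum y)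
  linarith

/-- Second-order Taylor expansion, with mean 0 and variance k(k-1)/2; the cubic remainder is
controlled by |βS| ≤ βk² ≤ 1. -/
lemma abs_pairMGF_sub_le {β : ℝ} (hβ : 0 ≤ β) (hβ1 : β * (Fintype.card ι : ℝ) ^ 2 ≤ 1) :
    |pairMGF ι β - (1 + Fintype.card ι * (Fintype.card ι - 1) / 4 * β ^ 2)|
      ≤ (Fintype.card ι : ℝ) ^ 6 * β ^ 3 := by
  have h : pairMGF ι β - (1 + Fintype.card ι * (Fintype.card ι - 1) / 4 * β ^ 2)
      = patternAvg fun y : ι → ℤˣ => Real.exp (β * pairSum y)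
        - (1 + β * pairSum y + (β ^ 2 / 2) * pairSum y ^ 2) := by
    have h1 : patternAvg (fun y : ι → ℤˣ => 1 + β * pairSum y + (β ^ 2 / 2) * pairSum y ^ 2)
        = 1 + Fintype.card ι * (Fintype.card ι - 1) / 4 * β ^ 2 := by
      rw [patternAvg_add, patternAvg_add, patternAvg_const, patternAvg_const_mul,
        patternAvg_const_mul, patternAvg_pairSum, patternAvg_pairSum_sq]
      ring
    rw [← h1, pairMGF, sub_eq_iff_eq_add, ← patternAvg_add]
    simp
  rw [h]
  refine abs_patternAvg_le fun y => ?_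
  have habs : |β * pairSum y| ≤ β * (Fintype.card ι : ℝ) ^ 2 := by
    rw [abs_mul, abs_of_nonneg hβ]
    exact mul_le_mul_of_nonneg_left (abs_pairSum_le y) hβ
  have h2 := Real.exp_bound (habs.trans hβ1) (n := 3) (by norm_num)
  simp only [Finset.sum_range_succ, Finset.sum_range_zero, Nat.factorial] at h2
  have h3 : |β * pairSum y| ^ 3 ≤ (Fintype.card ι : ℝ) ^ 6 * β ^ 3 := by
    calc _ ≤ (β * (Fintype.card ι : ℝ) ^ 2) ^ 3 := pow_le_pow_left₀ (abs_nonneg _) habs 3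
      _ = _ := by ring
  have h4 : 0 ≤ |β * pairSum y| ^ 3 := by positivity
  norm_num at h2
  rw [show Real.exp (β * pairSum y) - (1 + β * pairSum y + (β ^ 2 / 2) * pairSum y ^ 2)
    = Real.exp (β * pairSum y) - (1 + β * pairSum y + (β * pairSum y) ^ 2 / 2) by ring]
  refine h2.trans ?_
  rw [abs_mul] at h3 h4
  linarith

lemma exp_sub_two_sq_le_one_add {z : ℝ} (hz : -(1 / 2) ≤ z) : Real.exp (z - 2 * z ^ 2) ≤ 1 + z := by
  have h1 := Real.add_one_le_exp (-(z - 2 * z ^ 2))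
  have h2 : 1 ≤ (1 + z) * Real.exp (-(z - 2 * z ^ 2)) := by
    -- The product equals 1 + z²(1 + 2z).
    have : 1 ≤ (1 + z) * (-(z - 2 * z ^ 2) + 1) := by nlinarith [sq_nonneg z]
    exact this.trans (mul_le_mul_of_nonneg_left h1 (by linarith))
  have h3 : Real.exp (z - 2 * z ^ 2) * Real.exp (-(z - 2 * z ^ 2)) = 1 := by
    rw [← Real.exp_add]; simp
  nlinarith [Real.exp_pos (-(z - 2 * z ^ 2)), Real.exp_pos (z - 2 * z ^ 2)]

/-- The cumulant generating function of `pairSum` up to third order. -/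
lemma exists_pairMGF_bounds (ι : Type*) [Fintype ι] [DecidableEq ι] :
    ∃ C ≥ 0, ∃ β₀ > 0, ∀ β : ℝ, 0 ≤ β → β ≤ β₀ →
      pairMGF ι β ∈ Set.Icc
        (Real.exp (Fintype.card ι * (Fintype.card ι - 1) / 4 * β ^ 2 - C * β ^ 3))
        (Real.exp (Fintype.card ι * (Fintype.card ι - 1) / 4 * β ^ 2 + C * β ^ 3)) := by
  set k : ℝ := (Fintype.card ι : ℝ) with hk
  have hk0 : 0 ≤ k := Nat.cast_nonneg _
  set c : ℝ := k * (k - 1) / 4 with hc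
  set D : ℝ := |c| + k ^ 6 + 1 with hD
  have hD1 : 1 ≤ D := by have := abs_nonneg c; have : 0 ≤ k ^ 6 := by positivity
                         linarith
  -- `k ^ 6` is the Taylor error and `2 * D ^ 2` the loss 2z² in passing from 1 + z to an
  -- exponential, where |z| ≤ Dβ². The range of β ensures Dβ² ≤ 1/2 and βk² ≤ 1.
  refine ⟨k ^ 6 + 2 * D ^ 2, by positivity, min (1 / (2 * D)) (1 / (k ^ 2 + 1)), by positivity,
    fun β hβ hβ0 => ?_⟩
  have hβD : β * (2 * D) ≤ 1 := by
    rw [← le_div_iff₀ (by positivity)]; exact hβ0.trans (min_le_left _ _)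
  have hβk : β * (k ^ 2 + 1) ≤ 1 := by
    rw [← le_div_iff₀ (by positivity)]; exact hβ0.trans (min_le_right _ _)
  have hβ1 : β ≤ 1 := by nlinarith
  have h := abs_le.mp (abs_pairMGF_sub_le (ι := ι) hβ (by rw [← hk]; nlinarith))
  rw [← hk, ← hc] at h
  have hβ3 : 0 ≤ β ^ 3 := by positivity
  constructor
  · have hz1 : |c * β ^ 2 - k ^ 6 * β ^ 3| ≤ D * β ^ 2 := by
      have h32 : β ^ 3 ≤ β ^ 2 := pow_le_pow_of_le_one hβ hβ1 (by norm_num)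
      calc _ ≤ |c * β ^ 2| + |k ^ 6 * β ^ 3| := abs_sub _ _
        _ = |c| * β ^ 2 + k ^ 6 * β ^ 3 := by
            rw [abs_mul, abs_of_nonneg (by positivity : 0 ≤ β ^ 2),
              abs_of_nonneg (by positivity : 0 ≤ k ^ 6 * β ^ 3)]
        _ ≤ |c| * β ^ 2 + k ^ 6 * β ^ 2 := by gcongr
        _ ≤ _ := by rw [hD]; nlinarith [sq_nonneg β]
    have hz2 : D * β ^ 2 ≤ 1 / 2 := by nlinarith
    have hz3 : (c * β ^ 2 - k ^ 6 * β ^ 3) ^ 2 ≤ D ^ 2 * β ^ 3 := by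
      rw [← sq_abs]
      calc _ ≤ (D * β ^ 2) ^ 2 := pow_le_pow_left₀ (abs_nonneg _) hz1 2
        _ = D ^ 2 * β ^ 4 := by ring
        _ ≤ _ := mul_le_mul_of_nonneg_left (pow_le_pow_of_le_one hβ hβ1 (by norm_num))
            (by positivity)
    have h5 := exp_sub_two_sq_le_one_add (z := c * β ^ 2 - k ^ 6 * β ^ 3)
      (by have := (abs_le.mp hz1).1; linarith)
    refine (Real.exp_le_exp.mpr ?_).trans (h5.trans (by linarith [h.1]))
    nlinarith
  · have h5 := Real.add_one_le_exp (c * β ^ 2 + (k ^ 6 + 2 * D ^ 2) * β ^ 3)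
    have : 0 ≤ D ^ 2 * β ^ 3 := by positivity
    nlinarith [h.2]

/-- Flipping the sign at `s` permutes the patterns and negates the summand. -/
lemma patternAvg_mul_of_ne {s t : ι} (hst : s ≠ t) :
    patternAvg (fun y : ι → ℤˣ => ((y s : ℤ) : ℝ) * ((y t : ℤ) : ℝ)) = 0 := by
  have h : ∑ y : ι → ℤˣ, ((y s : ℤ) : ℝ) * ((y t : ℤ) : ℝ)
      = ∑ y : ι → ℤˣ, -(((y s : ℤ) : ℝ) * ((y t : ℤ) : ℝ)) := by
    refine Fintype.sum_equiv (Equiv.mulLeft (Pi.mulSingle s (-1 : ℤˣ))) _ _ fun y => ?_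
    simp [Pi.mulSingle_eq_of_ne hst.symm]
  rw [Finset.sum_neg_distrib] at h
  have h0 : ∑ y : ι → ℤˣ, ((y s : ℤ) : ℝ) * ((y t : ℤ) : ℝ) = 0 := by linarith
  rw [patternAvg, h0, mul_zero]

/-- The product of two distinct spins is centred, so 1 may be subtracted from the exponential. Hence
tilting correlates two spins at a site only to order β. -/
lemma abs_patternAvg_mul_exp_le {s t : ι} (hst : s ≠ t) {β : ℝ} (hβ : 0 ≤ β)
    (hβ1 : β * (Fintype.card ι : ℝ) ^ 2 ≤ 1) :
    |patternAvg (fun y : ι → ℤˣ => ((y s : ℤ) : ℝ) * ((y t : ℤ) : ℝ)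
      * Real.exp (β * pairSum y))| ≤ 2 * β * (Fintype.card ι : ℝ) ^ 2 := by
  have h : patternAvg (fun y : ι → ℤˣ => ((y s : ℤ) : ℝ) * ((y t : ℤ) : ℝ)
        * Real.exp (β * pairSum y))
      = patternAvg (fun y : ι → ℤˣ => ((y s : ℤ) : ℝ) * ((y t : ℤ) : ℝ)
        * (Real.exp (β * pairSum y) - 1)) := by
    have h0 : ∀ y : ι → ℤˣ, ((y s : ℤ) : ℝ) * ((y t : ℤ) : ℝ) * Real.exp (β * pairSum y)
        = ((y s : ℤ) : ℝ) * ((y t : ℤ) : ℝ) * (Real.exp (β * pairSum y) - 1)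
          + ((y s : ℤ) : ℝ) * ((y t : ℤ) : ℝ) := fun y => by ring
    simp_rw [h0]
    rw [patternAvg_add, patternAvg_mul_of_ne hst, add_zero]
  rw [h]
  refine abs_patternAvg_le fun y => ?_
  have habs : |β * pairSum y| ≤ β * (Fintype.card ι : ℝ) ^ 2 := by
    rw [abs_mul, abs_of_nonneg hβ]
    exact mul_le_mul_of_nonneg_left (abs_pairSum_le y) hβ
  rw [abs_mul, abs_mul, abs_unit, abs_unit, one_mul, one_mul]
  have := Real.abs_exp_sub_one_le (habs.trans hβ1)
  linarith

/-- The product of two distinct spins is again a fair sign, so the average is cosh θ. This is the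
one-site input of the Chernoff bound. -/
lemma patternAvg_exp_mul_le {s t : ι} (hst : s ≠ t) (θ : ℝ) :
    patternAvg (fun y : ι → ℤˣ => Real.exp (θ * (((y s : ℤ) : ℝ) * ((y t : ℤ) : ℝ))))
      ≤ Real.exp (θ ^ 2 / 2) := by
  have h : ∀ u : ℝ, u = 1 ∨ u = -1 →
      Real.exp (θ * u) = Real.cosh θ + Real.sinh θ * u := by
    rintro u (rfl | rfl)
    · rw [Real.cosh_eq, Real.sinh_eq]; ring_nf
    · rw [Real.cosh_eq, Real.sinh_eq]; ring_nf
  have h2 : ∀ y : ι → ℤˣ, Real.exp (θ * (((y s : ℤ) : ℝ) * ((y t : ℤ) : ℝ)))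
      = Real.cosh θ + Real.sinh θ * (((y s : ℤ) : ℝ) * ((y t : ℤ) : ℝ)) := by
    intro y
    refine h _ ?_
    rcases Int.units_eq_one_or (y s) with h | h <;> rcases Int.units_eq_one_or (y t) with h' | h'
      <;> simp [h, h']
  simp_rw [h2]
  rw [patternAvg_add, patternAvg_const, patternAvg_const_mul, patternAvg_mul_of_ne hst, mul_zero,
    add_zero]
  exact Real.cosh_le_exp_half_sq θ

end SignPatterns
-- Moments under product weights and Jensen's inequality
section ProductWeights

variable {Ξ : Type*} [Fintype Ξ]

lemma sum_fin_succ_fun {n : ℕ} (F : (Fin (n + 1) → Ξ) → ℝ) :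
    ∑ x, F x = ∑ a, ∑ x, F (Fin.cons a x) := by
  rw [← (Fin.consEquiv fun _ : Fin (n + 1) => Ξ).sum_comp, Fintype.sum_prod_type]
  rfl

/-- First and second moments of `∑ᵢ f(xᵢ)` for independent `xᵢ` with weights `ρ`. -/
lemma sum_prod_weight_moments (ρ f : Ξ → ℝ) (hρ : ∑ a, ρ a = 1) (n : ℕ) :
    ∑ x : Fin n → Ξ, ∏ i, ρ (x i) = 1 ∧
    ∑ x : Fin n → Ξ, (∏ i, ρ (x i)) * ∑ i, f (x i) = n * ∑ a, ρ a * f a ∧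
    ∑ x : Fin n → Ξ, (∏ i, ρ (x i)) * (∑ i, f (x i)) ^ 2
      = n * (∑ a, ρ a * f a ^ 2) + n * (n - 1) * (∑ a, ρ a * f a) ^ 2 := by
  have h0 : ∀ n : ℕ, ∑ x : Fin n → Ξ, ∏ i, ρ (x i) = 1 := fun n => by
    rw [← Fintype.sum_pow, hρ, one_pow]
  induction n with
  | zero => simp
  | succ n ih =>
    obtain ⟨-, ih1, ih2⟩ := ih
    refine ⟨h0 _, ?_, ?_⟩
    · rw [sum_fin_succ_fun]
      simp only [Fin.prod_univ_succ, Fin.sum_univ_succ, Fin.cons_zero, Fin.cons_succ]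
      have : ∀ a, ∑ x : Fin n → Ξ, ρ a * (∏ i, ρ (x i)) * (f a + ∑ i, f (x i))
          = (ρ a * f a) * 1 + ρ a * (n * ∑ a, ρ a * f a) := by
        intro a
        rw [← ih1, ← h0 n, Finset.mul_sum, Finset.mul_sum, ← Finset.sum_add_distrib]
        exact Finset.sum_congr rfl fun x _ => by ring
      simp_rw [this]
      rw [Finset.sum_add_distrib, ← Finset.sum_mul, ← Finset.sum_mul, hρ]
      push_cast
      ring
    · rw [sum_fin_succ_fun]
      simp only [Fin.prod_univ_succ, Fin.sum_univ_succ, Fin.cons_zero, Fin.cons_succ]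
      have : ∀ a, ∑ x : Fin n → Ξ, ρ a * (∏ i, ρ (x i)) * (f a + ∑ i, f (x i)) ^ 2
          = (ρ a * f a ^ 2) * 1 + (ρ a * f a) * (2 * (n * ∑ a, ρ a * f a))
            + ρ a * (n * (∑ a, ρ a * f a ^ 2) + n * (n - 1) * (∑ a, ρ a * f a) ^ 2) := by
        intro a
        rw [← ih2, ← ih1, ← h0 n, Finset.mul_sum, Finset.mul_sum, Finset.mul_sum, Finset.mul_sum,
          ← Finset.sum_add_distrib, ← Finset.sum_add_distrib]
        exact Finset.sum_congr rfl fun x _ => by ring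
      simp_rw [this]
      rw [Finset.sum_add_distrib, Finset.sum_add_distrib, ← Finset.sum_mul, ← Finset.sum_mul,
        ← Finset.sum_mul, hρ]
      push_cast
      ring

/-- Jensen's inequality for `exp (-Y)` and unnormalised finite weights. -/
lemma mul_exp_neg_le_sum {X : Type*} (A : Finset X) (p Y : X → ℝ) (hp : ∀ x ∈ A, 0 ≤ p x)
    (hP : 0 < ∑ x ∈ A, p x) :
    (∑ x ∈ A, p x) * Real.exp (-((∑ x ∈ A, p x * Y x) / ∑ x ∈ A, p x))
      ≤ ∑ x ∈ A, p x * Real.exp (-Y x) := by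
  set y := (∑ x ∈ A, p x * Y x) / ∑ x ∈ A, p x with hy
  -- Tangent line of exp(-Y) at the weighted mean y; its linear part cancels on summation.
  have h1 : ∀ x ∈ A, p x * (Real.exp (-y) * (1 + y) - Real.exp (-y) * Y x)
      ≤ p x * Real.exp (-Y x) := by
    intro x hx
    refine mul_le_mul_of_nonneg_left ?_ (hp x hx)
    have h2 := Real.add_one_le_exp (-Y x + y)
    have h3 : Real.exp (-Y x) = Real.exp (-y) * Real.exp (-Y x + y) := by
      rw [← Real.exp_add]; ring_nf
    rw [h3]
    nlinarith [Real.exp_pos (-y)]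
  refine le_trans (le_of_eq ?_) (Finset.sum_le_sum h1)
  have h4 : ∑ x ∈ A, p x * Y x = y * ∑ x ∈ A, p x := by rw [hy]; field_simp
  calc _ = Real.exp (-y) * (1 + y) * (∑ x ∈ A, p x) - Real.exp (-y) * (∑ x ∈ A, p x * Y x) := by
        rw [h4]; ring
    _ = _ := by
        rw [Finset.mul_sum, Finset.mul_sum, ← Finset.sum_sub_distrib]
        exact Finset.sum_congr rfl fun x _ => by ring

end ProductWeights

/-! ### Sums over tuples: factorisation, large overlaps, tilted weights -/

section Patterns

variable {ι : Type*} [Fintype ι] [DecidableEq ι] {n : ℕ}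

/-- The sum over all tuples of configurations of a product over sites. -/
lemma sum_tuple_prod (f : (ι → ℤˣ) → ℝ) :
    ∑ σ : ι → Spin n, ∏ i, f (fun s => σ s i)
      = (2 ^ Fintype.card ι * patternAvg f) ^ n := by
  rw [patternAvg, mul_inv_cancel_left₀ (by positivity), Fintype.sum_pow]
  exact Fintype.sum_equiv (Equiv.piComm fun _ _ => ℤˣ) _ _ fun σ => rfl

lemma sum_tuple_exp_pairSum (β : ℝ) :
    ∑ σ : ι → Spin n, Real.exp (β * ∑ i, pairSum fun s => σ s i)
      = 2 ^ (n * Fintype.card ι) * pairMGF ι β ^ n := by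
  simp_rw [Finset.mul_sum, Real.exp_sum]
  rw [sum_tuple_prod fun y => Real.exp (β * pairSum y), mul_pow, ← pow_mul, mul_comm n]
  rfl

/-- Chernoff bound for the number of tuples with a large overlap. -/
lemma card_overlap_gt_le (hn : 0 < n) {s t : ι} (hst : s ≠ t) {ε : ℝ} (hε : 0 ≤ ε) :
    ((Finset.univ.filter fun σ : ι → Spin n => ε < |overlap σ s t|).card : ℝ)
      ≤ 2 * (2 ^ (n * Fintype.card ι) * Real.exp (-(n * ε ^ 2 / 2))) := by
  have hn' : (0 : ℝ) < n := by exact_mod_cast hn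
  -- The optimal choices θ = ±ε treat the two tails at once: nθ²/2 - nε² = -nε²/2.
  have hcount : ∀ θ : ℝ, θ ^ 2 = ε ^ 2 →
      ∑ σ : ι → Spin n, Real.exp (θ * (n * overlap σ s t) - n * ε ^ 2)
        ≤ 2 ^ (n * Fintype.card ι) * Real.exp (-(n * ε ^ 2 / 2)) := by
    intro θ hθ
    have h1 : ∀ σ : ι → Spin n, Real.exp (θ * (n * overlap σ s t) - n * ε ^ 2)
        = Real.exp (-(n * ε ^ 2))
          * ∏ i, Real.exp (θ * (((σ s i : ℤ) : ℝ) * ((σ t i : ℤ) : ℝ))) := by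
      intro σ
      rw [← Real.exp_sum, ← Real.exp_add, overlap_apply, mul_div_cancel₀ _ hn'.ne',
        ← Finset.mul_sum]
      ring_nf
    simp_rw [h1]
    rw [← Finset.mul_sum, sum_tuple_prod fun y : ι → ℤˣ =>
      Real.exp (θ * (((y s : ℤ) : ℝ) * ((y t : ℤ) : ℝ))), mul_pow, ← pow_mul, mul_comm n,
      mul_left_comm]
    refine mul_le_mul_of_nonneg_left ?_ (by positivity)
    have h0 : 0 ≤ patternAvg fun y : ι → ℤˣ =>
        Real.exp (θ * (((y s : ℤ) : ℝ) * ((y t : ℤ) : ℝ))) :=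
      mul_nonneg (by positivity) (Finset.sum_nonneg fun y _ => (Real.exp_pos _).le)
    calc _ ≤ Real.exp (-(n * ε ^ 2)) * Real.exp (θ ^ 2 / 2) ^ n :=
          mul_le_mul_of_nonneg_left (pow_le_pow_left₀ h0 (patternAvg_exp_mul_le hst θ) n)
            (Real.exp_pos _).le
      _ = _ := by rw [← Real.exp_nat_mul, ← Real.exp_add, hθ]; ring_nf
  have h2 : ((Finset.univ.filter fun σ : ι → Spin n => ε < |overlap σ s t|).card : ℝ)
      ≤ ∑ σ : ι → Spin n, (Real.exp (ε * (n * overlap σ s t) - n * ε ^ 2)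
        + Real.exp (-ε * (n * overlap σ s t) - n * ε ^ 2)) := by
    rw [Finset.card_filter]
    push_cast
    refine Finset.sum_le_sum fun σ _ => ?_
    split_ifs with h
    · rcases lt_abs.mp h with h | h
      · refine le_add_of_le_of_nonneg (Real.one_le_exp ?_) (Real.exp_pos _).le
        have : 0 ≤ ε * n * (overlap σ s t - ε) :=
          mul_nonneg (by positivity) (by linarith)
        nlinarith
      · refine le_add_of_nonneg_of_le (Real.exp_pos _).le (Real.one_le_exp ?_)
        have : 0 ≤ ε * n * (-overlap σ s t - ε) :=
          mul_nonneg (by positivity) (by linarith)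
        nlinarith
    · positivity
  rw [Finset.sum_add_distrib] at h2
  linarith [hcount ε rfl, hcount (-ε) (by ring)]

/-- All overlaps of a tuple are small. -/
def NearOrthogonal (ε : ℝ) (σ : ι → Spin n) : Prop :=
  ∀ s t, |overlap σ s t - (1 : Matrix ι ι ℝ) s t| ≤ ε

noncomputable instance (ε : ℝ) : DecidablePred (NearOrthogonal (ι := ι) (n := n) ε) :=
  Classical.decPred _

lemma card_not_nearOrthogonal_le (hn : 0 < n) {ε : ℝ} (hε : 0 ≤ ε) :
    ((Finset.univ.filter fun σ : ι → Spin n => ¬ NearOrthogonal ε σ).card : ℝ)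
      ≤ (Fintype.card ι : ℝ) ^ 2
        * (2 * (2 ^ (n * Fintype.card ι) * Real.exp (-(n * ε ^ 2 / 2)))) := by
  have h1 : (Finset.univ.filter fun σ : ι → Spin n => ¬ NearOrthogonal ε σ)
      ⊆ (Finset.univ : Finset (ι × ι)).biUnion fun p =>
        if p.1 = p.2 then ∅ else
          Finset.univ.filter fun σ : ι → Spin n => ε < |overlap σ p.1 p.2| := by
    intro σ hσ
    simp only [Finset.mem_filter, Finset.mem_univ, true_and, NearOrthogonal, not_forall,
      not_le] at hσ
    obtain ⟨s, t, h⟩ := hσ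
    have hst : s ≠ t := by
      rintro rfl
      simp [overlap_self hn] at h
      linarith
    rw [Matrix.one_apply_ne hst, sub_zero] at h
    simp only [Finset.mem_biUnion, Finset.mem_univ, true_and]
    exact ⟨(s, t), by simpa [hst] using h⟩
  calc _ ≤ ∑ p : ι × ι, ((if p.1 = p.2 then ∅ else
          Finset.univ.filter fun σ : ι → Spin n => ε < |overlap σ p.1 p.2|).card : ℝ) := by
        exact_mod_cast (Finset.card_le_card h1).trans Finset.card_biUnion_le
    _ ≤ ∑ _ : ι × ι, 2 * (2 ^ (n * Fintype.card ι) * Real.exp (-(n * ε ^ 2 / 2))) := by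
        refine Finset.sum_le_sum fun p _ => ?_
        split_ifs with h
        · simp; positivity
        · exact card_overlap_gt_le hn h hε
    _ = _ := by simp [Fintype.card_prod, sq]

/-- The lower bound for the exponential sum over near-orthogonal tuples, by Jensen's inequality
under the tilted weights. -/
lemma le_sum_nearOrthogonal (hn : 0 < n) {β c ε : ℝ} (hβ : 0 ≤ β)
    (hβ1 : β * (Fintype.card ι : ℝ) ^ 2 ≤ 1) (hc : 0 ≤ c) (hε : 0 < ε)
    (hsmall : (Fintype.card ι : ℝ) ^ 2 * (1 / n + 4 * β ^ 2 * (Fintype.card ι : ℝ) ^ 4) / ε ^ 2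
      ≤ 1 / 2) :
    2 ^ (n * Fintype.card ι) * pairMGF ι β ^ n
      * ((1 - (Fintype.card ι : ℝ) ^ 2 * (1 / n + 4 * β ^ 2 * (Fintype.card ι : ℝ) ^ 4) / ε ^ 2)
        * Real.exp (-(2 * (c * ((Fintype.card ι : ℝ) ^ 2
          * (1 / n + 4 * β ^ 2 * (Fintype.card ι : ℝ) ^ 4))))))
      ≤ ∑ σ : ι → Spin n with NearOrthogonal ε σ,
        Real.exp (β * (∑ i, pairSum fun s => σ s i)
          - c * ∑ s, ∑ t, (overlap σ s t - (1 : Matrix ι ι ℝ) s t) ^ 2) := by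
  have hn' : (0 : ℝ) < n := by exact_mod_cast hn
  set k : ℝ := (Fintype.card ι : ℝ) with hk
  set v : ℝ := k ^ 2 * (1 / n + 4 * β ^ 2 * k ^ 4) with hv
  set Z : ℝ := 2 ^ Fintype.card ι * pairMGF ι β with hZ
  have hM1 := one_le_pairMGF (ι := ι) β
  have hZ0 : 0 < Z := by positivity
  -- The tilted law of the spins at one site. Under the product weight `p` the sites are
  -- independent, and exp(β ∑ᵢ Sᵢ) = Zⁿ p.
  set ρ : (ι → ℤˣ) → ℝ := fun y => Real.exp (β * pairSum y) / Z with hρ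
  have hρ1 : ∑ y, ρ y = 1 := by
    rw [hρ, ← Finset.sum_div, hZ, pairMGF, patternAvg, mul_inv_cancel_left₀ (by positivity)]
    refine div_self (ne_of_gt ?_)
    exact Finset.sum_pos (fun y _ => Real.exp_pos _) Finset.univ_nonempty
  set p : (ι → Spin n) → ℝ := fun σ => ∏ i, ρ fun s => σ s i with hp
  have hp0 : ∀ σ, 0 ≤ p σ := fun σ => Finset.prod_nonneg fun i _ => by positivity
  have hpe : ∀ σ, Real.exp (β * ∑ i, pairSum fun s => σ s i) = Z ^ n * p σ := by
    intro σ
    simp only [hp, hρ, Finset.prod_div_distrib, Finset.prod_const, Finset.card_univ,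
      Fintype.card_fin]
    rw [← Real.exp_sum, ← Finset.mul_sum]
    field_simp
  have htrans : ∀ F : (Fin n → ι → ℤˣ) → ℝ,
      ∑ σ : ι → Spin n, F (fun i s => σ s i) = ∑ x, F x := fun F =>
    Fintype.sum_equiv (Equiv.piComm fun _ _ => ℤˣ) _ _ fun σ => rfl
  have hp1 : ∑ σ, p σ = 1 := by
    rw [htrans fun x => ∏ i, ρ (x i)]
    exact (sum_prod_weight_moments ρ 0 hρ1 n).1
  -- An off-diagonal overlap is a mean of n independent signs with expectation m, |m| ≤ 2βk²; its
  -- second moment is (n + n(n-1)m²)/n² ≤ 1/n + m².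
  have hq : ∀ s t, ∑ σ, p σ * (overlap σ s t - (1 : Matrix ι ι ℝ) s t) ^ 2
      ≤ 1 / n + 4 * β ^ 2 * k ^ 4 := by
    intro s t
    rcases eq_or_ne s t with rfl | hst
    · simp only [overlap_self hn, Matrix.one_apply_eq, sub_self]
      simp
      positivity
    · set f : (ι → ℤˣ) → ℝ := fun y => ((y s : ℤ) : ℝ) * ((y t : ℤ) : ℝ) with hf
      have h2 := (sum_prod_weight_moments ρ f hρ1 n).2.2
      have hf2 : ∑ y, ρ y * f y ^ 2 = 1 := by
        rw [← hρ1]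
        refine Finset.sum_congr rfl fun y _ => ?_
        have : f y ^ 2 = 1 := by
          simp only [hf]
          rw [mul_pow, sq, sq, unit_sq, unit_sq, one_mul]
        rw [this, mul_one]
      have hm : |∑ y, ρ y * f y| ≤ 2 * β * k ^ 2 := by
        have h3 : ∑ y, ρ y * f y
            = patternAvg (fun y => f y * Real.exp (β * pairSum y)) / pairMGF ι β := by
          have hZ' : pairMGF ι β = Z / 2 ^ Fintype.card ι := by
            rw [hZ, mul_div_cancel_left₀ _ (by positivity)]
          rw [patternAvg, hZ', Finset.mul_sum, Finset.sum_div]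
          refine Finset.sum_congr rfl fun y _ => ?_
          simp only [hρ]
          field_simp
        rw [h3, abs_div, abs_of_pos (by linarith : 0 < pairMGF ι β)]
        exact (div_le_self (abs_nonneg _) hM1).trans (abs_patternAvg_mul_exp_le hst hβ hβ1)
      have hm2 : (∑ y, ρ y * f y) ^ 2 ≤ 4 * β ^ 2 * k ^ 4 := by
        rw [← sq_abs]
        calc _ ≤ (2 * β * k ^ 2) ^ 2 := pow_le_pow_left₀ (abs_nonneg _) hm 2
          _ = _ := by ring
      rw [hf2] at h2
      have h4 : ∑ σ, p σ * (overlap σ s t - (1 : Matrix ι ι ℝ) s t) ^ 2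
          = (∑ x : Fin n → ι → ℤˣ, (∏ i, ρ (x i)) * (∑ i, f (x i)) ^ 2) / (n : ℝ) ^ 2 := by
        rw [← htrans fun x => (∏ i, ρ (x i)) * (∑ i, f (x i)) ^ 2, Finset.sum_div]
        refine Finset.sum_congr rfl fun σ _ => ?_
        rw [Matrix.one_apply_ne hst, sub_zero, overlap_apply, div_pow, mul_div_assoc]
      rw [h4, h2, div_le_iff₀ (by positivity)]
      have h5 : (1 / n + 4 * β ^ 2 * k ^ 4) * (n : ℝ) ^ 2
          = n + n ^ 2 * (4 * β ^ 2 * k ^ 4) := by field_simp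
      rw [h5]
      have h6 : (n : ℝ) * (n - 1) * (∑ y, ρ y * f y) ^ 2 ≤ n ^ 2 * (∑ y, ρ y * f y) ^ 2 :=
        mul_le_mul_of_nonneg_right (by nlinarith) (sq_nonneg _)
      nlinarith [mul_le_mul_of_nonneg_left hm2 (sq_nonneg (n : ℝ))]
  set Y : (ι → Spin n) → ℝ := fun σ =>
    ∑ s, ∑ t, (overlap σ s t - (1 : Matrix ι ι ℝ) s t) ^ 2 with hY
  have hY0 : ∀ σ, 0 ≤ Y σ := fun σ =>
    Finset.sum_nonneg fun s _ => Finset.sum_nonneg fun t _ => sq_nonneg _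
  have hEY : ∑ σ, p σ * Y σ ≤ v := by
    calc ∑ σ, p σ * Y σ
        = ∑ s, ∑ t, ∑ σ, p σ * (overlap σ s t - (1 : Matrix ι ι ℝ) s t) ^ 2 := by
          simp only [hY, Finset.mul_sum]
          rw [Finset.sum_comm]
          exact Finset.sum_congr rfl fun s _ => Finset.sum_comm
      _ ≤ ∑ _ : ι, ∑ _ : ι, (1 / n + 4 * β ^ 2 * k ^ 4) :=
          Finset.sum_le_sum fun s _ => Finset.sum_le_sum fun t _ => hq s t
      _ = v := by simp [hv, hk]; ring
  set A : Finset (ι → Spin n) := Finset.univ.filter (NearOrthogonal ε) with hA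
  have hPA : 1 - v / ε ^ 2 ≤ ∑ σ ∈ A, p σ := by
    have h1 : ∑ σ ∈ A, p σ + ∑ σ with ¬ NearOrthogonal ε σ, p σ = 1 := by
      rw [← hp1]; exact Finset.sum_filter_add_sum_filter_not _ _ _
    -- Markov's inequality: outside `A` some entry of Q - 1 exceeds ε, so `Y` exceeds ε².
    have h2 : ∑ σ : ι → Spin n with ¬ NearOrthogonal ε σ, p σ ≤ v / ε ^ 2 := by
      rw [le_div_iff₀ (by positivity), Finset.sum_mul]
      refine le_trans ?_ hEY
      refine (Finset.sum_le_sum (g := fun σ => p σ * Y σ) fun σ hσ => ?_).trans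
        (Finset.sum_le_sum_of_subset_of_nonneg (Finset.filter_subset _ _)
          fun σ _ _ => mul_nonneg (hp0 σ) (hY0 σ))
      refine mul_le_mul_of_nonneg_left ?_ (hp0 σ)
      simp only [Finset.mem_filter, Finset.mem_univ, true_and, NearOrthogonal, not_forall,
        not_le] at hσ
      obtain ⟨s, t, h⟩ := hσ
      calc ε ^ 2 ≤ (overlap σ s t - (1 : Matrix ι ι ℝ) s t) ^ 2 := by
            rw [← sq_abs (overlap σ s t - _)]
            exact pow_le_pow_left₀ hε.le h.le 2
        _ ≤ ∑ t, (overlap σ s t - (1 : Matrix ι ι ℝ) s t) ^ 2 :=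
            Finset.single_le_sum (f := fun t => (overlap σ s t - (1 : Matrix ι ι ℝ) s t) ^ 2)
              (fun t _ => sq_nonneg _) (Finset.mem_univ t)
        _ ≤ Y σ := Finset.single_le_sum
              (f := fun s => ∑ t, (overlap σ s t - (1 : Matrix ι ι ℝ) s t) ^ 2)
              (fun s _ => Finset.sum_nonneg fun t _ => sq_nonneg _) (Finset.mem_univ s)
    linarith
  have hPpos : 1 / 2 ≤ ∑ σ ∈ A, p σ := by linarith
  have hJ := mul_exp_neg_le_sum A p (fun σ => c * Y σ) (fun σ _ => hp0 σ) (by linarith)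
  -- The factor 2 pays for conditioning on `A`, whose tilted mass is at least 1/2.
  have hy : (∑ σ ∈ A, p σ * (c * Y σ)) / ∑ σ ∈ A, p σ ≤ 2 * (c * v) := by
    rw [div_le_iff₀ (by linarith)]
    have h1 : ∑ σ ∈ A, p σ * (c * Y σ) ≤ c * v := by
      calc _ ≤ ∑ σ, p σ * (c * Y σ) :=
            Finset.sum_le_sum_of_subset_of_nonneg (Finset.filter_subset _ _)
              fun σ _ _ => mul_nonneg (hp0 σ) (mul_nonneg hc (hY0 σ))
        _ = c * ∑ σ, p σ * Y σ := by
            rw [Finset.mul_sum]; exact Finset.sum_congr rfl fun σ _ => by ring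
        _ ≤ _ := mul_le_mul_of_nonneg_left hEY hc
    have hv0 : 0 ≤ v := by positivity
    nlinarith [mul_nonneg hc hv0]
  have hfin : (1 - v / ε ^ 2) * Real.exp (-(2 * (c * v)))
      ≤ ∑ σ ∈ A, p σ * Real.exp (-(c * Y σ)) := by
    refine le_trans ?_ hJ
    exact mul_le_mul hPA (Real.exp_le_exp.mpr (neg_le_neg hy)) (Real.exp_pos _).le (by linarith)
  have hsum : ∑ σ ∈ A, Real.exp (β * (∑ i, pairSum fun s => σ s i) - c * Y σ)
      = Z ^ n * ∑ σ ∈ A, p σ * Real.exp (-(c * Y σ)) := by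
    rw [Finset.mul_sum]
    refine Finset.sum_congr rfl fun σ _ => ?_
    rw [sub_eq_add_neg, Real.exp_add, hpe]
    ring
  rw [hsum, show (2 : ℝ) ^ (n * Fintype.card ι) * pairMGF ι β ^ n = Z ^ n by
    rw [hZ, mul_pow, ← pow_mul, mul_comm n]]
  exact mul_le_mul_of_nonneg_left hfin (by positivity)

end Patterns
-- Linearly dependent tuples
section Dependent

/-- Signs chosen to match the coefficients give ∑|c_j| = 1. Flipping the sign at an index with c ≠ 0
gives |1 - 2|c|| = 1, hence |c| = 1, and nothing is left for the other indices. -/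
lemma exists_unique_coeff_of_abs_sum_eq_one {J : Type*} [Fintype J] [DecidableEq J] (c : J → ℝ)
    (h : ∀ p : J → ℤˣ, |∑ j, c j * ((p j : ℤ) : ℝ)| = 1) :
    ∃ j₀, (c j₀ = 1 ∨ c j₀ = -1) ∧ ∀ j, j ≠ j₀ → c j = 0 := by
  obtain ⟨j₀, hj₀⟩ : ∃ j, c j ≠ 0 := by
    by_contra! hc
    have := h 1
    simp [hc] at this
  set p : J → ℤˣ := fun j => if 0 ≤ c j then 1 else -1 with hp
  have hcp : ∀ j, c j * ((p j : ℤ) : ℝ) = |c j| := by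
    intro j
    by_cases hj : 0 ≤ c j
    · simp [hp, hj, abs_of_nonneg hj]
    · simp [hp, hj, abs_of_neg (not_le.mp hj)]
  have h1 : ∑ j, |c j| = 1 := by
    have := h p
    simp_rw [hcp] at this
    rwa [abs_of_nonneg (Finset.sum_nonneg fun j _ => abs_nonneg _)] at this
  have h2 : |(∑ j, |c j|) - 2 * (|c j₀|)| = 1 := by
    rw [← h (Function.update p j₀ (-p j₀))]
    congr 1
    rw [← Finset.add_sum_erase _ _ (Finset.mem_univ j₀),
      ← Finset.add_sum_erase _ _ (Finset.mem_univ j₀)]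
    have herase : ∑ j ∈ Finset.univ.erase j₀,
        c j * ((Function.update p j₀ (-p j₀) j : ℤ) : ℝ) = ∑ j ∈ Finset.univ.erase j₀, |c j| :=
      Finset.sum_congr rfl fun j hj => by
        rw [Function.update_of_ne (Finset.ne_of_mem_erase hj), hcp]
    rw [herase, Function.update_self, Units.val_neg, Int.cast_neg, mul_neg, hcp]
    ring
  have hpos : 0 < |c j₀| := abs_pos.mpr hj₀
  have h3 : |c j₀| = 1 := by
    rw [h1] at h2
    rcases abs_eq (zero_le_one' ℝ) |>.mp h2 with h | h <;> linarith
  refine ⟨j₀, (abs_eq zero_le_one).mp h3, fun j hj => ?_⟩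
  rw [← Finset.add_sum_erase _ _ (Finset.mem_univ j₀), h3] at h1
  have h4 : ∑ j ∈ Finset.univ.erase j₀, |c j| = 0 := by linarith
  exact abs_eq_zero.mp ((Finset.sum_eq_zero_iff_of_nonneg fun j _ => abs_nonneg _).mp h4 j
    (Finset.mem_erase.mpr ⟨hj, Finset.mem_univ j⟩))

lemma unit_cast_inj {u v : ℤˣ} (h : ((u : ℤ) : ℝ) = ((v : ℤ) : ℝ)) : u = v :=
  Units.ext (by exact_mod_cast h)

variable {ι : Type*} {n : ℕ}

/-- The configurations of the tuple are pairwise distinct, even up to a global flip. -/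
def PairwiseNonparallel (σ : ι → Spin n) : Prop :=
  Pairwise fun s t => σ s ≠ σ t ∧ σ s ≠ -σ t

variable [Fintype ι]

/-- A linearly dependent tuple of distinct partitions is determined by an independent subtuple,
in which some sign pattern does not occur. -/
lemma exists_missing_pattern (σ : ι → Spin n) (hpar : PairwiseNonparallel σ)
    (hdep : ¬ LinearIndependent ℝ (signMatrix σ).row) :
    ∃ J : Finset ι, LinearIndependent ℝ (signMatrix fun j : J => σ j).row ∧
      (∃ p : J → ℤˣ, ∀ i, (fun j : J => σ j i) ≠ p) ∧
      ∃ φ : ι → (J → ℤˣ) → ℤˣ, ∀ s i, σ s i = φ s fun j => σ j i := by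
  classical
  -- `J` indexes a maximal independent subfamily of the rows; every row is a combination of those in
  -- `J`.
  obtain ⟨κ, a, ha, hspan, hli⟩ := exists_linearIndependent' ℝ (signMatrix σ).row
  set J : Finset ι := Finset.univ.filter fun s => s ∈ Set.range a with hJ
  have hmem : ∀ j : J, ∃ q, a q = j := fun j => (Finset.mem_filter.mp j.2).2
  choose e he using hmem
  have hrow : (signMatrix fun j : J => σ j).row = ((signMatrix σ).row ∘ a) ∘ e := by
    funext j
    change (fun i => ((σ j i : ℤ) : ℝ)) = fun i => ((σ (a (e j)) i : ℤ) : ℝ)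
    rw [he]
  have hJli : LinearIndependent ℝ (signMatrix fun j : J => σ j).row := by
    rw [hrow]
    refine hli.comp e fun j j' h => ?_
    have := congrArg a h
    rw [he, he] at this
    exact Subtype.ext this
  have hJspan : ∀ s, (signMatrix σ).row s
      ∈ Submodule.span ℝ (Set.range (signMatrix fun j : J => σ j).row) := by
    intro s
    have h1 : (signMatrix σ).row s ∈ Submodule.span ℝ (Set.range ((signMatrix σ).row ∘ a)) := by
      rw [hspan]; exact Submodule.subset_span ⟨s, rfl⟩
    refine Submodule.span_mono ?_ h1
    rintro _ ⟨q, rfl⟩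
    exact ⟨⟨a q, by simp [hJ]⟩, rfl⟩
  have hcoef : ∀ s, ∃ c : J → ℝ, ∀ i, ∑ j, c j * ((σ j i : ℤ) : ℝ) = ((σ s i : ℤ) : ℝ) := by
    intro s
    obtain ⟨c, hc⟩ := (Submodule.mem_span_range_iff_exists_fun ℝ).mp (hJspan s)
    refine ⟨c, fun i => ?_⟩
    have := congrFun hc i
    simpa [signMatrix, Matrix.row] using this
  choose c hc using hcoef
  refine ⟨J, hJli, ?_, ?_⟩
  -- If every pattern on `J` occurred, a row outside `J` would be a linear form with values ±1 on
  -- all sign vectors, hence plus or minus a row of `J`, contrary to nonparallelism.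
  · by_contra! hall
    obtain ⟨s, hs⟩ : ∃ s, s ∉ J := by
      by_contra! hJall
      refine hdep ?_
      have : (signMatrix σ).row = (signMatrix fun j : J => σ j).row ∘ fun s => ⟨s, hJall s⟩ :=
        rfl
      rw [this]
      exact hJli.comp _ fun s t h => congrArg Subtype.val h
    obtain ⟨j₀, hj₀, hz⟩ := exists_unique_coeff_of_abs_sum_eq_one (c s) fun p => by
      obtain ⟨i, hi⟩ := hall p
      rw [← hi, hc s i, abs_unit]
    have hval : ∀ i, ((σ s i : ℤ) : ℝ) = c s j₀ * ((σ j₀ i : ℤ) : ℝ) := by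
      intro i
      rw [← hc s i, Finset.sum_eq_single j₀ (fun j _ hj => by rw [hz j hj, zero_mul]) (by simp)]
    have hne : s ≠ j₀ := fun h => hs (h ▸ j₀.2)
    rcases hj₀ with h | h
    · refine (hpar hne).1 (funext fun i => unit_cast_inj ?_)
      rw [hval, h, one_mul]
    · refine (hpar hne).2 (funext fun i => unit_cast_inj ?_)
      rw [hval, h]; simp
  -- The coefficients do not depend on the site, so equal `J`-patterns at two sites force equal
  -- spins. The value 1 on patterns that do not occur is arbitrary.
  · refine ⟨fun s p => if h : ∃ i, (fun j : J => σ j i) = p then σ s h.choose else 1,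
      fun s i => ?_⟩
    have h : ∃ i', (fun j : J => σ j i') = fun j : J => σ j i := ⟨i, rfl⟩
    simp only [dif_pos h]
    refine unit_cast_inj ?_
    rw [← hc s i, ← hc s h.choose]
    refine Finset.sum_congr rfl fun j _ => ?_
    rw [congrFun h.choose_spec j]

variable [DecidableEq ι]

lemma card_missing_pattern (p : ι → ℤˣ) :
    ((Finset.univ.filter fun σ : ι → Spin n => ∀ i, (fun s => σ s i) ≠ p).card : ℝ)
      = (2 ^ Fintype.card ι - 1) ^ n := by
  have h := sum_tuple_prod (n := n) fun y : ι → ℤˣ => if y ≠ p then (1 : ℝ) else 0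
  have h1 : 2 ^ Fintype.card ι * patternAvg (fun y : ι → ℤˣ => if y ≠ p then (1 : ℝ) else 0)
      = 2 ^ Fintype.card ι - 1 := by
    rw [patternAvg, mul_inv_cancel_left₀ (by positivity), Finset.sum_boole,
      Finset.filter_ne' Finset.univ p, Finset.card_erase_of_mem (Finset.mem_univ p),
      Nat.cast_sub (Finset.card_pos.mpr ⟨p, Finset.mem_univ p⟩)]
    simp
  rw [h1] at h
  rw [← h, Finset.card_filter]
  push_cast
  refine Finset.sum_congr rfl fun σ _ => ?_
  rw [Finset.prod_boole]
  simp

/-- The number of ways to extend a `J`-tuple to a dependent tuple, up to a factor depending on the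
missing pattern. -/
def extensionCount (ι : Type*) [Fintype ι] [DecidableEq ι] (J : Finset ι) : ℕ :=
  Fintype.card (J → ℤˣ) * Fintype.card (ι → (J → ℤˣ) → ℤˣ)

/-- The contribution of linearly dependent tuples of distinct partitions. -/
lemma sum_dependent_le (hn : 0 < n) {a b : ι → ℝ} (hab : a ≤ b)
    (D : Finset (ι → Spin n)) (hD : ∀ σ ∈ D, PairwiseNonparallel σ ∧
      ¬ LinearIndependent ℝ (signMatrix σ).row) :
    ∑ σ ∈ D, boxProb σ a b ≤ ∑ J : Finset ι, extensionCount ι J *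
      ((2 ^ J.card - 1) ^ n * ((√(2 * Real.pi))⁻¹ ^ J.card * √n ^ J.card
        * ∏ s ∈ J, (b s - a s))) := by
  classical
  have hdata := fun σ : D => exists_missing_pattern σ.1 (hD σ.1 σ.2).1 (hD σ.1 σ.2).2
  choose J hli hmiss φ hφ using hdata
  choose p hp using hmiss
  -- A dependent tuple is encoded by the index set, the missing pattern, the extension rule and the
  -- subtuple; the last two determine it, so the encoding is injective.
  let T := Σ J : Finset ι, ((J → ℤˣ) × (ι → (J → ℤˣ) → ℤˣ)) × (J → Spin n)
  let g : D → T := fun σ => ⟨J σ, (p σ, φ σ), fun j => σ.1 j⟩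
  have hg : Function.Injective g := by
    have hext : ∀ σ : D, σ.1 = fun s i => (g σ).2.1.2 s fun j => (g σ).2.2 j i := by
      intro σ
      ext s i
      exact congrArg (fun u : ℤˣ => (u : ℤ)) (hφ σ s i)
    intro σ τ h
    refine Subtype.ext ?_
    rw [hext σ, hext τ, h]
  let B : Finset ι → ℝ := fun J => (√(2 * Real.pi))⁻¹ ^ J.card * √n ^ J.card
    * ∏ s ∈ J, (b s - a s)
  have hB : ∀ J, 0 ≤ B J := fun J => mul_nonneg (by positivity)
    (Finset.prod_nonneg fun s _ => sub_nonneg.mpr (hab s))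
  -- The weight vanishes unless the recorded pattern is really missing; summing over subtuples then
  -- yields (2^|J| - 1)^n.
  let W : T → ℝ := fun x => if ∀ i, (fun j => x.2.2 j i) ≠ x.2.1.1 then B x.1 else 0
  have hW0 : ∀ x, 0 ≤ W x := fun x => by
    simp only [W]; split_ifs; exacts [hB _, le_rfl]
  have hw : ∀ σ : D, boxProb σ.1 a b ≤ W (g σ) := by
    intro σ
    have : W (g σ) = B (J σ) := if_pos (hp σ)
    rw [this]
    refine (boxProb_le_restrict σ.1 a b (J σ)).trans ?_
    have h := boxProb_le_of_linearIndependent hn (fun j : J σ => σ.1 j) (hli σ)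
      (a := fun j => a j) (b := fun j => b j) (fun j => hab j)
    rw [Fintype.card_coe, Finset.prod_coe_sort (J σ) fun s => b s - a s] at h
    exact h
  calc ∑ σ ∈ D, boxProb σ a b = ∑ σ : D, boxProb σ.1 a b := (Finset.sum_coe_sort D _).symm
    _ ≤ ∑ σ : D, W (g σ) := Finset.sum_le_sum fun σ _ => hw σ
    _ = ∑ x ∈ Finset.univ.image g, W x := (Finset.sum_image fun _ _ _ _ h => hg h).symm
    _ ≤ ∑ x, W x := Finset.sum_le_sum_of_subset_of_nonneg (Finset.subset_univ _)
        fun x _ _ => hW0 x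
    _ = _ := by
        rw [Fintype.sum_sigma]
        refine Finset.sum_congr rfl fun J _ => ?_
        rw [Fintype.sum_prod_type, Fintype.sum_prod_type]
        have h1 : ∀ (q : J → ℤˣ) (ψ : ι → (J → ℤˣ) → ℤˣ),
            ∑ τ : J → Spin n, W ⟨J, (q, ψ), τ⟩ = (2 ^ J.card - 1) ^ n * B J := by
          intro q ψ
          have h2 := card_missing_pattern (n := n) q
          rw [Fintype.card_coe] at h2
          rw [← h2, Finset.card_filter]
          push_cast
          rw [Finset.sum_mul]
          refine Finset.sum_congr rfl fun τ _ => ?_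
          simp only [W, ite_mul, one_mul, zero_mul]
        simp only [h1, Finset.sum_const, Finset.card_univ, nsmul_eq_mul, extensionCount]
        push_cast
        ring

end Dependent
-- From partitions to tuples of configurations
section Counting

variable {n : ℕ}

lemma energy_eq_abs_signedEnergy (x : Fin n → ℝ) (σ : Spin n) :
    energy x σ = |signedEnergy x σ| := by
  rw [energy, signedEnergy, abs_div, abs_of_nonneg (Real.sqrt_nonneg _)]

lemma signedEnergy_neg (x : Fin n → ℝ) (σ : Spin n) :
    signedEnergy x (-σ) = -signedEnergy x σ := by
  simp [signedEnergy, Finset.sum_neg_distrib, neg_div]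

/-- Partitions with energy in `[a, b]` are counted by the configurations with signed energy in
`[a, b]`. -/
lemma numPoints_eq_card (x : Fin n → ℝ) (hx : ∀ σ : Spin n, signedEnergy x σ ≠ 0) {a : ℝ}
    (ha : 0 ≤ a) (b : ℝ) :
    numPoints x a b = Fintype.card {σ : Spin n // signedEnergy x σ ∈ Set.Icc a b} := by
  have hinj : Set.InjOn (fun σ : Spin n => (Quotient.mk (flipSetoid n) σ : Partition n))
      {σ | signedEnergy x σ ∈ Set.Icc a b} := by
    intro σ hσ τ hτ h
    rcases Quotient.exact h with h | h
    · exact h.symm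
    -- Two opposite configurations both lie in the window only if their signed energy is 0, the case
    -- that `hx` excludes.
    · exfalso
      have h1 : signedEnergy x τ = -signedEnergy x σ := by rw [h, signedEnergy_neg]
      have h2 : a ≤ signedEnergy x σ := hσ.1
      have h3 : a ≤ signedEnergy x τ := hτ.1
      exact hx σ (by linarith)
  have himg : (fun σ : Spin n => (Quotient.mk (flipSetoid n) σ : Partition n)) ''
      {σ | signedEnergy x σ ∈ Set.Icc a b} = {p | Partition.energy x p ∈ Set.Icc a b} := by
    ext p
    constructor
    · rintro ⟨σ, hσ, rfl⟩
      change energy x σ ∈ Set.Icc a b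
      rw [energy_eq_abs_signedEnergy, abs_of_nonneg (ha.trans hσ.1)]
      exact hσ
    · induction p using Quotient.inductionOn with
      | h σ =>
        intro hp
        change energy x σ ∈ Set.Icc a b at hp
        rw [energy_eq_abs_signedEnergy] at hp
        rcases le_total 0 (signedEnergy x σ) with h | h
        · rw [abs_of_nonneg h] at hp
          exact ⟨σ, hp, rfl⟩
        · rw [abs_of_nonpos h, ← signedEnergy_neg] at hp
          exact ⟨-σ, hp, Quotient.sound (Or.inr (neg_neg σ).symm)⟩
  rw [numPoints, ← himg, hinj.ncard_image, ← Nat.card_coe_set_eq,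
    Nat.card_eq_fintype_card]
  rfl

/-- A falling factorial counts injections, and a family of injections, one per block, is a tuple
that is injective on each block. -/
lemma prod_descFactorial_card {m : ℕ} {S : Type*} [Fintype S] [DecidableEq S] (k : Fin m → ℕ)
    (p : Fin m → S → Prop) [∀ l, DecidablePred (p l)] :
    ∏ l, (Fintype.card {σ // p l σ}).descFactorial (k l)
      = (Finset.univ.filter fun σ : (Σ l, Fin (k l)) → S =>
          (∀ l, Function.Injective fun j => σ ⟨l, j⟩) ∧ ∀ s, p s.1 (σ s)).card := by
  have h1 : ∀ l, (Fintype.card {σ // p l σ}).descFactorial (k l)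
      = Fintype.card (Fin (k l) ↪ {σ // p l σ}) := fun l => by
    rw [Fintype.card_embedding_eq, Fintype.card_fin]
  simp_rw [h1]
  rw [← Fintype.card_pi, ← Fintype.card_subtype]
  refine Fintype.card_congr
    { toFun := fun f => ⟨fun s => (f s.1 s.2).1,
        fun l i j h => (f l).injective (Subtype.ext h), fun s => (f s.1 s.2).2⟩
      invFun := fun σ l => ⟨fun j => ⟨σ.1 ⟨l, j⟩, σ.2.2 ⟨l, j⟩⟩,
        fun i j h => σ.2.1 l (congrArg Subtype.val h)⟩
      left_inv := fun f => rfl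
      right_inv := fun σ => rfl }

lemma linearIndependent_single (hn : 0 < n) (σ : Spin n) :
    LinearIndependent ℝ (signMatrix fun _ : Unit => σ).row := by
  refine linearIndependent_unique_iff.mpr fun h => ?_
  have := congrFun h ⟨0, hn⟩
  simp only [Matrix.row, signMatrix, Matrix.of_apply, Pi.zero_apply] at this
  have h2 := abs_unit (σ ⟨0, hn⟩)
  rw [this] at h2
  simp at h2

/-- A level set is a box with a side of length zero. -/
lemma measure_signedEnergy_eq (hn : 0 < n) (σ : Spin n) (c : ℝ) :
    stdGaussianPi (Fin n) {x | signedEnergy x σ = c} = 0 := by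
  have h := boxProb_le_of_linearIndependent hn (fun _ : Unit => σ) (linearIndependent_single hn σ)
    (a := fun _ => c) (b := fun _ => c) le_rfl
  simp only [sub_self, Finset.univ_unique, Finset.prod_singleton,
    mul_zero] at h
  have h0 := le_antisymm h (boxProb_nonneg _ _ _)
  rw [boxProb, measureReal_eq_zero_iff] at h0
  refine measure_mono_null ?_ h0
  intro x hx s
  exact ⟨le_of_eq (Eq.symm hx), le_of_eq hx⟩

lemma ae_signedEnergy_ne_zero (hn : 0 < n) :
    ∀ᵐ x ∂(stdGaussianPi (Fin n)), ∀ σ : Spin n, signedEnergy x σ ≠ 0 := by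
  rw [ae_all_iff]
  intro σ
  rw [ae_iff]
  simpa using measure_signedEnergy_eq hn σ 0

section Moments

variable {Ω : Type*} [MeasurableSpace Ω] {P : Measure Ω} {X : Fin n → Ω → ℝ}

lemma map_eq_stdGaussianPi (hind : iIndepFun X P)
    (hlaw : ∀ i, HasLaw (X i) (gaussianReal 0 1) P) :
    P.map (fun ω i => X i ω) = stdGaussianPi (Fin n) := by
  have hprob : IsProbabilityMeasure P := hind.isProbabilityMeasure
  rw [(iIndepFun_iff_map_fun_eq_pi_map fun i => (hlaw i).aemeasurable).mp hind]
  congr 1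
  ext1 i
  exact (hlaw i).map_eq

variable {m : ℕ} {k : Fin m → ℕ}

/-- Tuples whose entries within each block are distinct. -/
noncomputable def blockInjective (n : ℕ) (k : Fin m → ℕ) : Finset ((Σ l, Fin (k l)) → Spin n) :=
  Finset.univ.filter fun σ => ∀ l, Function.Injective fun j => σ ⟨l, j⟩

/-- Mixed factorial moments as sums over tuples of configurations. -/
lemma integral_prod_descFactorial (hn : 0 < n) (hind : iIndepFun X P)
    (hlaw : ∀ i, HasLaw (X i) (gaussianReal 0 1) P) (a b : Fin m → ℝ) (ha : ∀ l, 0 ≤ a l) :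
    ∫ ω, ∏ l, ((numPoints (fun i => X i ω) (a l) (b l)).descFactorial (k l) : ℝ) ∂P
      = ∑ σ ∈ blockInjective n k, boxProb σ (fun s => a s.1) (fun s => b s.1) := by
  classical
  have hmap := map_eq_stdGaussianPi hind hlaw
  have hXm : AEMeasurable (fun ω i => X i ω) P :=
    aemeasurable_pi_lambda _ fun i => (hlaw i).aemeasurable
  set E : ((Σ l, Fin (k l)) → Spin n) → Set (Fin n → ℝ) := fun σ =>
    {x | ∀ s, signedEnergy x (σ s) ∈ Set.Icc (a s.1) (b s.1)} with hE
  have hEm : ∀ σ, MeasurableSet (E σ) := fun σ => by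
    have : E σ = ⋂ s, (fun x => signedEnergy x (σ s)) ⁻¹' Set.Icc (a s.1) (b s.1) := by
      ext x; simp [hE]
    rw [this]
    exact MeasurableSet.iInter fun s => measurable_signedEnergy (σ s) measurableSet_Icc
  set G : (Fin n → ℝ) → ℝ := fun x =>
    ∑ σ ∈ blockInjective n k, (E σ).indicator (fun _ => (1 : ℝ)) x with hG
  have hGm : Measurable G := Finset.measurable_sum _ fun σ _ =>
    measurable_const.indicator (hEm σ)
  have hae : ∀ᵐ ω ∂P, ∏ l, ((numPoints (fun i => X i ω) (a l) (b l)).descFactorial (k l) : ℝ)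
      = G fun i => X i ω := by
    have h1 : ∀ᵐ x ∂(P.map fun ω i => X i ω), ∀ σ : Spin n, signedEnergy x σ ≠ 0 := by
      rw [hmap]; exact ae_signedEnergy_ne_zero hn
    filter_upwards [ae_of_ae_map hXm h1] with ω hω
    have h2 := prod_descFactorial_card (S := Spin n) k
      (fun l σ => signedEnergy (fun i => X i ω) σ ∈ Set.Icc (a l) (b l))
    have h3 : ∀ l, numPoints (fun i => X i ω) (a l) (b l)
        = Fintype.card {σ // signedEnergy (fun i => X i ω) σ ∈ Set.Icc (a l) (b l)} := fun l => by
      rw [numPoints_eq_card _ hω (ha l)]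
    simp_rw [h3]
    rw [← Nat.cast_prod, h2, ← Finset.filter_filter, Finset.card_filter]
    push_cast
    simp only [hG, hE, Set.indicator_apply, Set.mem_ofPred_eq]
    exact Finset.sum_congr (by simp [blockInjective]) fun σ _ => rfl
  rw [integral_congr_ae hae, ← integral_map hXm (f := G) hGm.aestronglyMeasurable, hmap]
  simp only [hG]
  rw [integral_finsetSum _ fun σ _ => (integrable_const (1 : ℝ)).indicator (hEm σ)]
  refine Finset.sum_congr rfl fun σ _ => ?_
  rw [integral_indicator (hEm σ)]
  simp [boxProb, hE]

end Moments

lemma boxProb_eq_zero_of_forall {ι : Type*} (hn : 0 < n) (σ : ι → Spin n) (a b : ι → ℝ) (s : ι)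
    (c : ℝ) (h : ∀ x, (∀ s, signedEnergy x (σ s) ∈ Set.Icc (a s) (b s)) →
      signedEnergy x (σ s) = c) : boxProb σ a b = 0 := by
  rw [boxProb, measureReal_eq_zero_iff]
  exact measure_mono_null h (measure_signedEnergy_eq hn (σ s) c)

/-- Tuples with two parallel entries do not contribute to the mixed factorial moments. -/
lemma boxProb_eq_zero_of_parallel {m : ℕ} {k : Fin m → ℕ} (hn : 0 < n) {a b : Fin m → ℝ}
    (ha : ∀ l, 0 ≤ a l)
    (hdisj : Pairwise fun l l' => Disjoint (Set.Ioo (a l) (b l)) (Set.Ioo (a l') (b l')))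
    (σ : (Σ l, Fin (k l)) → Spin n) (hσ : σ ∈ blockInjective n k)
    (hpar : ¬ PairwiseNonparallel σ) :
    boxProb σ (fun s => a s.1) (fun s => b s.1) = 0 := by
  simp only [PairwiseNonparallel, Pairwise, not_forall, not_and_or, not_not] at hpar
  obtain ⟨s, t, hst, h | h⟩ := hpar
  · have hl : s.1 ≠ t.1 := by
      rintro hl
      obtain ⟨l, i⟩ := s
      obtain ⟨l', j⟩ := t
      dsimp only at hl
      subst hl
      exact hst (by rw [(Finset.mem_filter.mp hσ).2 l h])
    -- Equal entries belong to different blocks, whose windows share at most the point `max (a s.1)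
    -- (a t.1)`, since anything larger would make the interiors meet.
    refine boxProb_eq_zero_of_forall hn σ _ _ s (max (a s.1) (a t.1)) fun x hx => ?_
    have h1 := hx s
    have h2 := hx t
    rw [← h] at h2
    refine le_antisymm ?_ (max_le h1.1 h2.1)
    by_contra! hlt
    have h3 : max (a s.1) (a t.1) < min (b s.1) (b t.1) :=
      hlt.trans_le (le_min h1.2 h2.2)
    obtain ⟨y, hy1, hy2⟩ := exists_between h3
    exact Set.disjoint_left.mp (hdisj hl)
      ⟨(le_max_left _ _).trans_lt hy1, hy2.trans_le (min_le_left _ _)⟩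
      ⟨(le_max_right _ _).trans_lt hy1, hy2.trans_le (min_le_right _ _)⟩
  -- Opposite signed energies that are both nonnegative vanish.
  · refine boxProb_eq_zero_of_forall hn σ _ _ s 0 fun x hx => ?_
    have h1 := (hx s).1
    have h2 := (hx t).1
    have h3 : signedEnergy x (σ s) = -signedEnergy x (σ t) := by rw [h, signedEnergy_neg]
    have := ha s.1
    have := ha t.1
    linarith

end Counting
-- Bounds for the sum over tuples at fixed n
section FiniteBounds

variable {n : ℕ}

lemma scaling_eq (hn : 0 < n) (α : ℝ) :
    scaling n α = √(2 * Real.pi) * Real.exp (α ^ 2 / 2) / 2 ^ n := by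
  obtain ⟨n, rfl⟩ : ∃ m, n = m + 1 := ⟨n - 1, by omega⟩
  have hpi := Real.pi_pos
  have h1 : √(2 / Real.pi) = 2 / √(2 * Real.pi) := by
    rw [eq_div_iff (by positivity), ← Real.sqrt_mul (by positivity),
      show 2 / Real.pi * (2 * Real.pi) = 2 ^ 2 by field_simp, Real.sqrt_sq (by norm_num)]
  rw [scaling, energyDensity, h1, neg_div, Real.exp_neg, Nat.add_sub_cancel, pow_succ (2 : ℝ) n]
  have := Real.exp_pos (α ^ 2 / 2)
  have h2 : 0 < √(2 * Real.pi) := by positivity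
  field_simp

lemma scaling_pos (n : ℕ) (α : ℝ) : 0 < scaling n α := by
  have := Real.pi_pos
  unfold scaling energyDensity
  positivity

/-- The purpose of the scaling: 2^(n|J|) is the number of `J`-tuples and exp(|J|α²/2) compensates
the Gaussian density at height α. -/
lemma gaussian_norm_mul_prod {ι : Type*} (hn : 0 < n) (α : ℝ) (J : Finset ι) (γ : ι → ℝ) :
    (√(2 * Real.pi))⁻¹ ^ J.card * ∏ s ∈ J, (γ s * scaling n α)
      = (∏ s ∈ J, γ s) * (Real.exp (J.card * α ^ 2 / 2) / 2 ^ (n * J.card)) := by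
  have hpi := Real.pi_pos
  have h2 : 0 < √(2 * Real.pi) := by positivity
  rw [Finset.prod_mul_distrib, Finset.prod_const, scaling_eq hn, div_pow, mul_pow,
    ← Real.exp_nat_mul, ← pow_mul, inv_pow, mul_div_assoc (J.card : ℝ)]
  field_simp

variable {ι : Type*} [Fintype ι] [DecidableEq ι]

/-- The contributions of near-orthogonal, of independent but not near-orthogonal, and of
linearly dependent tuples. -/
lemma sum_boxProb_le (hn : 0 < n) {α K ε δ : ℝ} (hα : 0 ≤ α) (c d : ι → ℝ) (hc : ∀ s, 0 ≤ c s)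
    (hcd : ∀ s, c s ≤ d s) (hK : ∀ s, d s ≤ K) (hε : 0 < ε)
    (hε1 : Fintype.card ι * ε ≤ 1 / 2)
    (hdet : ∀ Q : Matrix ι ι ℝ, (∀ s t, |Q s t - (1 : Matrix ι ι ℝ) s t| ≤ ε) →
      |(√Q.det)⁻¹ - 1| ≤ δ)
    (G : Finset (ι → Spin n))
    (hG : ∀ σ ∈ G, ¬ PairwiseNonparallel σ → boxProb σ (fun s => α + c s * scaling n α)
      (fun s => α + d s * scaling n α) = 0) :
    ∑ σ ∈ G, boxProb σ (fun s => α + c s * scaling n α) (fun s => α + d s * scaling n α)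
      ≤ (∏ s, (d s - c s)) * ((1 + δ)
          * Real.exp (Fintype.card ι ^ 2 * (2 * α * (K * scaling n α) + (K * scaling n α) ^ 2))
          * pairMGF ι (α ^ 2 / n) ^ n)
        + (∏ s, (d s - c s)) * (2 * Fintype.card ι ^ 2)
          * (√n ^ Fintype.card ι * Real.exp (Fintype.card ι * α ^ 2 / 2)
            * Real.exp (-(n * ε ^ 2 / 2)))
        + ∑ J : Finset ι, extensionCount ι J * (∏ s ∈ J, (d s - c s))
          * (√n ^ J.card * Real.exp (J.card * α ^ 2 / 2) * (1 - (2 ^ J.card)⁻¹) ^ n) := by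
  classical
  set ξ := scaling n α with hξ
  have hξ0 : 0 < ξ := scaling_pos n α
  set a : ι → ℝ := fun s => α + c s * ξ with ha
  set b : ι → ℝ := fun s => α + d s * ξ with hb
  set η : ℝ := 2 * α * (K * ξ) + (K * ξ) ^ 2 with hη
  set w : (ι → Spin n) → ℝ := fun σ => boxProb σ a b with hw
  have hab : a ≤ b := fun s => by
    simp only [ha, hb]; have := mul_le_mul_of_nonneg_right (hcd s) hξ0.le; linarith
  have hba : ∀ s, b s - a s = (d s - c s) * ξ := fun s => by simp only [ha, hb]; ring
  have haα : ∀ s, α ≤ a s := fun s => by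
    simp only [ha]; have := mul_nonneg (hc s) hξ0.le; linarith
  have hbη : ∀ s t, b s * b t ≤ α ^ 2 + η := by
    intro s t
    have h1 : ∀ s, b s ≤ α + K * ξ := fun s => by
      simp only [hb]; have := mul_le_mul_of_nonneg_right (hK s) hξ0.le; linarith
    have h2 : ∀ s, 0 ≤ b s := fun s => hα.trans ((haα s).trans (hab s))
    calc b s * b t ≤ (α + K * ξ) * (α + K * ξ) :=
          mul_le_mul (h1 s) (h1 t) (h2 t) ((h2 s).trans (h1 s))
      _ = _ := by rw [hη]; ring
  have hγ : 0 ≤ ∏ s, (d s - c s) := Finset.prod_nonneg fun s _ => sub_nonneg.mpr (hcd s)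
  have hnorm := gaussian_norm_mul_prod hn α (Finset.univ : Finset ι) fun s => d s - c s
  rw [Finset.card_univ] at hnorm
  set k := Fintype.card ι with hk
  have hw0 : ∀ σ, 0 ≤ w σ := fun σ => boxProb_nonneg _ _ _
  set LI : (ι → Spin n) → Prop := fun σ => LinearIndependent ℝ (signMatrix σ).row with hLI
  -- The classes may overlap, which is harmless for nonnegative terms; dependent tuples with
  -- parallel entries drop out by `hG`.
  have hsplit : ∑ σ ∈ G, w σ ≤ ∑ σ : ι → Spin n with NearOrthogonal ε σ, w σ
      + ∑ σ : ι → Spin n with ¬ NearOrthogonal ε σ ∧ LI σ, w σ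
      + ∑ σ : ι → Spin n with PairwiseNonparallel σ ∧ ¬ LI σ, w σ := by
    simp only [Finset.sum_filter]
    rw [← Finset.sum_add_distrib, ← Finset.sum_add_distrib]
    refine le_trans (Finset.sum_le_sum fun σ hσ => ?_)
      (Finset.sum_le_sum_of_subset_of_nonneg (Finset.subset_univ G) fun σ _ _ => ?_)
    · by_cases h1 : NearOrthogonal ε σ <;> by_cases h2 : LI σ <;>
        by_cases h3 : PairwiseNonparallel σ <;> simp [h1, h2, h3, hw0]
      exact (hG σ hσ h3).le
    · have := hw0 σ
      split_ifs <;> linarith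
  have hnear : ∑ σ : ι → Spin n with NearOrthogonal ε σ, w σ
      ≤ (∏ s, (d s - c s)) * ((1 + δ) * Real.exp (k ^ 2 * η) * pairMGF ι (α ^ 2 / n) ^ n) := by
    have h1 : ∀ σ : ι → Spin n, NearOrthogonal ε σ → w σ
        ≤ (∏ s, (d s - c s)) * ((1 + δ) * Real.exp (k ^ 2 * η)) / 2 ^ (n * k)
          * Real.exp (α ^ 2 / n * ∑ i, pairSum fun s => σ s i) := by
      intro σ hσ
      have h2 := boxProb_le_exp hn σ (posDef_of_near_one (overlap_isHermitian σ) hσ hε1) hab hα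
        haα hbη
      have h3 : (√(overlap σ).det)⁻¹ ≤ 1 + δ := by
        linarith [(abs_le.mp (hdet (overlap σ) hσ)).2]
      simp_rw [hba] at h2
      refine h2.trans ?_
      rw [← hk, Real.exp_add, Real.exp_add, mul_assoc ((√(2 * Real.pi))⁻¹ ^ k), mul_right_comm,
        hnorm]
      calc _ ≤ (∏ s, (d s - c s)) * (Real.exp (k * α ^ 2 / 2) / 2 ^ (n * k)) * ((1 + δ)
            * (Real.exp (-(k * α ^ 2) / 2) * Real.exp (α ^ 2 / n * ∑ i, pairSum fun s => σ s i)
              * Real.exp (k ^ 2 * η))) := by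
            refine mul_le_mul_of_nonneg_left ?_ (by positivity)
            exact mul_le_mul_of_nonneg_right h3 (by positivity)
        _ = (∏ s, (d s - c s)) * ((1 + δ) * Real.exp (k ^ 2 * η)) / 2 ^ (n * k)
          * Real.exp (α ^ 2 / n * ∑ i, pairSum fun s => σ s i)
          * (Real.exp (k * α ^ 2 / 2) * Real.exp (-(k * α ^ 2) / 2)) := by ring
        _ = _ := by rw [← Real.exp_add]; ring_nf; simp
    have hδ : 0 ≤ 1 + δ := by
      have := hdet 1 (by simp [hε.le])
      linarith [abs_nonneg ((√(1 : Matrix ι ι ℝ).det)⁻¹ - 1)]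
    calc _ ≤ ∑ σ : ι → Spin n with NearOrthogonal ε σ,
          (∏ s, (d s - c s)) * ((1 + δ) * Real.exp (k ^ 2 * η)) / 2 ^ (n * k)
          * Real.exp (α ^ 2 / n * ∑ i, pairSum fun s => σ s i) :=
          Finset.sum_le_sum fun σ hσ => h1 σ (Finset.mem_filter.mp hσ).2
      -- Passing to all tuples makes the sum factor over sites.
      _ ≤ ∑ σ : ι → Spin n,
          (∏ s, (d s - c s)) * ((1 + δ) * Real.exp (k ^ 2 * η)) / 2 ^ (n * k)
          * Real.exp (α ^ 2 / n * ∑ i, pairSum fun s => σ s i) :=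
          Finset.sum_le_sum_of_subset_of_nonneg (Finset.filter_subset _ _)
            fun σ _ _ => by positivity
      _ = _ := by
          rw [← Finset.mul_sum, sum_tuple_exp_pairSum, ← hk]
          field_simp
  have hfar : ∑ σ : ι → Spin n with ¬ NearOrthogonal ε σ ∧ LI σ, w σ
      ≤ (∏ s, (d s - c s)) * (2 * (k : ℝ) ^ 2)
          * (√n ^ k * Real.exp (k * α ^ 2 / 2) * Real.exp (-(n * ε ^ 2 / 2))) := by
    have h1 : ∀ σ ∈ Finset.univ.filter (fun σ : ι → Spin n => ¬ NearOrthogonal ε σ ∧ LI σ),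
        w σ ≤ √n ^ k * ((∏ s, (d s - c s)) * (Real.exp (k * α ^ 2 / 2) / 2 ^ (n * k))) := by
      intro σ hσ
      have h2 := boxProb_le_of_linearIndependent hn σ (Finset.mem_filter.mp hσ).2.2 hab
      simp_rw [hba] at h2
      rwa [mul_right_comm, ← hk, hnorm, mul_comm] at h2
    refine (Finset.sum_le_card_nsmul _ _ _ h1).trans ?_
    rw [nsmul_eq_mul]
    have h3 : ((Finset.univ.filter
        (fun σ : ι → Spin n => ¬ NearOrthogonal ε σ ∧ LI σ)).card : ℝ)
        ≤ (k : ℝ) ^ 2 * (2 * (2 ^ (n * k) * Real.exp (-(n * ε ^ 2 / 2)))) := by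
      refine le_trans ?_ (card_not_nearOrthogonal_le hn hε.le)
      refine Nat.cast_le.mpr (Finset.card_le_card fun σ hσ => ?_)
      exact Finset.mem_filter.mpr ⟨Finset.mem_univ _, (Finset.mem_filter.mp hσ).2.1⟩
    refine (mul_le_mul_of_nonneg_right h3 (by positivity)).trans (le_of_eq ?_)
    field_simp
  have hdep : ∑ σ : ι → Spin n with PairwiseNonparallel σ ∧ ¬ LI σ, w σ
      ≤ ∑ J : Finset ι, extensionCount ι J * (∏ s ∈ J, (d s - c s))
          * (√n ^ J.card * Real.exp (J.card * α ^ 2 / 2) * (1 - (2 ^ J.card)⁻¹) ^ n) := by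
    refine (sum_dependent_le hn hab _ fun σ hσ => (Finset.mem_filter.mp hσ).2).trans
      (le_of_eq (Finset.sum_congr rfl fun J _ => ?_))
    simp_rw [hba]
    have h2 := gaussian_norm_mul_prod hn α J fun s => d s - c s
    rw [mul_right_comm ((√(2 * Real.pi))⁻¹ ^ J.card), h2]
    have h3 : (1 - ((2 : ℝ) ^ J.card)⁻¹) ^ n = (2 ^ J.card - 1) ^ n / 2 ^ (n * J.card) := by
      rw [mul_comm n, pow_mul, ← div_pow]
      congr 1
      field_simp
    rw [h3]
    ring
  linarith

/-- Near-orthogonal tuples alone suffice: all terms are nonnegative, and `ε < 1` forces the entries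
of such a tuple to be distinct, so that it belongs to `G`. -/
lemma le_sum_boxProb (hn : 0 < n) {α K ε δ : ℝ} (hα : 0 ≤ α) (c d : ι → ℝ) (hc : ∀ s, 0 ≤ c s)
    (hcd : ∀ s, c s ≤ d s) (hK0 : 0 ≤ K) (hK : ∀ s, d s ≤ K) (hε : 0 < ε) (hε2 : ε < 1)
    (hε1 : Fintype.card ι * ε ≤ 1 / 2) (hδ : δ ≤ 1)
    (hdet : ∀ Q : Matrix ι ι ℝ, (∀ s t, |Q s t - (1 : Matrix ι ι ℝ) s t| ≤ ε) →
      |(√Q.det)⁻¹ - 1| ≤ δ)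
    (G : Finset (ι → Spin n)) (hG : ∀ σ, Function.Injective σ → σ ∈ G)
    (hβ1 : α ^ 2 / n * (Fintype.card ι : ℝ) ^ 2 ≤ 1)
    (hsmall : (Fintype.card ι : ℝ) ^ 2 * (1 / n + 4 * (α ^ 2 / n) ^ 2 * (Fintype.card ι : ℝ) ^ 4)
      / ε ^ 2 ≤ 1 / 2) :
    (∏ s, (d s - c s)) * ((1 - δ)
        * Real.exp (-(3 * Fintype.card ι ^ 3
          * (2 * α * (K * scaling n α) + (K * scaling n α) ^ 2)))
        * (pairMGF ι (α ^ 2 / n) ^ n * ((1 - (Fintype.card ι : ℝ) ^ 2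
          * (1 / n + 4 * (α ^ 2 / n) ^ 2 * (Fintype.card ι : ℝ) ^ 4) / ε ^ 2)
        * Real.exp (-(2 * (Fintype.card ι * α ^ 2 * ((Fintype.card ι : ℝ) ^ 2
          * (1 / n + 4 * (α ^ 2 / n) ^ 2 * (Fintype.card ι : ℝ) ^ 4))))))))
      ≤ ∑ σ ∈ G, boxProb σ (fun s => α + c s * scaling n α)
        (fun s => α + d s * scaling n α) := by
  set ξ := scaling n α with hξ
  have hξ0 : 0 < ξ := scaling_pos n α
  set a : ι → ℝ := fun s => α + c s * ξ with ha
  set b : ι → ℝ := fun s => α + d s * ξ with hb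
  set η : ℝ := 2 * α * (K * ξ) + (K * ξ) ^ 2 with hη
  have hab : a ≤ b := fun s => by
    simp only [ha, hb]; have := mul_le_mul_of_nonneg_right (hcd s) hξ0.le; linarith
  have hba : ∀ s, b s - a s = (d s - c s) * ξ := fun s => by simp only [ha, hb]; ring
  have haα : ∀ s, α ≤ a s := fun s => by
    simp only [ha]; have := mul_nonneg (hc s) hξ0.le; linarith
  have hbη : ∀ s t, b s * b t ≤ α ^ 2 + η := by
    intro s t
    have h1 : ∀ s, b s ≤ α + K * ξ := fun s => by
      simp only [hb]; have := mul_le_mul_of_nonneg_right (hK s) hξ0.le; linarith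
    have h2 : ∀ s, 0 ≤ b s := fun s => hα.trans ((haα s).trans (hab s))
    calc b s * b t ≤ (α + K * ξ) * (α + K * ξ) :=
          mul_le_mul (h1 s) (h1 t) (h2 t) ((h2 s).trans (h1 s))
      _ = _ := by rw [hη]; ring
  have hη0 : 0 ≤ η := by positivity
  have hγ : 0 ≤ ∏ s, (d s - c s) := Finset.prod_nonneg fun s _ => sub_nonneg.mpr (hcd s)
  have hnorm := gaussian_norm_mul_prod hn α (Finset.univ : Finset ι) fun s => d s - c s
  rw [Finset.card_univ] at hnorm
  have htilt := le_sum_nearOrthogonal (ι := ι) hn (c := Fintype.card ι * α ^ 2)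
    (by positivity : 0 ≤ α ^ 2 / (n : ℝ)) hβ1 (by positivity) hε hsmall
  set k := Fintype.card ι with hk
  set R := (1 - (k : ℝ) ^ 2 * (1 / n + 4 * (α ^ 2 / n) ^ 2 * (k : ℝ) ^ 4) / ε ^ 2)
        * Real.exp (-(2 * (k * α ^ 2 * ((k : ℝ) ^ 2
          * (1 / n + 4 * (α ^ 2 / n) ^ 2 * (k : ℝ) ^ 4)))))
  have hsub : Finset.univ.filter (NearOrthogonal (ι := ι) (n := n) ε) ⊆ G := by
    intro σ hσ
    refine hG σ fun s t hst => ?_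
    by_contra hne
    have h := (Finset.mem_filter.mp hσ).2 s t
    rw [Matrix.one_apply_ne hne, overlap_apply, hst, ← overlap_apply, overlap_self hn] at h
    norm_num at h
    linarith
  have h1 : ∀ σ : ι → Spin n, NearOrthogonal ε σ →
      (∏ s, (d s - c s)) * ((1 - δ) * Real.exp (-(3 * k ^ 3 * η))) / 2 ^ (n * k)
          * Real.exp (α ^ 2 / n * (∑ i, pairSum fun s => σ s i)
            - k * α ^ 2 * ∑ s, ∑ t, (overlap σ s t - (1 : Matrix ι ι ℝ) s t) ^ 2)
        ≤ boxProb σ a b := by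
    intro σ hσ
    have h2 := le_boxProb_exp hn σ hσ hε1 hab hα haα hη0 hbη
    have h3 : 1 - δ ≤ (√(overlap σ).det)⁻¹ := by
      linarith [(abs_le.mp (hdet (overlap σ) hσ)).1]
    simp_rw [hba] at h2
    refine le_trans ?_ h2
    rw [← hk, mul_assoc ((√(2 * Real.pi))⁻¹ ^ k), mul_right_comm ((√(2 * Real.pi))⁻¹ ^ k),
      hnorm]
    set Y := ∑ s, ∑ t, (overlap σ s t - (1 : Matrix ι ι ℝ) s t) ^ 2
    set T := ∑ i, pairSum fun s => σ s i
    rw [show -(k * α ^ 2) / 2 + α ^ 2 / n * T - k * α ^ 2 * Y - 3 * k ^ 3 * η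
      = -(k * α ^ 2 / 2) + (α ^ 2 / n * T - k * α ^ 2 * Y) + -(3 * k ^ 3 * η) by ring,
      Real.exp_add, Real.exp_add]
    calc _ = (∏ s, (d s - c s)) * ((1 - δ) * Real.exp (-(3 * k ^ 3 * η))) / 2 ^ (n * k)
          * Real.exp (α ^ 2 / n * T - k * α ^ 2 * Y)
          * (Real.exp (k * α ^ 2 / 2) * Real.exp (-(k * α ^ 2 / 2))) := by
          rw [← Real.exp_add]; simp
      _ = (∏ s, (d s - c s)) * (Real.exp (k * α ^ 2 / 2) / 2 ^ (n * k)) * ((1 - δ)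
            * (Real.exp (-(k * α ^ 2 / 2)) * Real.exp (α ^ 2 / n * T - k * α ^ 2 * Y)
              * Real.exp (-(3 * k ^ 3 * η)))) := by ring
      _ ≤ _ := by
          refine mul_le_mul_of_nonneg_left ?_ (by positivity)
          exact mul_le_mul_of_nonneg_right h3 (by positivity)
  have hδ0 : 0 ≤ 1 - δ := by linarith
  calc _ = (∏ s, (d s - c s)) * ((1 - δ) * Real.exp (-(3 * k ^ 3 * η))) / 2 ^ (n * k)
        * (2 ^ (n * k) * pairMGF ι (α ^ 2 / n) ^ n * R) := by
        field_simp
    _ ≤ (∏ s, (d s - c s)) * ((1 - δ) * Real.exp (-(3 * k ^ 3 * η))) / 2 ^ (n * k) * _ :=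
        mul_le_mul_of_nonneg_left htilt (by positivity)
    _ = ∑ σ : ι → Spin n with NearOrthogonal ε σ, _ := Finset.mul_sum _ _ _
    _ ≤ ∑ σ : ι → Spin n with NearOrthogonal ε σ, boxProb σ a b :=
        Finset.sum_le_sum fun σ hσ => h1 σ (Finset.mem_filter.mp hσ).2
    _ ≤ _ := Finset.sum_le_sum_of_subset_of_nonneg hsub fun σ _ _ => boxProb_nonneg _ _ _

end FiniteBounds
-- Asymptotics of the sum over tuples
section Asymptotic

variable {α : ℕ → ℝ}

lemma tendsto_sq_div_nat (hα : α =o[atTop] fun n : ℕ => √(n : ℝ)) :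
    Tendsto (fun n : ℕ => α n ^ 2 / n) atTop (𝓝 0) := by
  have h := (hα.tendsto_div_nhds_zero).pow 2
  refine Tendsto.congr (fun n => ?_) (by simpa using h)
  rw [div_pow, Real.sq_sqrt (Nat.cast_nonneg n)]

/-- Since α² = o(n), eventually rα² ≤ cn, so the Gaussian factor uses up only half of the
exponential decay. -/
lemma tendsto_sqrt_pow_mul_exp (hα : α =o[atTop] fun n : ℕ => √(n : ℝ)) (r : ℕ) {c : ℝ}
    (hc : 0 < c) :
    Tendsto (fun n : ℕ => √(n : ℝ) ^ r * Real.exp (r * α n ^ 2 / 2) * Real.exp (-(c * n)))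
      atTop (𝓝 0) := by
  have hlim : Tendsto (fun n : ℕ => (n : ℝ) ^ r * Real.exp (-(c / 2)) ^ n) atTop (𝓝 0) :=
    tendsto_pow_const_mul_const_pow_of_abs_lt_one r (by
      rw [abs_of_pos (Real.exp_pos _)]; exact Real.exp_lt_one_iff.mpr (by linarith))
  have hsmall : ∀ᶠ n : ℕ in atTop, r * (α n ^ 2 / n) < c := by
    have := (tendsto_sq_div_nat hα).const_mul (r : ℝ)
    rw [mul_zero] at this
    exact this.eventually_lt_const hc
  refine squeeze_zero' (Eventually.of_forall fun n => by positivity) ?_ hlim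
  filter_upwards [hsmall, eventually_gt_atTop 0] with n hn hn0
  have hn' : (1 : ℝ) ≤ n := by exact_mod_cast hn0
  have h1 : √(n : ℝ) ^ r ≤ (n : ℝ) ^ r :=
    pow_le_pow_left₀ (Real.sqrt_nonneg _) (Real.sqrt_le_iff.mpr ⟨by linarith, by nlinarith⟩) r
  rw [mul_assoc, ← Real.exp_add, ← Real.exp_nat_mul]
  refine mul_le_mul h1 (Real.exp_le_exp.mpr ?_) (Real.exp_pos _).le (by positivity)
  have h2 : r * α n ^ 2 ≤ c * n := by
    rw [mul_div_assoc'] at hn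
    exact ((div_lt_iff₀ (by linarith)).mp hn).le
  linarith

/-- Both sequences are eventually dominated by √n ξ, which tends to 0 by the preceding decay with r
= 1 and c = log 2. -/
lemma tendsto_scaling (hα : α =o[atTop] fun n : ℕ => √(n : ℝ)) :
    Tendsto (fun n => scaling n (α n)) atTop (𝓝 0) ∧
    Tendsto (fun n => α n * scaling n (α n)) atTop (𝓝 0) := by
  have hlim := (tendsto_sqrt_pow_mul_exp hα 1 (Real.log_pos one_lt_two)).const_mul
    (√(2 * Real.pi))
  rw [mul_zero] at hlim
  have hb : ∀ᶠ n : ℕ in atTop, ‖α n‖ ≤ 1 * ‖√(n : ℝ)‖ := hα.bound one_pos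
  have heq : ∀ n : ℕ, 0 < n → √(n : ℝ) * scaling n (α n) = √(2 * Real.pi)
      * (√(n : ℝ) ^ 1 * Real.exp ((1 : ℕ) * α n ^ 2 / 2) * Real.exp (-(Real.log 2 * n))) := by
    intro n hn
    rw [scaling_eq hn, Real.exp_neg, Real.exp_mul, Real.exp_log two_pos, Real.rpow_natCast,
      Nat.cast_one, one_mul, pow_one]
    ring
  constructor
  · refine squeeze_zero' (Eventually.of_forall fun n => (scaling_pos _ _).le) ?_ hlim
    filter_upwards [eventually_gt_atTop 0] with n hn
    rw [← heq n hn]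
    refine le_mul_of_one_le_left (scaling_pos _ _).le ?_
    rw [Real.one_le_sqrt]
    exact_mod_cast hn
  · refine squeeze_zero_norm' ?_ hlim
    filter_upwards [eventually_gt_atTop 0, hb] with n hn hn2
    rw [← heq n hn, norm_mul, Real.norm_of_nonneg (scaling_pos _ _).le]
    refine mul_le_mul_of_nonneg_right ?_ (scaling_pos _ _).le
    rwa [one_mul, Real.norm_of_nonneg (Real.sqrt_nonneg _)] at hn2

lemma tendsto_window_error (hα : α =o[atTop] fun n : ℕ => √(n : ℝ)) (K : ℝ) :
    Tendsto (fun n => 2 * α n * (K * scaling n (α n)) + (K * scaling n (α n)) ^ 2)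
      atTop (𝓝 0) := by
  obtain ⟨h1, h2⟩ := tendsto_scaling hα
  have h3 := (h2.const_mul (2 * K)).add ((h1.const_mul K).pow 2)
  refine Tendsto.congr (fun n => ?_) (by simpa using h3)
  ring

/-- Two-sided asymptotics of the mixed factorial moments, as sums over tuples. -/
lemma exists_sum_boxProb_bounds (hα0 : ∀ n, 0 ≤ α n)
    (hα : α =o[atTop] fun n : ℕ => √(n : ℝ)) {ι : Type*} [Fintype ι] [DecidableEq ι]
    (c d : ι → ℝ) (hc : ∀ s, 0 ≤ c s) (hcd : ∀ s, c s < d s)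
    (G : ∀ n, Finset (ι → Spin n)) (hG : ∀ n σ, Function.Injective σ → σ ∈ G n)
    (hG0 : ∀ n, 0 < n → ∀ σ ∈ G n, ¬ PairwiseNonparallel σ →
      boxProb σ (fun s => α n + c s * scaling n (α n))
        (fun s => α n + d s * scaling n (α n)) = 0) :
    ∃ C : ℝ, 0 ≤ C ∧ ∀ δ : ℝ, 0 < δ → ∀ᶠ n : ℕ in atTop,
      ∑ σ ∈ G n, boxProb σ (fun s => α n + c s * scaling n (α n))
          (fun s => α n + d s * scaling n (α n)) ∈ Set.Icc
        ((∏ s, (d s - c s)) * (1 - δ)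
          * Real.exp (Fintype.card ι * (Fintype.card ι - 1) / (4 * n) * α n ^ 4
            - C * (α n ^ 6 / (n : ℝ) ^ 2)))
        ((∏ s, (d s - c s)) * (1 + δ)
          * Real.exp (Fintype.card ι * (Fintype.card ι - 1) / (4 * n) * α n ^ 4
            + C * (α n ^ 6 / (n : ℝ) ^ 2))) := by
  obtain ⟨C₁, hC₁, β₀, hβ₀, hZ⟩ := exists_pairMGF_bounds ι
  set k := Fintype.card ι with hk
  set γ := ∏ s, (d s - c s) with hγ
  have hγ0 : 0 < γ := Finset.prod_pos fun s _ => sub_pos.mpr (hcd s)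
  have hκ : 0 ≤ (k : ℝ) * (k - 1) := by
    rcases Nat.eq_zero_or_pos k with h | h
    · simp [h]
    · have : (1 : ℝ) ≤ k := by exact_mod_cast h
      exact mul_nonneg (by linarith) (by linarith)
  obtain ⟨K, hK0, hK⟩ : ∃ K, 0 ≤ K ∧ ∀ s, d s ≤ K :=
    ⟨∑ s, d s, Finset.sum_nonneg fun s _ => (hc s).trans (hcd s).le, fun s =>
      Finset.single_le_sum (f := d) (fun s _ => (hc s).trans (hcd s).le) (Finset.mem_univ s)⟩
  have hβ := tendsto_sq_div_nat hα
  have hη := tendsto_window_error hα K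
  set η : ℕ → ℝ := fun n => 2 * α n * (K * scaling n (α n)) + (K * scaling n (α n)) ^ 2 with hηd
  have hinv : Tendsto (fun n : ℕ => 1 / (n : ℝ)) atTop (𝓝 0) := tendsto_one_div_atTop_nhds_zero_nat
  -- `C₁` comes from the cumulant expansion. The Jensen loss 2kα²·k²(1/n + 4β²k⁴) splits into 2k³β,
  -- which vanishes, and 8k⁷α⁶/n². The constant must not depend on δ.
  refine ⟨C₁ + 8 * k ^ 7, by positivity, fun δ hδ => ?_⟩
  -- The gap between δ₁ and δ absorbs all vanishing errors.
  set δ₁ : ℝ := min (δ / 2) (1 / 2) with hδ₁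
  have hδ₁0 : 0 < δ₁ := by positivity
  have hδ₁δ : δ₁ < δ := (min_le_left _ _).trans_lt (half_lt_self hδ)
  have hδ₁1 : δ₁ ≤ 1 := (min_le_right _ _).trans (by norm_num)
  obtain ⟨ε₀, hε₀, hdet₀⟩ := exists_abs_det_sub_one_le ι hδ₁0
  set ε : ℝ := min ε₀ (1 / (2 * (k + 1))) with hεd
  have hε : 0 < ε := by positivity
  have hε' : ε ≤ 1 / (2 * (k + 1)) := min_le_right _ _
  have hε1 : k * ε ≤ 1 / 2 := by
    rw [le_div_iff₀ (by positivity)] at hε'; nlinarith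
  have hε2 : ε < 1 := by
    rw [le_div_iff₀ (by positivity)] at hε'
    have : (0 : ℝ) ≤ k * ε := by positivity
    nlinarith
  have hdet : ∀ Q : Matrix ι ι ℝ, (∀ s t, |Q s t - (1 : Matrix ι ι ℝ) s t| ≤ ε) →
      |(√Q.det)⁻¹ - 1| ≤ δ₁ := fun Q hQ =>
    hdet₀ Q fun s t => (hQ s t).trans (min_le_left _ _)
  have hπ : Tendsto (fun n : ℕ => (k : ℝ) ^ 2
      * (1 / n + 4 * (α n ^ 2 / n) ^ 2 * (k : ℝ) ^ 4) / ε ^ 2) atTop (𝓝 0) := by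
    have := (((hinv.add (((hβ.pow 2).const_mul 4).mul_const ((k : ℝ) ^ 4))).const_mul
      ((k : ℝ) ^ 2)).div_const (ε ^ 2))
    simpa using this
  have hlowlim : Tendsto (fun n : ℕ => (1 - δ₁) * Real.exp (-(3 * k ^ 3 * η n))
      * ((1 - (k : ℝ) ^ 2 * (1 / n + 4 * (α n ^ 2 / n) ^ 2 * (k : ℝ) ^ 4) / ε ^ 2)
        * Real.exp (-(2 * k ^ 3 * (α n ^ 2 / n))))) atTop (𝓝 (1 - δ₁)) := by
    have h1 := (Real.continuous_exp.tendsto _).comp (hη.const_mul (3 * (k : ℝ) ^ 3)).neg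
    have h2 := (Real.continuous_exp.tendsto _).comp (hβ.const_mul (2 * (k : ℝ) ^ 3)).neg
    have h3 := (h1.const_mul (1 - δ₁)).mul ((hπ.const_sub 1).mul h2)
    simpa using h3
  have hrem : Tendsto (fun n : ℕ => γ * (2 * (k : ℝ) ^ 2)
          * (√n ^ k * Real.exp (k * α n ^ 2 / 2) * Real.exp (-(n * ε ^ 2 / 2)))
        + ∑ J : Finset ι, extensionCount ι J * (∏ s ∈ J, (d s - c s))
          * (√n ^ J.card * Real.exp (J.card * α n ^ 2 / 2) * (1 - (2 ^ J.card)⁻¹) ^ n))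
      atTop (𝓝 0) := by
    have h1 : Tendsto (fun n : ℕ => √(n : ℝ) ^ k * Real.exp (k * α n ^ 2 / 2)
        * Real.exp (-(n * ε ^ 2 / 2))) atTop (𝓝 0) := by
      refine (tendsto_sqrt_pow_mul_exp hα k (by positivity : 0 < ε ^ 2 / 2)).congr fun n => ?_
      ring_nf
    have h2 : ∀ J : Finset ι, Tendsto (fun n : ℕ => √(n : ℝ) ^ J.card
        * Real.exp (J.card * α n ^ 2 / 2) * (1 - ((2 : ℝ) ^ J.card)⁻¹) ^ n) atTop (𝓝 0) := by
      intro J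
      have h3 : ((2 : ℝ) ^ J.card)⁻¹ ≤ 1 := inv_le_one_of_one_le₀ (one_le_pow₀ one_le_two)
      refine squeeze_zero (fun n => ?_) (fun n => ?_)
        (tendsto_sqrt_pow_mul_exp hα J.card (by positivity : 0 < ((2 : ℝ) ^ J.card)⁻¹))
      · have := sub_nonneg.mpr h3
        positivity
      · refine mul_le_mul_of_nonneg_left ?_ (by positivity)
        calc _ ≤ Real.exp (-((2 : ℝ) ^ J.card)⁻¹) ^ n :=
              pow_le_pow_left₀ (sub_nonneg.mpr h3) (Real.one_sub_le_exp_neg _) n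
          _ = _ := by rw [← Real.exp_nat_mul]; ring_nf
    have h4 := (h1.const_mul (γ * (2 * (k : ℝ) ^ 2))).add
      (tendsto_finsetSum Finset.univ fun J _ =>
        (h2 J).const_mul (extensionCount ι J * (∏ s ∈ J, (d s - c s))))
    simpa using h4
  set r : ℕ → ℝ := fun n => γ * (2 * (k : ℝ) ^ 2)
          * (√n ^ k * Real.exp (k * α n ^ 2 / 2) * Real.exp (-(n * ε ^ 2 / 2)))
        + ∑ J : Finset ι, extensionCount ι J * (∏ s ∈ J, (d s - c s))
          * (√n ^ J.card * Real.exp (J.card * α n ^ 2 / 2) * (1 - (2 ^ J.card)⁻¹) ^ n) with hr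
  have huplim : Tendsto (fun n : ℕ => (1 + δ₁) * Real.exp (k ^ 2 * η n) + r n / γ)
      atTop (𝓝 (1 + δ₁)) := by
    have h1 := (Real.continuous_exp.tendsto _).comp (hη.const_mul ((k : ℝ) ^ 2))
    have h3 := (h1.const_mul (1 + δ₁)).add (hrem.div_const γ)
    simpa using h3
  filter_upwards [eventually_gt_atTop 0, hβ.eventually_le_const hβ₀,
    hπ.eventually_le_const (by norm_num : (0 : ℝ) < 1 / 2),
    (by simpa using (hβ.mul_const ((k : ℝ) ^ 2)) :
      Tendsto (fun n : ℕ => α n ^ 2 / n * (k : ℝ) ^ 2) atTop (𝓝 0)).eventually_le_const one_pos,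
    hlowlim.eventually_const_le (by linarith : 1 - δ < 1 - δ₁),
    huplim.eventually_le_const (by linarith : 1 + δ₁ < 1 + δ)]
    with n hn hβn hπn hβk hlow hup
  have hn' : (0 : ℝ) < n := by exact_mod_cast hn
  obtain ⟨hZl, hZu⟩ := hZ (α n ^ 2 / n) (by positivity) hβn
  have hM1 := one_le_pairMGF (ι := ι) (α n ^ 2 / n)
  have hpow : ∀ x : ℝ, Real.exp (k * (k - 1) / 4 * (α n ^ 2 / n) ^ 2 + x * (α n ^ 2 / n) ^ 3) ^ n
      = Real.exp (k * (k - 1) / (4 * n) * α n ^ 4 + x * (α n ^ 6 / (n : ℝ) ^ 2)) := by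
    intro x
    rw [← Real.exp_nat_mul]
    congr 1
    field_simp
  have hw : 0 ≤ α n ^ 6 / (n : ℝ) ^ 2 := by positivity
  constructor
  · have h1 := le_sum_boxProb hn (hα0 n) c d hc (fun s => (hcd s).le) hK0 hK hε hε2 hε1 hδ₁1 hdet
      (G n) (hG n) hβk hπn
    refine le_trans ?_ h1
    rw [← hk, ← hγ]
    change _ ≤ γ * ((1 - δ₁) * Real.exp (-(3 * k ^ 3 * η n)) * (pairMGF ι (α n ^ 2 / n) ^ n
      * ((1 - (k : ℝ) ^ 2 * (1 / n + 4 * (α n ^ 2 / n) ^ 2 * (k : ℝ) ^ 4) / ε ^ 2)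
        * Real.exp (-(2 * (k * α n ^ 2 * ((k : ℝ) ^ 2
          * (1 / n + 4 * (α n ^ 2 / n) ^ 2 * (k : ℝ) ^ 4))))))))
    have h2 : Real.exp (k * (k - 1) / (4 * n) * α n ^ 4 + -C₁ * (α n ^ 6 / (n : ℝ) ^ 2))
        ≤ pairMGF ι (α n ^ 2 / n) ^ n := by
      rw [← hpow]
      refine pow_le_pow_left₀ (Real.exp_pos _).le ?_ n
      rwa [neg_mul, ← sub_eq_add_neg]
    have h3 : Real.exp (-(2 * (k * α n ^ 2 * ((k : ℝ) ^ 2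
          * (1 / n + 4 * (α n ^ 2 / n) ^ 2 * (k : ℝ) ^ 4)))))
        = Real.exp (-(2 * k ^ 3 * (α n ^ 2 / n))) * Real.exp (-(8 * k ^ 7)
          * (α n ^ 6 / (n : ℝ) ^ 2)) := by
      rw [← Real.exp_add]
      congr 1
      field_simp
      ring
    rw [h3]
    set π := (k : ℝ) ^ 2 * (1 / n + 4 * (α n ^ 2 / n) ^ 2 * (k : ℝ) ^ 4) / ε ^ 2
    have h4 : 0 ≤ (1 - δ₁) * Real.exp (-(3 * k ^ 3 * η n)) * ((1 - π)
        * Real.exp (-(2 * k ^ 3 * (α n ^ 2 / n)))) :=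
      mul_nonneg (mul_nonneg (by linarith) (Real.exp_pos _).le)
        (mul_nonneg (by linarith) (Real.exp_pos _).le)
    rw [mul_assoc γ]
    refine mul_le_mul_of_nonneg_left ?_ hγ0.le
    calc (1 - δ) * Real.exp (k * (k - 1) / (4 * n) * α n ^ 4
            - (C₁ + 8 * k ^ 7) * (α n ^ 6 / (n : ℝ) ^ 2))
        ≤ ((1 - δ₁) * Real.exp (-(3 * k ^ 3 * η n)) * ((1 - π)
        * Real.exp (-(2 * k ^ 3 * (α n ^ 2 / n))))) * Real.exp (k * (k - 1) / (4 * n) * α n ^ 4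
            - (C₁ + 8 * k ^ 7) * (α n ^ 6 / (n : ℝ) ^ 2)) :=
          mul_le_mul_of_nonneg_right hlow (Real.exp_pos _).le
      _ = ((1 - δ₁) * Real.exp (-(3 * k ^ 3 * η n)) * ((1 - π)
        * Real.exp (-(2 * k ^ 3 * (α n ^ 2 / n))))) * (Real.exp (-(8 * k ^ 7)
          * (α n ^ 6 / (n : ℝ) ^ 2)) * Real.exp (k * (k - 1) / (4 * n) * α n ^ 4
            + -C₁ * (α n ^ 6 / (n : ℝ) ^ 2))) := by
          rw [← Real.exp_add]
          congr 2
          ring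
      _ ≤ ((1 - δ₁) * Real.exp (-(3 * k ^ 3 * η n)) * ((1 - π)
        * Real.exp (-(2 * k ^ 3 * (α n ^ 2 / n))))) * (Real.exp (-(8 * k ^ 7)
          * (α n ^ 6 / (n : ℝ) ^ 2)) * pairMGF ι (α n ^ 2 / n) ^ n) :=
          mul_le_mul_of_nonneg_left (mul_le_mul_of_nonneg_left h2 (Real.exp_pos _).le) h4
      _ = _ := by ring
  · have h1 := sum_boxProb_le hn (hα0 n) c d hc (fun s => (hcd s).le) hK hε hε1 hdet (G n)
      (hG0 n hn)
    refine h1.trans ?_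
    rw [← hk, ← hγ, add_assoc]
    change γ * ((1 + δ₁) * Real.exp (k ^ 2 * η n) * pairMGF ι (α n ^ 2 / n) ^ n) + r n ≤ _
    set E := Real.exp (k * (k - 1) / (4 * n) * α n ^ 4
      + (C₁ + 8 * k ^ 7) * (α n ^ 6 / (n : ℝ) ^ 2)) with hE
    have hE1 : 1 ≤ E := Real.one_le_exp (by positivity)
    have h2 : pairMGF ι (α n ^ 2 / n) ^ n ≤ E := by
      calc _ ≤ _ := pow_le_pow_left₀ (by linarith) hZu n
        _ = _ := hpow C₁
        _ ≤ E := Real.exp_le_exp.mpr (by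
          have : 0 ≤ 8 * (k : ℝ) ^ 7 * (α n ^ 6 / (n : ℝ) ^ 2) := by positivity
          linarith)
    have hr0 : 0 ≤ r n := by
      refine add_nonneg (by positivity) (Finset.sum_nonneg fun J _ => ?_)
      have h3 : ((2 : ℝ) ^ J.card)⁻¹ ≤ 1 := inv_le_one_of_one_le₀ (one_le_pow₀ one_le_two)
      have h4 := sub_nonneg.mpr h3
      have h5 : 0 ≤ ∏ s ∈ J, (d s - c s) :=
        Finset.prod_nonneg fun s _ => (sub_pos.mpr (hcd s)).le
      positivity
    -- As `E ≥ 1`, the additive remainder becomes a multiplicative one.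
    calc _ ≤ γ * ((1 + δ₁) * Real.exp (k ^ 2 * η n) * E) + r n * E := by
          refine add_le_add (mul_le_mul_of_nonneg_left (mul_le_mul_of_nonneg_left h2
            (by positivity)) hγ0.le) (le_mul_of_one_le_right hr0 hE1)
      _ = γ * ((1 + δ₁) * Real.exp (k ^ 2 * η n) + r n / γ) * E := by field_simp
      _ ≤ γ * (1 + δ) * E := mul_le_mul_of_nonneg_right
          (mul_le_mul_of_nonneg_left hup hγ0.le) (by positivity)

end Asymptotic
-- First moment and factorial moments as integrals
section FirstMoment

variable {n : ℕ}

/-- For a single configuration the covariance is 1 and there are no pairs, so the window error is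
the only error. -/
lemma boxProb_unique_mem_Icc {ι : Type*} [Fintype ι] [DecidableEq ι] [Unique ι] (hn : 0 < n)
    (σ : ι → Spin n) {α c d : ℝ} (hα : 0 ≤ α) (hc : 0 ≤ c) (hcd : c ≤ d) :
    boxProb σ (fun _ => α + c * scaling n α) (fun _ => α + d * scaling n α)
      ∈ Set.Icc
        ((d - c) * Real.exp (-(3 * (2 * α * (d * scaling n α) + (d * scaling n α) ^ 2))) / 2 ^ n)
        ((d - c) * Real.exp (2 * α * (d * scaling n α) + (d * scaling n α) ^ 2) / 2 ^ n) := by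
  have hξ0 : 0 < scaling n α := scaling_pos n α
  have hnorm := gaussian_norm_mul_prod hn α (Finset.univ : Finset ι) fun _ => d - c
  set ξ := scaling n α
  set η : ℝ := 2 * α * (d * ξ) + (d * ξ) ^ 2 with hη
  have hd : 0 ≤ d := hc.trans hcd
  have hη0 : 0 ≤ η := by positivity
  have hov : overlap σ = 1 := by
    ext s t
    rw [Subsingleton.elim s t, overlap_self hn, Matrix.one_apply_eq]
  have hcard : Fintype.card ι = 1 := Fintype.card_unique
  have hpair : ∀ y : ι → ℤˣ, pairSum y = 0 := fun y => by
    simp [pairSum, sq, unit_sq]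
  have hab : (fun _ : ι => α + c * ξ) ≤ fun _ => α + d * ξ := fun _ => by
    have := mul_le_mul_of_nonneg_right hcd hξ0.le; dsimp only; linarith
  have haα : ∀ _ : ι, α ≤ α + c * ξ := fun _ => by
    have := mul_nonneg hc hξ0.le; linarith
  have hbη : ∀ _ _ : ι, (α + d * ξ) * (α + d * ξ) ≤ α ^ 2 + η := fun _ _ => by
    rw [hη]; nlinarith
  have hba : α + d * ξ - (α + c * ξ) = (d - c) * ξ := by ring
  have hsub : ∀ s t, |overlap σ s t - (1 : Matrix ι ι ℝ) s t| ≤ 0 := by simp [hov]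
  have hup := boxProb_le_exp hn σ (by rw [hov]; exact Matrix.PosDef.one) hab hα haα hbη
  have hlow := le_boxProb_exp hn σ hsub (by simp) hab hα haα hη0 hbη
  simp only [hba, hov, hpair, hcard, Matrix.det_one, Real.sqrt_one, inv_one, mul_one, sub_self,
    ne_eq, OfNat.ofNat_ne_zero, not_false_eq_true, zero_pow,
    Finset.sum_const_zero, mul_zero, Nat.cast_one, one_mul, one_pow, pow_one, add_zero, sub_zero,
    Finset.card_univ, Finset.prod_const] at hup hlow hnorm
  rw [mul_right_comm, hnorm] at hup hlow
  constructor
  · refine le_trans (le_of_eq ?_) hlow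
    rw [sub_eq_add_neg _ (3 * η), Real.exp_add, neg_div, Real.exp_neg (α ^ 2 / 2)]
    field_simp
  · refine hup.trans (le_of_eq ?_)
    rw [Real.exp_add, neg_div, Real.exp_neg (α ^ 2 / 2)]
    field_simp

variable {Ω : ℕ → Type*} [∀ n, MeasurableSpace (Ω n)] {P : ∀ n, Measure (Ω n)}
  {X : ∀ n, Fin n → Ω n → ℝ} {α : ℕ → ℝ}

/-- All `2 ^ n` configurations contribute the same asymptotic probability. A general left end `c` is
needed to compare with products of expectations. -/
lemma tendsto_integral_numPoints (hind : ∀ n, iIndepFun (X n) (P n))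
    (hlaw : ∀ n i, HasLaw (X n i) (gaussianReal 0 1) (P n)) (hα0 : ∀ n, 0 ≤ α n)
    (hα : α =o[atTop] fun n : ℕ => √(n : ℝ)) {c d : ℝ} (hc : 0 ≤ c) (hcd : c ≤ d) :
    Tendsto (fun n : ℕ => ∫ ω, (numPoints (fun i => X n i ω)
      (α n + c * scaling n (α n)) (α n + d * scaling n (α n)) : ℝ) ∂(P n)) atTop (𝓝 (d - c)) := by
  have hη := tendsto_window_error hα d
  have hlow : Tendsto (fun n => (d - c) * Real.exp (-(3 * (2 * α n * (d * scaling n (α n))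
      + (d * scaling n (α n)) ^ 2)))) atTop (𝓝 (d - c)) := by
    have := ((Real.continuous_exp.tendsto _).comp (hη.const_mul 3).neg).const_mul (d - c)
    simpa using this
  have hup : Tendsto (fun n => (d - c) * Real.exp (2 * α n * (d * scaling n (α n))
      + (d * scaling n (α n)) ^ 2)) atTop (𝓝 (d - c)) := by
    have := ((Real.continuous_exp.tendsto _).comp hη).const_mul (d - c)
    simpa using this
  have hmem : ∀ᶠ n : ℕ in atTop, ∫ ω, (numPoints (fun i => X n i ω)
      (α n + c * scaling n (α n)) (α n + d * scaling n (α n)) : ℝ) ∂(P n) ∈ Set.Icc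
      ((d - c) * Real.exp (-(3 * (2 * α n * (d * scaling n (α n))
      + (d * scaling n (α n)) ^ 2))))
      ((d - c) * Real.exp (2 * α n * (d * scaling n (α n)) + (d * scaling n (α n)) ^ 2)) := by
    filter_upwards [eventually_gt_atTop 0] with n hn
    have h := integral_prod_descFactorial (k := fun _ : Fin 1 => 1) hn (hind n) (hlaw n)
      (fun _ => α n + c * scaling n (α n)) (fun _ => α n + d * scaling n (α n))
      (fun _ => add_nonneg (hα0 n) (mul_nonneg hc (scaling_pos _ _).le))
    simp only [Finset.univ_unique, Finset.prod_singleton, Nat.descFactorial_one] at h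
    rw [h]
    have hall : blockInjective n (fun _ : Fin 1 => 1) = Finset.univ :=
      Finset.filter_true_of_mem fun σ _ l => Function.injective_of_subsingleton _
    have hcard : ((Finset.univ : Finset ((Σ _ : Fin 1, Fin 1) → Spin n)).card : ℝ) = 2 ^ n := by
      rw [Finset.card_univ, Fintype.card_fun, Fintype.card_fun]
      simp
    rw [hall]
    let _ : Unique (Σ _ : Fin 1, Fin 1) :=
      ⟨⟨⟨0, 0⟩⟩, fun ⟨i, j⟩ => by fin_cases i; fin_cases j; rfl⟩
    constructor
    · have h1 := Finset.card_nsmul_le_sum (Finset.univ : Finset ((Σ _ : Fin 1, Fin 1) → Spin n)) _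
        _ fun σ _ => (boxProb_unique_mem_Icc hn σ (hα0 n) hc hcd).1
      rw [nsmul_eq_mul, hcard, mul_div_cancel₀ _ (by positivity)] at h1
      exact h1
    · have h1 := Finset.sum_le_card_nsmul (Finset.univ : Finset ((Σ _ : Fin 1, Fin 1) → Spin n)) _
        _ fun σ _ => (boxProb_unique_mem_Icc hn σ (hα0 n) hc hcd).2
      rw [nsmul_eq_mul, hcard, mul_div_cancel₀ _ (by positivity)] at h1
      exact h1
  exact tendsto_of_tendsto_of_tendsto_of_le_of_le' hlow hup (hmem.mono fun _ h => h.1)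
    (hmem.mono fun _ h => h.2)

lemma exists_integral_prod_descFactorial_bounds (hind : ∀ n, iIndepFun (X n) (P n))
    (hlaw : ∀ n i, HasLaw (X n i) (gaussianReal 0 1) (P n)) (hα0 : ∀ n, 0 ≤ α n)
    (hα : α =o[atTop] fun n : ℕ => √(n : ℝ)) {m : ℕ} (c d : Fin m → ℝ) (k : Fin m → ℕ)
    (hc : ∀ l, 0 ≤ c l) (hcd : ∀ l, c l < d l)
    (hdisj : Pairwise fun l l' => Disjoint (Set.Ioo (c l) (d l)) (Set.Ioo (c l') (d l'))) :
    ∃ C : ℝ, 0 ≤ C ∧ ∀ δ : ℝ, 0 < δ → ∀ᶠ n : ℕ in atTop,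
      ∫ ω, ∏ l, ((numPoints (fun i => X n i ω) (α n + c l * scaling n (α n))
        (α n + d l * scaling n (α n))).descFactorial (k l) : ℝ) ∂(P n) ∈ Set.Icc
        ((∏ l, (d l - c l) ^ k l) * (1 - δ)
          * Real.exp (((∑ l, k l : ℕ) : ℝ) * (((∑ l, k l : ℕ) : ℝ) - 1) / (4 * n) * α n ^ 4
            - C * (α n ^ 6 / (n : ℝ) ^ 2)))
        ((∏ l, (d l - c l) ^ k l) * (1 + δ)
          * Real.exp (((∑ l, k l : ℕ) : ℝ) * (((∑ l, k l : ℕ) : ℝ) - 1) / (4 * n) * α n ^ 4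
            + C * (α n ^ 6 / (n : ℝ) ^ 2))) := by
  have ha : ∀ n l, 0 ≤ α n + c l * scaling n (α n) := fun n l =>
    add_nonneg (hα0 n) (mul_nonneg (hc l) (scaling_pos _ _).le)
  have hdisj' : ∀ n, Pairwise fun l l' =>
      Disjoint (Set.Ioo (α n + c l * scaling n (α n)) (α n + d l * scaling n (α n)))
        (Set.Ioo (α n + c l' * scaling n (α n)) (α n + d l' * scaling n (α n))) := by
    intro n l l' hl
    have hξ := scaling_pos n (α n)
    refine Set.disjoint_left.mpr fun y hy hy' => ?_
    have key : ∀ l, y ∈ Set.Ioo (α n + c l * scaling n (α n)) (α n + d l * scaling n (α n)) →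
        (y - α n) / scaling n (α n) ∈ Set.Ioo (c l) (d l) := fun l h =>
      ⟨by rw [lt_div_iff₀ hξ]; linarith [h.1], by rw [div_lt_iff₀ hξ]; linarith [h.2]⟩
    exact Set.disjoint_left.mp (hdisj hl) (key l hy) (key l' hy')
  obtain ⟨C, hC, h⟩ := exists_sum_boxProb_bounds hα0 hα (ι := Σ l, Fin (k l))
    (fun s => c s.1) (fun s => d s.1) (fun s => hc s.1) (fun s => hcd s.1)
    (fun n => blockInjective n k)
    (fun n σ hσ => Finset.mem_filter.mpr ⟨Finset.mem_univ _, fun l i j hij => by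
      simpa using hσ hij⟩)
    (fun n hn σ hσ hpar => boxProb_eq_zero_of_parallel hn (ha n) (hdisj' n) σ hσ hpar)
  have hcard : Fintype.card (Σ l, Fin (k l)) = ∑ l, k l := by simp
  have hprod : ∏ s : Σ l, Fin (k l), (d s.1 - c s.1) = ∏ l, (d l - c l) ^ k l := by
    rw [Fintype.prod_sigma]
    simp
  rw [hcard, hprod] at h
  refine ⟨C, hC, fun δ hδ => ?_⟩
  filter_upwards [h δ hδ, eventually_gt_atTop 0] with n hn hn0
  rw [integral_prod_descFactorial hn0 (hind n) (hlaw n) _ _ (ha n)]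
  exact hn

end FirstMoment

/-! ### From two-sided bounds to the error terms -/

section Deduction

/-- Splitting an error into a part dominated by `w` and a part tending to zero. -/
lemma exists_add_of_abs_le {R w : ℕ → ℝ} {C : ℝ} (hC : 0 ≤ C) (hw : ∀ n, 0 ≤ w n)
    (h : ∀ t : ℝ, 0 < t → ∀ᶠ n in atTop, |R n| ≤ C * w n + t) :
    ∃ u v : ℕ → ℝ, (u =O[atTop] w) ∧ Tendsto v atTop (𝓝 0) ∧ ∀ n, R n = u n + v n := by
  -- `u` is `R` clipped to [-Cw, Cw] and `v` is the excess, eventually below every t > 0.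
  refine ⟨fun n => max (-(C * w n)) (min (C * w n) (R n)),
    fun n => R n - max (-(C * w n)) (min (C * w n) (R n)), ?_, ?_, fun n => by ring⟩
  · refine IsBigO.of_bound C (Eventually.of_forall fun n => ?_)
    have h0 := mul_nonneg hC (hw n)
    rw [Real.norm_eq_abs, Real.norm_of_nonneg (hw n), abs_le]
    exact ⟨le_max_left _ _, max_le (by linarith) (min_le_left _ _)⟩
  · rw [Metric.tendsto_atTop']
    intro t ht
    obtain ⟨N, hN⟩ := eventually_atTop.mp (h (t / 2) (by linarith))
    refine ⟨N, fun n hn => ?_⟩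
    have h0 := mul_nonneg hC (hw n)
    have h1 := abs_le.mp (hN n hn.le)
    rw [Real.dist_eq, sub_zero, abs_lt]
    rcases le_total (C * w n) (R n) with h2 | h2
    · rw [min_eq_left h2, max_eq_right (by linarith)]
      constructor <;> linarith [h1.2]
    · rw [min_eq_right h2]
      rcases le_total (-(C * w n)) (R n) with h3 | h3
      · rw [max_eq_right h3]
        constructor <;> linarith
      · rw [max_eq_left h3]
        constructor <;> linarith [h1.1]

lemma exists_exp_error {L A w : ℕ → ℝ} {γ C : ℝ} (hγ : 0 < γ) (hC : 0 ≤ C) (hw : ∀ n, 0 ≤ w n)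
    (h : ∀ δ : ℝ, 0 < δ → ∀ᶠ n in atTop, L n ∈ Set.Icc
      (γ * (1 - δ) * Real.exp (A n - C * w n)) (γ * (1 + δ) * Real.exp (A n + C * w n))) :
    ∃ u v : ℕ → ℝ, (u =O[atTop] w) ∧ Tendsto v atTop (𝓝 0) ∧
      ∀ᶠ n in atTop, L n = γ * Real.exp (A n) * Real.exp (u n + v n) := by
  obtain ⟨u, v, hu, hv, huv⟩ := exists_add_of_abs_le (R := fun n => Real.log (L n / γ) - A n) hC hw
    (fun t ht => by
      have hlog : ∀ δ : ℝ, 0 < δ → δ ≤ 1 / 2 → -(2 * δ) ≤ Real.log (1 - δ) := by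
        intro δ h0 h1
        have h2 := Real.one_sub_inv_le_log_of_pos (by linarith : 0 < 1 - δ)
        refine le_trans ?_ h2
        rw [le_sub_iff_add_le, ← le_sub_iff_add_le', inv_le_comm₀ (by linarith) (by linarith)]
        rw [inv_le_iff_one_le_mul₀ (by linarith)]
        nlinarith
      -- Chosen so that log(1 - δ) ≥ -2δ ≥ -t and log(1 + δ) ≤ δ ≤ t.
      set δ := min (t / 2) (1 / 2) with hδ
      have hδ0 : 0 < δ := by positivity
      have hδ1 : δ ≤ 1 / 2 := min_le_right _ _
      have hδt : 2 * δ ≤ t := by have := min_le_left (t / 2) (1 / 2); linarith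
      filter_upwards [h δ hδ0] with n hn
      have hpos : 0 < L n := lt_of_lt_of_le
        (mul_pos (mul_pos hγ (by linarith)) (Real.exp_pos _)) hn.1
      have h1 : (1 - δ) * Real.exp (A n - C * w n) ≤ L n / γ := by
        rw [le_div_iff₀ hγ]; linarith [hn.1]
      have h2 : L n / γ ≤ (1 + δ) * Real.exp (A n + C * w n) := by
        rw [div_le_iff₀ hγ]; linarith [hn.2]
      have h3 := Real.log_le_log (mul_pos (by linarith) (Real.exp_pos _)) h1
      have h4 := Real.log_le_log (div_pos hpos hγ) h2
      rw [Real.log_mul (by linarith) (Real.exp_pos _).ne', Real.log_exp] at h3 h4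
      have h5 := hlog δ hδ0 hδ1
      have h6 := Real.log_le_sub_one_of_pos (by linarith : 0 < 1 + δ)
      rw [abs_le]
      constructor <;> linarith)
  refine ⟨u, v, hu, hv, ?_⟩
  filter_upwards [h (1 / 2) (by norm_num)] with n hn
  have hpos : 0 < L n := lt_of_lt_of_le
    (mul_pos (mul_pos hγ (by norm_num)) (Real.exp_pos _)) hn.1
  rw [← huv n, mul_assoc, ← Real.exp_add, add_sub_cancel, Real.exp_log (div_pos hpos hγ)]
  field_simp

/-- The correction is Cα²/n times α⁴/n, eventually below half of the main term κα⁴/n; the other half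
is at least q = κ/(2c⁴) because n^(1/4) ≤ cα. -/
lemma exists_one_add_mul_le {α L : ℕ → ℝ} {γ C κ : ℝ} (hγ : 0 < γ) (hκ : 0 < κ)
    (hα : α =o[atTop] fun n : ℕ => √(n : ℝ))
    (hα4 : (fun n : ℕ => (n : ℝ) ^ (1 / 4 : ℝ)) =O[atTop] α)
    (h : ∀ δ : ℝ, 0 < δ → ∀ᶠ n : ℕ in atTop,
      γ * (1 - δ) * Real.exp (κ / n * α n ^ 4 - C * (α n ^ 6 / (n : ℝ) ^ 2)) ≤ L n) :
    ∃ q : ℝ, 0 < q ∧ ∀ᶠ n in atTop, (1 + q) * γ ≤ L n := by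
  obtain ⟨c, hc, hbound⟩ := hα4.exists_pos
  set q : ℝ := κ / 2 * (c ^ 4)⁻¹ with hq
  have hq0 : 0 < q := by positivity
  refine ⟨q / 2, by positivity, ?_⟩
  have hsmall : ∀ᶠ n : ℕ in atTop, C * (α n ^ 2 / n) < κ / 2 := by
    have := (tendsto_sq_div_nat hα).const_mul C
    rw [mul_zero] at this
    exact this.eventually_lt_const (by positivity)
  -- This δ solves (1 - δ)(1 + q) = 1 + q/2.
  filter_upwards [h (q / (2 * (1 + q))) (by positivity), hsmall, hbound.bound,
    eventually_gt_atTop 0] with n hn hs hb hn0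
  have hn' : (0 : ℝ) < n := by exact_mod_cast hn0
  have h1 : (c ^ 4)⁻¹ ≤ α n ^ 4 / n := by
    rw [Real.norm_of_nonneg (by positivity), Real.norm_eq_abs] at hb
    have h2 := pow_le_pow_left₀ (by positivity) hb 4
    rw [mul_pow, ← Real.rpow_natCast, ← Real.rpow_mul hn'.le] at h2
    norm_num at h2
    rw [inv_le_iff_one_le_mul₀ (by positivity), div_mul_eq_mul_div, le_div_iff₀ hn']
    have h3 : |α n| ^ 4 = α n ^ 4 := by rw [← abs_pow, abs_of_nonneg (by positivity)]
    rw [h3] at h2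
    linarith
  have h2 : q ≤ κ / n * α n ^ 4 - C * (α n ^ 6 / (n : ℝ) ^ 2) := by
    have h3 : κ / n * α n ^ 4 - C * (α n ^ 6 / (n : ℝ) ^ 2)
        = (κ - C * (α n ^ 2 / n)) * (α n ^ 4 / n) := by field_simp
    rw [h3, hq]
    exact mul_le_mul (by linarith) h1 (by positivity) (by linarith)
  refine le_trans ?_ hn
  have h4 : 1 + q ≤ Real.exp (κ / n * α n ^ 4 - C * (α n ^ 6 / (n : ℝ) ^ 2)) := by
    have := Real.add_one_le_exp (κ / n * α n ^ 4 - C * (α n ^ 6 / (n : ℝ) ^ 2))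
    linarith
  have h5 : 1 - q / (2 * (1 + q)) = (1 + q / 2) / (1 + q) := by field_simp; ring
  calc (1 + q / 2) * γ = γ * (1 - q / (2 * (1 + q))) * (1 + q) := by rw [h5]; field_simp
    _ ≤ _ := by
      refine mul_le_mul_of_nonneg_left h4 (mul_nonneg hγ.le ?_)
      rw [h5]
      positivity

end Deduction
end NumberPartitioning

/-! ### The main theorem -/

theorem theorem3p3
    {Ω : ℕ → Type*} [∀ n, MeasurableSpace (Ω n)]
    (P : ∀ n, Measure (Ω n)) [∀ n, IsProbabilityMeasure (P n)]
    (X : ∀ n, Fin n → Ω n → ℝ)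
    (hind : ∀ n, iIndepFun (X n) (P n))
    (hlaw : ∀ n i, HasLaw (X n i) (gaussianReal 0 1) (P n))
    (α : ℕ → ℝ) (hα_nonneg : ∀ n, 0 ≤ α n)
    (hα : α =o[atTop] fun n : ℕ => √(n : ℝ)) :
    -- (i) the first moment
    (∀ t : ℝ, 0 < t →
      Tendsto
        (fun n : ℕ => ∫ ω, (NumberPartitioning.numPoints (fun i => X n i ω)
          (α n) (α n + t * NumberPartitioning.scaling n (α n)) : ℝ) ∂(P n))
        atTop (𝓝 t)) ∧
    -- (ii) the mixed factorial moments
    (∀ (m : ℕ) (c d : Fin m → ℝ) (k : Fin m → ℕ),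
      (∀ l, 0 ≤ c l) → (∀ l, c l < d l) →
      (Pairwise fun l l' => Disjoint (Set.Ioo (c l) (d l)) (Set.Ioo (c l') (d l'))) →
      (∀ l, 0 < k l) → 2 ≤ ∑ l, k l →
      ∃ u v : ℕ → ℝ,
        (u =O[atTop] fun n : ℕ => α n ^ 6 / (n : ℝ) ^ 2) ∧
        Tendsto v atTop (𝓝 0) ∧
        ∀ᶠ n : ℕ in atTop,
          ∫ ω, ∏ l, ((NumberPartitioning.numPoints (fun i => X n i ω)
              (α n + c l * NumberPartitioning.scaling n (α n))
              (α n + d l * NumberPartitioning.scaling n (α n))).descFactorial (k l) : ℝ) ∂(P n)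
            = (∏ l, (d l - c l) ^ k l)
              * Real.exp (((∑ l, k l : ℕ) : ℝ) * (((∑ l, k l : ℕ) : ℝ) - 1) / (4 * (n : ℝ))
                  * α n ^ 4)
              * Real.exp (u n + v n)) ∧
    -- (iii) the factorization fails once `α n` is of order `n ^ (1 / 4)`
    (((fun n : ℕ => (n : ℝ) ^ (1 / 4 : ℝ)) =O[atTop] α) →
      ∀ (m : ℕ) (c d : Fin m → ℝ) (k : Fin m → ℕ),
      (∀ l, 0 ≤ c l) → (∀ l, c l < d l) →
      (Pairwise fun l l' => Disjoint (Set.Ioo (c l) (d l)) (Set.Ioo (c l') (d l'))) →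
      (∀ l, 0 < k l) → 2 ≤ ∑ l, k l →
      ∃ δ : ℝ, 0 < δ ∧ ∀ᶠ n : ℕ in atTop,
        (1 + δ) * ∏ l, (d l - c l) ^ k l
          ≤ ∫ ω, ∏ l, ((NumberPartitioning.numPoints (fun i => X n i ω)
              (α n + c l * NumberPartitioning.scaling n (α n))
              (α n + d l * NumberPartitioning.scaling n (α n))).descFactorial (k l) : ℝ) ∂(P n) ∧
        (1 + δ) * ∏ l, (∫ ω, (NumberPartitioning.numPoints (fun i => X n i ω)
              (α n + c l * NumberPartitioning.scaling n (α n))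
              (α n + d l * NumberPartitioning.scaling n (α n)) : ℝ) ∂(P n)) ^ k l
          ≤ ∫ ω, ∏ l, ((NumberPartitioning.numPoints (fun i => X n i ω)
              (α n + c l * NumberPartitioning.scaling n (α n))
              (α n + d l * NumberPartitioning.scaling n (α n))).descFactorial (k l) : ℝ) ∂(P n))
  := by
  refine ⟨fun t ht => ?_, ?_, ?_⟩
  · have h := NumberPartitioning.tendsto_integral_numPoints hind hlaw hα_nonneg hα le_rfl ht.le
    simpa using h
  · intro m c d k hc hcd hdisj _ _
    obtain ⟨C, hC, h⟩ := NumberPartitioning.exists_integral_prod_descFactorial_bounds hind hlaw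
      hα_nonneg hα c d k hc hcd hdisj
    have hγ : 0 < ∏ l, (d l - c l) ^ k l :=
      Finset.prod_pos fun l _ => pow_pos (sub_pos.mpr (hcd l)) _
    exact NumberPartitioning.exists_exp_error hγ hC (fun n => by
      have := hα_nonneg n; positivity) h
  · intro hα4 m c d k hc hcd hdisj _ hk
    obtain ⟨C, hC, h⟩ := NumberPartitioning.exists_integral_prod_descFactorial_bounds hind hlaw
      hα_nonneg hα c d k hc hcd hdisj
    have hγ : 0 < ∏ l, (d l - c l) ^ k l :=
      Finset.prod_pos fun l _ => pow_pos (sub_pos.mpr (hcd l)) _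
    have hk2 : (2 : ℝ) ≤ ((∑ l, k l : ℕ) : ℝ) := by exact_mod_cast hk
    set κ : ℝ := ((∑ l, k l : ℕ) : ℝ) * (((∑ l, k l : ℕ) : ℝ) - 1) / 4 with hκ
    have hκ0 : 0 < κ := by
      have : 0 < ((∑ l, k l : ℕ) : ℝ) * (((∑ l, k l : ℕ) : ℝ) - 1) :=
        mul_pos (by linarith) (by linarith)
      positivity
    obtain ⟨q, hq, hL⟩ := NumberPartitioning.exists_one_add_mul_le hγ hκ0 hα hα4
      (fun δ hδ => (h δ hδ).mono fun n hn => by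
        rw [hκ, div_div]
        exact hn.1)
    -- The product of expectations converges to the product of the lengths; giving up half of `q`
    -- leaves room for this convergence.
    have hprod : Tendsto (fun n : ℕ => (1 + q / 2) *
        ∏ l, (∫ ω, (NumberPartitioning.numPoints (fun i => X n i ω)
              (α n + c l * NumberPartitioning.scaling n (α n))
              (α n + d l * NumberPartitioning.scaling n (α n)) : ℝ) ∂(P n)) ^ k l) atTop
        (𝓝 ((1 + q / 2) * ∏ l, (d l - c l) ^ k l)) :=
      (tendsto_finsetProd Finset.univ fun l _ =>
        (NumberPartitioning.tendsto_integral_numPoints hind hlaw hα_nonneg hα (hc l)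
          (hcd l).le).pow (k l)).const_mul _
    refine ⟨q / 2, by positivity, ?_⟩
    filter_upwards [hL, hprod.eventually_le_const
      (mul_lt_mul_of_pos_right (by linarith : 1 + q / 2 < 1 + q) hγ)] with n h1 h2
    exact ⟨(mul_le_mul_of_nonneg_right (by linarith) hγ.le).trans h1, h2.trans h1⟩
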